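/- Let $k$ be a field, $V$ a finite-dimensional $k$-vector space, $R\subseteq V^{\otimes 3}$ a subspace, and $A=\mathrm{Tens}(V)/(R)$, graded with $V$ in degree $1$. Assume that $A$ is AS-regular of global dimension $D=3$: $A$ has global dimension $3$, $\mathrm{Ext}^i_A(k,A)=0$ for $i\neq 3$, $\dim_k\mathrm{Ext}^3_A(k,A)=1$ (left modules, $k$ the trivial module), and $\dim_k A_n$ is bounded by a polynomial in $n$. Then the following hold. 1. $\dim_k V=2$. For every basis $(x_1,x_2)$ of $V$ there is a unique $2\times 2$ matrix $Q$ over $k$ (the Artin–Schelter matrix of $A$ in this basis) for which there are bases $(f_1,f_2)$ and $(g_1,g_2)$ of $R$ with $$x_1f_1+x_2f_2=g_1x_1+g_2x_2 \ \text{ in } V^{\otimes 4},\qquad (g_1\ g_2)=(f_1\ f_2)\,Q^{t};$$ $Q$ is invertible. 2. Let $E(A)=\bigoplus_i\mathrm{Ext}^i_A(k,k)$ be the Yoneda algebra, with product $x\bullet y=x\circ y$ (first $y$, then $x$). The space $E(A)_3$ is one-dimensional. Let $u^*$ be a non-zero linear form on $E(A)_3$, extended by $0$ to $E(A)$, and let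 $(x,y)=\langle x\bullet y,u^*\rangle$ be the Frobenius pairing. There is a unique $k$-algebra automorphism $\nu$ of $E(A)$ with $(x,y)=(y,\nu(x))$ for all $x,y$. There is a unique algebra automorphism $\phi$ of $A$ with $\phi(V)\subseteq V$ whose restriction $\phi_1:V\to V$ is the transpose of $\nu_1=\nu|_{E(A)_1}$, where $E(A)_1=\mathrm{Ext}^1_A(k,k)$ is canonically identified with $V^*$. 3. For every basis $(x_1,x_2)$ of $V$, with Artin–Schelter matrix $Q$, the map $\phi_1$ has the matrix form $X\mapsto (Q^{-1})^{t}X$, where $X$ is the column with entries $x_1,x_2$; that is, $\phi_1(x_i)=\sum_j \big((Q^{-1})^t\big)_{ij}\,x_j$. 4. Let $\varepsilon$ be the automorphism of $A$ which is multiplication by $(-1)^m$ on $A_m$. Then $\varepsilon^{D+1}\phi=\mathrm{id}_A$ if and only if $A$ is of type A, i.e. there is a basis of $V$ in which the Artin–Schelter matrix of $A$ is the identity matrix. -/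

import Mathlib

open CategoryTheory CategoryTheory.Abelian

universe u

noncomputable section

/-- A space of relations of an `N`-homogeneous algebra on `V`, with `2 ≤ N`: a subspace `R` of
`V^{⊗N}`, viewed inside the tensor algebra, whose component of degree `N` is the `N`-th power of
the submodule `V`. -/
structure HomogeneousRelations (k V : Type u) [Field k] [AddCommGroup V] [Module k V] (N : ℕ) where
  /-- The space of relations. -/
  space : Submodule k (TensorAlgebra k V)
  two_le : 2 ≤ N
  space_le : space ≤ (LinearMap.range (TensorAlgebra.ι k (M := V))) ^ N

namespace HomogeneousRelations

section

variable {k V : Type u} [Field k] [AddCommGroup V] [Module k V] {N : ℕ}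

/-- The `N`-homogeneous algebra `A = Tens(V) / I(R)`. -/
def Alg (R : HomogeneousRelations k V N) : Type u :=
  RingQuot (fun a b : TensorAlgebra k V => a ∈ R.space ∧ b = 0)

variable (R : HomogeneousRelations k V N)

instance : Ring R.Alg :=
  inferInstanceAs (Ring (RingQuot (fun a b : TensorAlgebra k V => a ∈ R.space ∧ b = 0)))

instance : Algebra k R.Alg :=
  inferInstanceAs (Algebra k (RingQuot (fun a b : TensorAlgebra k V => a ∈ R.space ∧ b = 0)))

/-- The projection `Tens(V) → A`. -/
def proj : TensorAlgebra k V →ₐ[k] R.Alg :=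
  RingQuot.mkAlgHom k (fun a b : TensorAlgebra k V => a ∈ R.space ∧ b = 0)

/-- The canonical map `V → A`. -/
def gen : V →ₗ[k] R.Alg := R.proj.toLinearMap ∘ₗ TensorAlgebra.ι k

/-- The homogeneous component `A_n`, the image of `V^{⊗n}` in `A`. -/
def component (n : ℕ) : Submodule k R.Alg := (LinearMap.range R.gen) ^ n

lemma proj_eq_zero {r : TensorAlgebra k V} (hr : r ∈ R.space) : R.proj r = 0 := by
  have h := RingQuot.mkAlgHom_rel k (s := fun a b : TensorAlgebra k V => a ∈ R.space ∧ b = 0)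
    (x := r) (y := 0) ⟨hr, rfl⟩
  rw [map_zero] at h
  exact h

/-- Universal property of `A`: a linear map `V → B` whose extension to `Tens(V)` kills `R` extends
to an algebra morphism `A → B`. -/
def lift {B : Type*} [Ring B] [Algebra k B] (f : V →ₗ[k] B)
    (hf : ∀ r ∈ R.space, TensorAlgebra.lift k f r = 0) : R.Alg →ₐ[k] B :=
  RingQuot.liftAlgHom k (s := fun a b : TensorAlgebra k V => a ∈ R.space ∧ b = 0)
    ⟨TensorAlgebra.lift k f, by rintro x y ⟨hx, rfl⟩; rw [hf x hx, map_zero]⟩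

lemma lift_gen {B : Type*} [Ring B] [Algebra k B] (f : V →ₗ[k] B)
    (hf : ∀ r ∈ R.space, TensorAlgebra.lift k f r = 0) (v : V) :
    R.lift f hf (R.gen v) = f v := by
  have h := RingQuot.liftAlgHom_mkAlgHom_apply (S := k) (TensorAlgebra.lift k f)
    (s := fun a b : TensorAlgebra k V => a ∈ R.space ∧ b = 0)
    (by rintro x y ⟨hx, rfl⟩; rw [hf x hx, map_zero]) (TensorAlgebra.ι k v)
  rw [TensorAlgebra.lift_ι_apply] at h
  exact h

lemma algHom_ext {B : Type*} [Ring B] [Algebra k B] {f g : R.Alg →ₐ[k] B}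
    (h : ∀ v, f (R.gen v) = g (R.gen v)) : f = g := by
  have h2 : f.comp R.proj = g.comp R.proj := by
    apply TensorAlgebra.hom_ext
    ext v
    exact h v
  exact RingQuot.ringQuot_ext' k (s := fun a b : TensorAlgebra k V => a ∈ R.space ∧ b = 0) f g h2

lemma lift_mem_pow {B : Type*} [Ring B] [Algebra k B] (f : V →ₗ[k] B)
    {r : TensorAlgebra k V} (hr : r ∈ R.space) :
    TensorAlgebra.lift k f r ∈ (LinearMap.range f) ^ N := by
  have h : TensorAlgebra.lift k f r ∈
      ((LinearMap.range (TensorAlgebra.ι k (M := V))) ^ N).map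
        (TensorAlgebra.lift k f).toLinearMap := ⟨r, R.space_le hr, rfl⟩
  rw [Submodule.map_pow, ← LinearMap.range_comp] at h
  have hfc : (TensorAlgebra.lift k f).toLinearMap ∘ₗ TensorAlgebra.ι k = f := by
    ext v
    simp
  rwa [hfc] at h

lemma lift_eq_zero_of_sq {B : Type*} [Ring B] [Algebra k B] (f : V →ₗ[k] B)
    (hf : ∀ v w, f v * f w = 0) {r : TensorAlgebra k V} (hr : r ∈ R.space) :
    TensorAlgebra.lift k f r = 0 := by
  have h := R.lift_mem_pow f hr
  obtain ⟨m, rfl⟩ := Nat.exists_eq_add_of_le R.two_le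
  have h2 : (LinearMap.range f) ^ 2 = (⊥ : Submodule k B) := by
    rw [pow_two, eq_bot_iff, Submodule.mul_le]
    rintro _ ⟨v, rfl⟩ _ ⟨w, rfl⟩
    rw [hf v w]
    exact Submodule.zero_mem _
  rw [pow_add, h2, Submodule.bot_mul] at h
  exact (Submodule.mem_bot k).1 h

lemma lift_neg_apply {x : TensorAlgebra k V} {n : ℕ}
    (hx : x ∈ (LinearMap.range (TensorAlgebra.ι k (M := V))) ^ n) :
    TensorAlgebra.lift k (-R.gen) x = (-1 : k) ^ n • R.proj x := by
  induction hx using Submodule.pow_induction_on_left' with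
  | algebraMap r => simp
  | add x y i hx hy h1 h2 => rw [map_add, map_add, h1, h2, smul_add]
  | mem_mul m hm i x hx ih =>
    obtain ⟨v, rfl⟩ := hm
    rw [map_mul, map_mul, ih, TensorAlgebra.lift_ι_apply]
    change -(R.proj (TensorAlgebra.ι k v)) * _ = _
    rw [pow_succ']
    simp

/-- The automorphism `ε` of `A`, which sends `v ∈ V` to `-v`, i.e. which is the multiplication by
`(-1)^m` on `A_m`. -/
def parity : R.Alg ≃ₐ[k] R.Alg :=
  AlgEquiv.ofAlgHom
    (R.lift (-R.gen) fun r hr => by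
      rw [R.lift_neg_apply (R.space_le hr), R.proj_eq_zero hr, smul_zero])
    (R.lift (-R.gen) fun r hr => by
      rw [R.lift_neg_apply (R.space_le hr), R.proj_eq_zero hr, smul_zero])
    (R.algHom_ext fun v => by simp [lift_gen])
    (R.algHom_ext fun v => by simp [lift_gen])

lemma parity_gen (v : V) : R.parity (R.gen v) = -R.gen v := R.lift_gen _ _ v

lemma parity_apply {m : ℕ} {a : R.Alg} (ha : a ∈ R.component m) :
    R.parity a = (-1 : k) ^ m • a := by
  unfold component at ha
  induction ha using Submodule.pow_induction_on_left' with
  | algebraMap r => simp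
  | add x y i hx hy h1 h2 => rw [map_add, h1, h2, smul_add]
  | mem_mul m hm i x hx ih =>
    obtain ⟨v, rfl⟩ := hm
    rw [map_mul, ih, parity_gen, pow_succ']
    simp

/-- The augmentation `A → k`, which sends `V` to `0`. -/
def augmentation : R.Alg →ₐ[k] k :=
  R.lift 0 fun _ hr => R.lift_eq_zero_of_sq 0 (by simp) hr

/-- The trivial left `A`-module `k`. -/
def TrivialModule (_ : HomogeneousRelations k V N) : Type u := k

instance : AddCommGroup R.TrivialModule := inferInstanceAs (AddCommGroup k)

instance : Module R.Alg R.TrivialModule := Module.compHom k R.augmentation.toRingHom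

/-- The trivial module `k` as an object of the category of left `A`-modules. -/
abbrev trivialObj : ModuleCat.{u} R.Alg := ModuleCat.of R.Alg R.TrivialModule

/-- `E(A)_n = Ext_A^n(k, k)`. -/
abbrev ExtK (n : ℕ) : Type u := Ext.{u} R.trivialObj R.trivialObj n

lemma extK_mk_eq {n m : ℕ} (h : n = m) (x : R.ExtK n) (y : R.ExtK m)
    (hxy : x.comp (Ext.mk₀ (𝟙 R.trivialObj)) (show n + 0 = m by omega) = y) :
    (GradedMonoid.mk n x : GradedMonoid R.ExtK) = GradedMonoid.mk m y := by
  subst h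
  rw [Ext.comp_mk₀_id] at hxy
  rw [hxy]

/-- The Yoneda product: `f • g` is the composite `f ∘ g`, that is `g : k → k[j]` followed by
`f : k → k[i]`. -/
instance : GradedMonoid.GMul R.ExtK where
  mul {i j} f g := g.comp f (Nat.add_comm j i)

instance : GradedMonoid.GOne R.ExtK where
  one := Ext.mk₀ (𝟙 R.trivialObj)

instance : DirectSum.GRing R.ExtK where
  mul_zero a := Ext.zero_comp _ _ a _ _
  zero_mul b := Ext.comp_zero b _ _ _ _
  mul_add _ _ _ := Ext.add_comp _ _ _ _
  add_mul _ _ _ := Ext.comp_add _ _ _ _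
  one_mul := by
    rintro ⟨n, a⟩
    refine R.extK_mk_eq (Nat.zero_add n) _ _ ?_
    change (a.comp (Ext.mk₀ (𝟙 R.trivialObj)) _).comp (Ext.mk₀ (𝟙 R.trivialObj)) _ = a
    rw [Ext.comp_assoc _ _ _ _ (add_zero 0) (by omega)]
    simp
  mul_one := by
    rintro ⟨n, a⟩
    refine R.extK_mk_eq (Nat.add_zero n) _ _ ?_
    change ((Ext.mk₀ (𝟙 R.trivialObj)).comp a _).comp (Ext.mk₀ (𝟙 R.trivialObj)) _ = a
    rw [Ext.mk₀_id_comp, Ext.comp_mk₀_id]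
  mul_assoc := by
    rintro ⟨n, a⟩ ⟨m, b⟩ ⟨l, c⟩
    refine R.extK_mk_eq (Nat.add_assoc n m l) _ _ ?_
    change (c.comp (b.comp a (Nat.add_comm m n)) (Nat.add_comm l (n + m))).comp
      (Ext.mk₀ (𝟙 R.trivialObj)) _ = (c.comp b (Nat.add_comm l m)).comp a (Nat.add_comm (m + l) n)
    rw [Ext.comp_assoc c (b.comp a _) (Ext.mk₀ (𝟙 R.trivialObj)) _
      (show n + m + 0 = n + m by omega) (by omega),
      Ext.comp_mk₀_id, Ext.comp_assoc c b a _ _ (by omega)]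
  natCast n := n • Ext.mk₀ (𝟙 R.trivialObj)
  natCast_zero := zero_smul _ _
  natCast_succ n := succ_nsmul _ n
  intCast n := n • Ext.mk₀ (𝟙 R.trivialObj)
  intCast_ofNat n := natCast_zsmul _ n
  intCast_negSucc_ofNat n := negSucc_zsmul _ n

/-- The Yoneda algebra `E(A) = ⨁ₙ Ext_A^n(k, k)`. -/
abbrev Yoneda : Type u := DirectSum ℕ R.ExtK

lemma yoneda_smul_mul (c : k) (x y : R.Yoneda) : (c • x) * y = c • (x * y) := by
  induction x using DirectSum.induction_on with
  | zero => simp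
  | add a b ha hb => rw [smul_add, add_mul, ha, hb, add_mul, smul_add]
  | of i a =>
    induction y using DirectSum.induction_on with
    | zero => simp
    | add a b ha hb => rw [mul_add, ha, hb, mul_add, smul_add]
    | of j b =>
      change (c • DirectSum.lof k ℕ R.ExtK i a) * _ = c • _
      rw [← map_smul]
      change DirectSum.of R.ExtK i (c • a) * DirectSum.of R.ExtK j b = _
      rw [DirectSum.of_mul_of, DirectSum.of_mul_of]
      change _ = c • DirectSum.lof k ℕ R.ExtK _ _
      rw [← map_smul]
      change DirectSum.of R.ExtK _ (b.comp (c • a) _) = DirectSum.of R.ExtK _ (c • b.comp a _)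
      rw [Ext.comp_smul]

lemma yoneda_mul_smul (c : k) (x y : R.Yoneda) : x * (c • y) = c • (x * y) := by
  induction x using DirectSum.induction_on with
  | zero => simp
  | add a b ha hb => rw [add_mul, ha, hb, add_mul, smul_add]
  | of i a =>
    induction y using DirectSum.induction_on with
    | zero => simp
    | add a b ha hb => rw [smul_add, mul_add, ha, hb, mul_add, smul_add]
    | of j b =>
      change _ * (c • DirectSum.lof k ℕ R.ExtK j b) = c • _
      rw [← map_smul]
      change DirectSum.of R.ExtK i a * DirectSum.of R.ExtK j (c • b) = _
      rw [DirectSum.of_mul_of, DirectSum.of_mul_of]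
      change _ = c • DirectSum.lof k ℕ R.ExtK _ _
      rw [← map_smul]
      change DirectSum.of R.ExtK _ ((c • b).comp a _) = DirectSum.of R.ExtK _ (c • b.comp a _)
      rw [Ext.smul_comp]

instance : Algebra k R.Yoneda := Algebra.ofModule R.yoneda_smul_mul R.yoneda_mul_smul

/-- The augmentation ideal `A_{≥1}`, the left `A`-module which is the kernel of `A → k`. -/
abbrev augIdeal : Ideal R.Alg := RingHom.ker R.augmentation

/-- The augmentation as a map of left `A`-modules. -/
def augmentationLin : R.Alg →ₗ[R.Alg] R.TrivialModule where
  toFun a := R.augmentation a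
  map_add' := map_add R.augmentation
  map_smul' := map_mul R.augmentation

/-- The sequence `0 → A_{≥1} → A → k → 0` of left `A`-modules. -/
def augSequence : ShortComplex (ModuleCat.{u} R.Alg) :=
  ShortComplex.mk (ModuleCat.ofHom R.augIdeal.subtype) (ModuleCat.ofHom R.augmentationLin) (by
    ext a
    exact a.2)

lemma augSequence_shortExact : R.augSequence.ShortExact where
  exact := by
    rw [ShortComplex.moduleCat_exact_iff]
    intro a ha
    exact ⟨⟨a, ha⟩, rfl⟩
  mono_f := by
    rw [ModuleCat.mono_iff_injective]
    exact Subtype.val_injective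
  epi_g := by
    rw [ModuleCat.epi_iff_surjective]
    intro c
    exact ⟨algebraMap k R.Alg c, R.augmentation.commutes c⟩

/-- The algebra morphism `A → k[ε]`, `ε² = 0`, sending `v ∈ V` to `ξ(v) ε`. -/
def dualNumberHom (ξ : Module.Dual k V) : R.Alg →ₐ[k] DualNumber k :=
  R.lift (TrivSqZeroExt.inrHom k k ∘ₗ ξ) fun _ hr =>
    R.lift_eq_zero_of_sq _ (fun v w => TrivSqZeroExt.inr_mul_inr k (ξ v) (ξ w)) hr

lemma fst_dualNumberHom (ξ : Module.Dual k V) (a : R.Alg) :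
    (R.dualNumberHom ξ a).fst = R.augmentation a := by
  have h : (TrivSqZeroExt.fstHom k k k).comp (R.dualNumberHom ξ) = R.augmentation :=
    R.algHom_ext fun v => by simp [dualNumberHom, augmentation, lift_gen]
  exact DFunLike.congr_fun h a

/-- The left `A`-linear map `A_{≥1} → k` which extends the linear form `ξ` on `V` (and vanishes on
`A_m` for `m ≥ 2`). -/
def extendForm (ξ : Module.Dual k V) : R.augIdeal →ₗ[R.Alg] R.TrivialModule where
  toFun a := (R.dualNumberHom ξ a).snd
  map_add' a b := by
    rw [Submodule.coe_add, map_add, TrivSqZeroExt.snd_add]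
    rfl
  map_smul' a b := by
    have hb : R.augmentation (b : R.Alg) = 0 := b.2
    rw [Submodule.coe_smul, smul_eq_mul, map_mul, TrivSqZeroExt.snd_mul, fst_dualNumberHom,
      fst_dualNumberHom, hb, MulOpposite.op_zero, zero_smul, add_zero]
    rfl

lemma extendForm_gen (ξ : Module.Dual k V) (v : V) (hv : R.gen v ∈ R.augIdeal) :
    R.extendForm ξ ⟨R.gen v, hv⟩ = (ξ v : k) := by
  change (R.dualNumberHom ξ (R.gen v)).snd = ξ v
  rw [dualNumberHom, lift_gen]
  simp

/-- The canonical identification `V^* → E(A)_1 = Ext_A^1(k, k)`: it sends a linear form `ξ` to the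
image of its extension `A_{≥1} → k` under the connecting map of `0 → A_{≥1} → A → k → 0`. -/
def degreeOne (ξ : Module.Dual k V) : R.ExtK 1 :=
  R.augSequence_shortExact.extClass.comp (Ext.mk₀ (ModuleCat.ofHom (R.extendForm ξ)))
    (add_zero 1)

/-- The algebra `A` has (left) global dimension `D`: the maximum of the projective dimensions of
the left `A`-modules is `D`. -/
def HasGlobalDimension (D : ℕ) : Prop :=
  (∀ M : ModuleCat.{u} R.Alg, projectiveDimension M ≤ D) ∧
    ∃ M : ModuleCat.{u} R.Alg, projectiveDimension M = D

/-- `A` is AS-regular (with polynomial growth) of global dimension `D`: it is of global dimension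
`D`, the space `Ext_A^i(k, A)` vanishes for `i ≠ D` and is one-dimensional for `i = D`, and
`dim A_n` is bounded by a polynomial in `n`. -/
structure IsASRegular (D : ℕ) : Prop where
  globalDimension : R.HasGlobalDimension D
  ext_eq_zero : ∀ i, i ≠ D → Subsingleton (Ext.{u} R.trivialObj (ModuleCat.of R.Alg R.Alg) i)
  finrank_ext : Module.finrank k (Ext.{u} R.trivialObj (ModuleCat.of R.Alg R.Alg) D) = 1
  polynomial_growth : ∃ c d : ℕ, ∀ n, 1 ≤ n → Module.finrank k (R.component n) ≤ c * n ^ d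

/-- The Frobenius pairing `(x, y) = ⟨x • y, u^*⟩` on `E(A)`, attached to a linear form `u^*` on
`E(A)_D` (which is extended by zero to the other components of `E(A)`). -/
def frobeniusPairing {D : ℕ} (uStar : Module.Dual k (R.ExtK D)) (x y : R.Yoneda) : k :=
  uStar ((x * y) D)

/-- The algebra automorphism `ν` of `E(A)` satisfies `(x, y) = (y, ν x)` for the Frobenius
pairing. -/
def IsFrobeniusAutomorphism {D : ℕ} (uStar : Module.Dual k (R.ExtK D))
    (ν : R.Yoneda ≃ₐ[k] R.Yoneda) : Prop :=
  ∀ x y : R.Yoneda, R.frobeniusPairing uStar x y = R.frobeniusPairing uStar y (ν x)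

/-- The automorphism `φ` of the graded algebra `A` is induced by the linear map `φ₁ : V → V` whose
transposed map is the component `ν₁ : V^* → V^*` of `ν`, i.e. `ν₁ ξ = ξ ∘ φ₁`. -/
def IsTransposedAutomorphism (ν : R.Yoneda ≃ₐ[k] R.Yoneda) (φ : R.Alg ≃ₐ[k] R.Alg) : Prop :=
  ∃ φ₁ : V →ₗ[k] V, (∀ v, φ (R.gen v) = R.gen (φ₁ v)) ∧
    ∀ ξ : Module.Dual k V, ν (DirectSum.of R.ExtK 1 (R.degreeOne ξ)) =
      DirectSum.of R.ExtK 1 (R.degreeOne (ξ ∘ₗ φ₁))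

/-- `Q` is the Artin–Schelter matrix of `A` in the basis `(x₀, x₁)` of `V`: there are bases
`(f₀, f₁)` and `(g₀, g₁)` of `R` such that `w = x₀ f₀ + x₁ f₁ = g₀ x₀ + g₁ x₁` in the tensor
algebra and `(g₀ g₁) = (f₀ f₁) Qᵗ`. -/
def IsArtinSchelterMatrix (x : Module.Basis (Fin 2) k V) (Q : Matrix (Fin 2) (Fin 2) k) : Prop :=
  ∃ f g : Module.Basis (Fin 2) k R.space,
    ∑ i, TensorAlgebra.ι k (x i) * (f i : TensorAlgebra k V) =
      ∑ i, (g i : TensorAlgebra k V) * TensorAlgebra.ι k (x i) ∧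
    ∀ i, g i = ∑ j, Q.transpose j i • f j

/-- `A` is of type A: its Artin–Schelter matrix is the identity matrix. (The Artin–Schelter matrix
is replaced by a conjugate one if the basis of `V` is changed.) -/
def IsTypeA : Prop := ∃ x : Module.Basis (Fin 2) k V, R.IsArtinSchelterMatrix x 1

end

end HomogeneousRelations

end

/-! The trivial module has a projective resolution starting `A ⊗ R → A ⊗ V → A → k`, whose maps are
given by the Fox derivatives of the relations and by the generators. Let `K` be the kernel of `A ⊗ R
→ A ⊗ V`. Global dimension 3 makes `K` projective. The conditions on `Ext²(k, A)` and `Ext³(k, A)`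
then force `K` to be free on one vector `(y₁, …, y_r)` of degree one whose entries form a basis of
`V` (`IsASRegular.exists_isKernelBasis`). Hence `dim V = dim R = n`, and the Hilbert series of `A`
is `1 / (1 - n t + n t³ - t⁴)`. Polynomial growth excludes `n ≥ 3`, and small degrees exclude `n ≤
1` (`eq_two_of_cubic_recurrence`).

Everything else is read off the potential `w = ∑ yⱼ fⱼ` in `V^{⊗4}`, where `(fⱼ)` is a basis of `R`.
It spans `V ⊗ R ∩ R ⊗ V`, and contracting its first or its last letter gives two isomorphisms `L, D
: V^* → R` (`IsKernelBasis.isPotential`). In a basis of `V`, the Artin–Schelter matrix expresses `D`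
in terms of `L`; it is unique because `w` is unique up to a scalar.

On the other side, `E(A) = k ⊕ V^* ⊕ R^* ⊕ k`. Chain lifts give `ξ • η = η(L ξ)` and `η • ξ = η(D
ξ)`, as multiples of one generator of `E(A)_3` (`IsKernelBasis.degreeTwo_comp_degreeOne`,
`IsKernelBasis.degreeOne_comp_degreeTwo`). So the pairing is nondegenerate and `ν₁ = D⁻¹ L`, whose
transpose `θ` has the matrix `(Q⁻¹)ᵗ`. It extends to `A` because `w` is invariant under `θ⁻¹`
(`mapEnd_eq_self`) and `R` is the space of contractions of `w`. Finally `ε⁴ = 1`, so the last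
condition says `φ = id`, that is `Q = 1`. -/

noncomputable section

/-! ### Contraction of the first and of the last letter in the tensor algebra. -/

namespace TensorAlgebra

variable {k V : Type u} [Field k] [AddCommGroup V] [Module k V]

variable (k V) in
/-- The component `V^{⊗m}` of the tensor algebra. -/
abbrev homogeneous (m : ℕ) : Submodule k (TensorAlgebra k V) :=
  (LinearMap.range (ι k (M := V))) ^ m

lemma ι_mem_homogeneous (v : V) : ι k v ∈ homogeneous k V 1 := by
  rw [homogeneous, pow_one]
  exact ⟨v, rfl⟩

lemma mul_mem_homogeneous {s t : TensorAlgebra k V} {a b : ℕ} (hs : s ∈ homogeneous k V a)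
    (ht : t ∈ homogeneous k V b) : s * t ∈ homogeneous k V (a + b) := by
  rw [homogeneous, pow_add]
  exact Submodule.mul_mem_mul hs ht

/-- Induction on `V^{⊗(m+1)} = V^{⊗m} ⊗ V`. -/
lemma homogeneous_succ_induction_right {m : ℕ} {p : TensorAlgebra k V → Prop}
    (h1 : ∀ t ∈ homogeneous k V m, ∀ v : V, p (t * ι k v)) (h2 : ∀ s t, p s → p t → p (s + t))
    {t : TensorAlgebra k V} (ht : t ∈ homogeneous k V (m + 1)) : p t := by
  rw [homogeneous, pow_succ] at ht
  induction ht using Submodule.mul_induction_on' with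
  | mem_mul_mem s hs t ht =>
    obtain ⟨v, rfl⟩ := ht
    exact h1 s hs v
  | add s _ t _ hs ht => exact h2 _ _ hs ht

/-- Induction on `V^{⊗(m+1)} = V ⊗ V^{⊗m}`. -/
lemma homogeneous_succ_induction_left {m : ℕ} {p : TensorAlgebra k V → Prop}
    (h1 : ∀ t ∈ homogeneous k V m, ∀ v : V, p (ι k v * t)) (h2 : ∀ s t, p s → p t → p (s + t))
    {t : TensorAlgebra k V} (ht : t ∈ homogeneous k V (m + 1)) : p t := by
  rw [homogeneous, pow_succ'] at ht
  induction ht using Submodule.mul_induction_on' with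
  | mem_mul_mem s hs t ht =>
    obtain ⟨v, rfl⟩ := hs
    exact h1 t ht v
  | add s _ t _ hs ht => exact h2 _ _ hs ht

lemma mem_homogeneous_zero {t : TensorAlgebra k V} (ht : t ∈ homogeneous k V 0) :
    ∃ c : k, algebraMap k _ c = t := by
  rw [homogeneous, pow_zero] at ht
  exact Submodule.mem_one.1 ht

lemma algebraMapInv_eq_zero {t : TensorAlgebra k V} {m : ℕ} (ht : t ∈ homogeneous k V (m + 1)) :
    algebraMapInv t = (0 : k) := by
  refine homogeneous_succ_induction_right (p := fun t => algebraMapInv t = (0 : k)) ?_ ?_ ht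
  · intro t _ v
    simp [algebraMapInv]
  · intro s t hs ht
    simp [hs, ht]

/-- The algebra morphism `t ↦ !![t, D t; 0, ε t]`, where `D` contracts the last letter. -/
def rightMatrixHom (ξ : Module.Dual k V) :
    TensorAlgebra k V →ₐ[k] Matrix (Fin 2) (Fin 2) (TensorAlgebra k V) :=
  lift k
    { toFun := fun v => !![ι k v, algebraMap k _ (ξ v); 0, 0]
      map_add' := fun v w => by ext i j; fin_cases i <;> fin_cases j <;> simp
      map_smul' := fun c v => by
        ext i j; fin_cases i <;> fin_cases j <;> simp [Algebra.smul_def] }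

/-- The algebra morphism `t ↦ !![ε t, L t; 0, t]`, where `L` contracts the first letter. -/
def leftMatrixHom (ξ : Module.Dual k V) :
    TensorAlgebra k V →ₐ[k] Matrix (Fin 2) (Fin 2) (TensorAlgebra k V) :=
  lift k
    { toFun := fun v => !![0, algebraMap k _ (ξ v); 0, ι k v]
      map_add' := fun v w => by ext i j; fin_cases i <;> fin_cases j <;> simp
      map_smul' := fun c v => by
        ext i j; fin_cases i <;> fin_cases j <;> simp [Algebra.smul_def] }

/-- The matrices are upper triangular with diagonal `(t, ε t)`, so multiplicativity of the morphism
makes the corner entry a twisted derivation: this is the source of `rightContract_mul`. -/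
lemma rightMatrixHom_apply (ξ : Module.Dual k V) (t : TensorAlgebra k V) :
    rightMatrixHom ξ t 0 0 = t ∧ rightMatrixHom ξ t 1 0 = 0 ∧
      rightMatrixHom ξ t 1 1 = algebraMap k _ (algebraMapInv t) := by
  induction t using TensorAlgebra.induction with
  | algebraMap r => simp [Matrix.algebraMap_matrix_apply, algebraMapInv]
  | ι v => simp [rightMatrixHom, algebraMapInv]
  | mul a b ha hb =>
    simp [Matrix.mul_apply, Fin.sum_univ_two, ha.1, ha.2.1, ha.2.2, hb.1, hb.2.1, hb.2.2]
  | add a b ha hb => simp [ha.1, ha.2.1, ha.2.2, hb.1, hb.2.1, hb.2.2]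

lemma leftMatrixHom_apply (ξ : Module.Dual k V) (t : TensorAlgebra k V) :
    leftMatrixHom ξ t 1 1 = t ∧ leftMatrixHom ξ t 1 0 = 0 ∧
      leftMatrixHom ξ t 0 0 = algebraMap k _ (algebraMapInv t) := by
  induction t using TensorAlgebra.induction with
  | algebraMap r => simp [Matrix.algebraMap_matrix_apply, algebraMapInv]
  | ι v => simp [leftMatrixHom, algebraMapInv]
  | mul a b ha hb =>
    simp [Matrix.mul_apply, Fin.sum_univ_two, ha.1, ha.2.1, ha.2.2, hb.1, hb.2.1, hb.2.2]
  | add a b ha hb => simp [ha.1, ha.2.1, ha.2.2, hb.1, hb.2.1, hb.2.2]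

/-- Contraction of the last letter with a linear form. -/
def rightContract (ξ : Module.Dual k V) : TensorAlgebra k V →ₗ[k] TensorAlgebra k V where
  toFun t := rightMatrixHom ξ t 0 1
  map_add' s t := by simp
  map_smul' c t := by simp

/-- Contraction of the first letter with a linear form. -/
def leftContract (ξ : Module.Dual k V) : TensorAlgebra k V →ₗ[k] TensorAlgebra k V where
  toFun t := leftMatrixHom ξ t 0 1
  map_add' s t := by simp
  map_smul' c t := by simp

lemma rightContract_mul (ξ : Module.Dual k V) (s t : TensorAlgebra k V) :
    rightContract ξ (s * t) = s * rightContract ξ t + algebraMapInv t • rightContract ξ s := by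
  change rightMatrixHom ξ (s * t) 0 1 = s * rightMatrixHom ξ t 0 1 + _ • rightMatrixHom ξ s 0 1
  rw [map_mul, Matrix.mul_apply, Fin.sum_univ_two, (rightMatrixHom_apply ξ s).1,
    (rightMatrixHom_apply ξ t).2.2, Algebra.smul_def, Algebra.commutes]

lemma leftContract_mul (ξ : Module.Dual k V) (s t : TensorAlgebra k V) :
    leftContract ξ (s * t) = algebraMapInv s • leftContract ξ t + leftContract ξ s * t := by
  change leftMatrixHom ξ (s * t) 0 1 = _ • leftMatrixHom ξ t 0 1 + leftMatrixHom ξ s 0 1 * t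
  rw [map_mul, Matrix.mul_apply, Fin.sum_univ_two, (leftMatrixHom_apply ξ t).1,
    (leftMatrixHom_apply ξ s).2.2, Algebra.smul_def]

lemma rightContract_ι (ξ : Module.Dual k V) (v : V) :
    rightContract ξ (ι k v) = algebraMap k _ (ξ v) := by
  change rightMatrixHom ξ (ι k v) 0 1 = _
  simp [rightMatrixHom]

lemma leftContract_ι (ξ : Module.Dual k V) (v : V) :
    leftContract ξ (ι k v) = algebraMap k _ (ξ v) := by
  change leftMatrixHom ξ (ι k v) 0 1 = _
  simp [leftMatrixHom]

lemma rightContract_mul_ι (ξ : Module.Dual k V) (t : TensorAlgebra k V) (v : V) :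
    rightContract ξ (t * ι k v) = ξ v • t := by
  rw [rightContract_mul, rightContract_ι, Algebra.smul_def (ξ v), Algebra.commutes]
  simp [algebraMapInv]

lemma leftContract_ι_mul (ξ : Module.Dual k V) (t : TensorAlgebra k V) (v : V) :
    leftContract ξ (ι k v * t) = ξ v • t := by
  rw [leftContract_mul, leftContract_ι, Algebra.smul_def (ξ v)]
  simp [algebraMapInv]

lemma rightContract_algebraMap (ξ : Module.Dual k V) (c : k) :
    rightContract ξ (algebraMap k (TensorAlgebra k V) c) = 0 := by
  change rightMatrixHom ξ (algebraMap k _ c) 0 1 = 0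
  simp [Matrix.algebraMap_matrix_apply]

lemma leftContract_algebraMap (ξ : Module.Dual k V) (c : k) :
    leftContract ξ (algebraMap k (TensorAlgebra k V) c) = 0 := by
  change leftMatrixHom ξ (algebraMap k _ c) 0 1 = 0
  simp [Matrix.algebraMap_matrix_apply]

lemma rightContract_add (ξ η : Module.Dual k V) (t : TensorAlgebra k V) :
    rightContract (ξ + η) t = rightContract ξ t + rightContract η t := by
  induction t using TensorAlgebra.induction with
  | algebraMap r => simp [rightContract_algebraMap]
  | ι v => simp [rightContract_ι]
  | mul a b ha hb => simp only [rightContract_mul, ha, hb, mul_add, smul_add]; abel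
  | add a b ha hb => simp only [map_add, ha, hb]; abel

lemma leftContract_add (ξ η : Module.Dual k V) (t : TensorAlgebra k V) :
    leftContract (ξ + η) t = leftContract ξ t + leftContract η t := by
  induction t using TensorAlgebra.induction with
  | algebraMap r => simp [leftContract_algebraMap]
  | ι v => simp [leftContract_ι]
  | mul a b ha hb => simp only [leftContract_mul, ha, hb, add_mul, smul_add]; abel
  | add a b ha hb => simp only [map_add, ha, hb]; abel

lemma rightContract_smul (c : k) (ξ : Module.Dual k V) (t : TensorAlgebra k V) :
    rightContract (c • ξ) t = c • rightContract ξ t := by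
  induction t using TensorAlgebra.induction with
  | algebraMap r => simp [rightContract_algebraMap]
  | ι v => simp [rightContract_ι, Algebra.smul_def]
  | mul a b ha hb =>
    simp only [rightContract_mul, ha, hb, mul_smul_comm, smul_add, smul_comm (algebraMapInv b) c]
  | add a b ha hb => simp only [map_add, ha, hb, smul_add]

lemma leftContract_smul (c : k) (ξ : Module.Dual k V) (t : TensorAlgebra k V) :
    leftContract (c • ξ) t = c • leftContract ξ t := by
  induction t using TensorAlgebra.induction with
  | algebraMap r => simp [leftContract_algebraMap]
  | ι v => simp [leftContract_ι, Algebra.smul_def]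
  | mul a b ha hb =>
    simp only [leftContract_mul, ha, hb, smul_mul_assoc, smul_add, smul_comm (algebraMapInv a) c]
  | add a b ha hb => simp only [map_add, ha, hb, smul_add]

lemma rightContract_mul_of_mem (ξ : Module.Dual k V) (s : TensorAlgebra k V)
    {t : TensorAlgebra k V} {m : ℕ} (ht : t ∈ homogeneous k V (m + 1)) :
    rightContract ξ (s * t) = s * rightContract ξ t := by
  rw [rightContract_mul, algebraMapInv_eq_zero ht, zero_smul, add_zero]

lemma leftContract_mul_of_mem (ξ : Module.Dual k V) {s : TensorAlgebra k V}
    (t : TensorAlgebra k V) {m : ℕ} (hs : s ∈ homogeneous k V (m + 1)) :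
    leftContract ξ (s * t) = leftContract ξ s * t := by
  rw [leftContract_mul, algebraMapInv_eq_zero hs, zero_smul, zero_add]

lemma rightContract_mem (ξ : Module.Dual k V) {t : TensorAlgebra k V} {m : ℕ}
    (ht : t ∈ homogeneous k V (m + 1)) : rightContract ξ t ∈ homogeneous k V m := by
  refine homogeneous_succ_induction_right (p := fun t => rightContract ξ t ∈ _) ?_ ?_ ht
  · intro t ht v
    rw [rightContract_mul_ι]
    exact Submodule.smul_mem _ _ ht
  · intro s t hs ht
    rw [map_add]
    exact add_mem hs ht

lemma leftContract_mem (ξ : Module.Dual k V) {t : TensorAlgebra k V} {m : ℕ}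
    (ht : t ∈ homogeneous k V (m + 1)) : leftContract ξ t ∈ homogeneous k V m := by
  refine homogeneous_succ_induction_left (p := fun t => leftContract ξ t ∈ _) ?_ ?_ ht
  · intro t ht v
    rw [leftContract_ι_mul]
    exact Submodule.smul_mem _ _ ht
  · intro s t hs ht
    rw [map_add]
    exact add_mem hs ht

section Basis

variable {n : ℕ} (x : Module.Basis (Fin n) k V)

/-- This is `V^{⊗(m+1)} = V^{⊗m} ⊗ V` in coordinates. It fails for non-zero scalars, whose
contractions vanish, hence the degree `m + 1`. -/
lemma sum_rightContract_mul {t : TensorAlgebra k V} {m : ℕ} (ht : t ∈ homogeneous k V (m + 1)) :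
    ∑ i, rightContract (x.coord i) t * ι k (x i) = t := by
  refine homogeneous_succ_induction_right
    (p := fun t => ∑ i, rightContract (x.coord i) t * ι k (x i) = t) ?_ ?_ ht
  · intro t _ v
    simp_rw [rightContract_mul_ι, smul_mul_assoc, ← mul_smul_comm, ← map_smul, ← Finset.mul_sum,
      ← map_sum]
    congr 2
    simp
  · intro s t hs ht
    simp_rw [map_add, add_mul, Finset.sum_add_distrib, hs, ht]

lemma sum_mul_leftContract {t : TensorAlgebra k V} {m : ℕ} (ht : t ∈ homogeneous k V (m + 1)) :
    ∑ i, ι k (x i) * leftContract (x.coord i) t = t := by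
  refine homogeneous_succ_induction_left
    (p := fun t => ∑ i, ι k (x i) * leftContract (x.coord i) t = t) ?_ ?_ ht
  · intro t _ v
    simp_rw [leftContract_ι_mul, mul_smul_comm, ← smul_mul_assoc, ← map_smul, ← Finset.sum_mul,
      ← map_sum]
    congr 2
    simp
  · intro s t hs ht
    simp_rw [map_add, mul_add, Finset.sum_add_distrib, hs, ht]

lemma rightContract_sum_mul (ξ : Module.Dual k V) (t : Fin n → TensorAlgebra k V) :
    rightContract ξ (∑ i, t i * ι k (x i)) = ∑ i, ξ (x i) • t i := by
  simp [rightContract_mul_ι]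

lemma leftContract_sum_mul (ξ : Module.Dual k V) (t : Fin n → TensorAlgebra k V) :
    leftContract ξ (∑ i, ι k (x i) * t i) = ∑ i, ξ (x i) • t i := by
  simp [leftContract_ι_mul]

lemma rightContract_coord_sum_mul (t : Fin n → TensorAlgebra k V) (j : Fin n) :
    rightContract (x.coord j) (∑ i, t i * ι k (x i)) = t j := by
  classical
  rw [rightContract_sum_mul]
  simp [Finsupp.single_apply]

lemma leftContract_coord_sum_mul (t : Fin n → TensorAlgebra k V) (j : Fin n) :
    leftContract (x.coord j) (∑ i, ι k (x i) * t i) = t j := by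
  classical
  rw [leftContract_sum_mul]
  simp [Finsupp.single_apply]

lemma rightContract_eq_sum (ξ : Module.Dual k V) {t : TensorAlgebra k V} {m : ℕ}
    (ht : t ∈ homogeneous k V (m + 1)) :
    rightContract ξ t = ∑ i, ξ (x i) • rightContract (x.coord i) t := by
  conv_lhs => rw [← sum_rightContract_mul x ht]
  exact rightContract_sum_mul x ξ _

lemma leftContract_eq_sum (ξ : Module.Dual k V) {t : TensorAlgebra k V} {m : ℕ}
    (ht : t ∈ homogeneous k V (m + 1)) :
    leftContract ξ t = ∑ i, ξ (x i) • leftContract (x.coord i) t := by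
  conv_lhs => rw [← sum_mul_leftContract x ht]
  exact leftContract_sum_mul x ξ _

end Basis

end TensorAlgebra

/-! ### Fox derivations of `A` with values in a module. -/

namespace HomogeneousRelations

open TensorAlgebra

variable {k V : Type u} [Field k] [AddCommGroup V] [Module k V] {N : ℕ}
  (R : HomogeneousRelations k V N)

lemma proj_ι (v : V) : R.proj (ι k v) = R.gen v := rfl

lemma proj_surjective : Function.Surjective R.proj :=
  RingQuot.mkAlgHom_surjective k _

lemma lift_proj {B : Type*} [Ring B] [Algebra k B] (f : V →ₗ[k] B)
    (hf : ∀ r ∈ R.space, TensorAlgebra.lift k f r = 0) (t : TensorAlgebra k V) :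
    R.lift f hf (R.proj t) = TensorAlgebra.lift k f t := by
  have : (R.lift f hf).comp R.proj = TensorAlgebra.lift k f := by
    ext v
    simp [proj_ι, lift_gen]
  exact DFunLike.congr_fun this t

lemma augmentation_proj (t : TensorAlgebra k V) :
    R.augmentation (R.proj t) = algebraMapInv t := by
  rw [augmentation, lift_proj]
  rfl

lemma augmentation_gen (v : V) : R.augmentation (R.gen v) = 0 := R.lift_gen _ _ v

section FoxDerivation

variable {M : Type u} [AddCommGroup M] [Module k M] [Module R.Alg M] [IsScalarTower k R.Alg M]
  {n : ℕ} (x : Module.Basis (Fin n) k V) (e : V →ₗ[k] M)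

/-- The action of `v ∈ V` on `M × k` given by `(m, c) ↦ (v m + c e(v), 0)`. -/
def extensionAction : V →ₗ[k] Module.End k (M × k) where
  toFun v :=
    { toFun := fun p => (R.gen v • p.1 + p.2 • e v, 0)
      map_add' := fun p q => by
        ext
        · simp only [Prod.fst_add, Prod.snd_add, smul_add, add_smul]; abel
        · simp
      map_smul' := fun c p => by
        ext
        · change R.gen v • c • p.1 + (c * p.2) • e v = c • (R.gen v • p.1 + p.2 • e v)
          rw [smul_add, mul_smul, smul_algebra_smul_comm]
        · simp }
  map_add' v w := by
    ext p <;> simp [add_smul]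
  map_smul' c v := by
    ext p <;> simp

lemma lift_extensionAction_inl (t : TensorAlgebra k V) (m : M) :
    TensorAlgebra.lift k (R.extensionAction e) t (m, 0) = (R.proj t • m, 0) := by
  induction t using TensorAlgebra.induction generalizing m with
  | algebraMap r => simp
  | ι v => simp [extensionAction, proj_ι]
  | mul a b ha hb => simp [hb, ha, mul_smul]
  | add a b ha hb => simp [ha, hb, add_smul]

/-- Only the last letter sees the summand `k`. It moves `(0, c)` into `M`, where the remaining
letters act through `A`. -/
lemma lift_extensionAction_inr {m : ℕ} {t : TensorAlgebra k V}
    (ht : t ∈ homogeneous k V (m + 1)) (c : k) :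
    TensorAlgebra.lift k (R.extensionAction e) t (0, c) =
      (c • ∑ i, R.proj (rightContract (x.coord i) t) • e (x i), 0) := by
  conv_lhs => rw [← sum_rightContract_mul x ht]
  have h : ∀ v : V, R.extensionAction e v (0, c) = (c • e v, 0) := fun v => by
    simp [extensionAction]
  simp only [map_sum, map_mul, lift_ι_apply, LinearMap.sum_apply, Module.End.mul_apply, h,
    lift_extensionAction_inl]
  rw [Finset.smul_sum]
  ext
  · simp [Prod.fst_sum, smul_algebra_smul_comm]
  · simp [Prod.snd_sum]

/-- The derivation `δ : A → M`, `δ (a b) = a δ(b) + ε(b) δ(a)`, with prescribed values on `V`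
which are compatible with the relations. -/
theorem exists_foxDerivation
    (he : ∀ r ∈ R.space, ∑ i, R.proj (rightContract (x.coord i) r) • e (x i) = 0) :
    ∃ δ : R.Alg →ₗ[k] M, (∀ v, δ (R.gen v) = e v) ∧
      ∀ a b, δ (a * b) = a • δ b + R.augmentation b • δ a := by
  have hN := R.two_le
  -- This makes `M × k` an `A`-module, an extension of `k` by `M`: a relation kills `M × 0` because
  -- `M` is an `A`-module, and kills `(0, c)` by `he`.
  have hlift : ∀ r ∈ R.space, TensorAlgebra.lift k (R.extensionAction e) r = 0 := by
    intro r hr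
    have hr' : r ∈ homogeneous k V (N - 1 + 1) := by
      rw [show N - 1 + 1 = N by omega]
      exact R.space_le hr
    apply LinearMap.ext
    rintro ⟨m, c⟩
    have : ((m, c) : M × k) = (m, 0) + (0, c) := by simp
    rw [this, map_add, R.lift_extensionAction_inl, R.lift_extensionAction_inr x e hr', he r hr,
      R.proj_eq_zero hr]
    simp
  have key1 : ∀ (a : R.Alg) (m : M), R.lift (R.extensionAction e) hlift a (m, 0) = (a • m, 0) := by
    intro a m
    obtain ⟨t, rfl⟩ := R.proj_surjective a
    rw [lift_proj, lift_extensionAction_inl]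
  have key2 : ∀ a : R.Alg, (R.lift (R.extensionAction e) hlift a (0, 1)).2 = R.augmentation a := by
    intro a
    obtain ⟨t, rfl⟩ := R.proj_surjective a
    rw [lift_proj, augmentation_proj]
    suffices ∀ p : M × k, (TensorAlgebra.lift k (R.extensionAction e) t p).2 =
        algebraMapInv t * p.2 by rw [this]; simp
    induction t using TensorAlgebra.induction with
    | algebraMap r => simp [algebraMapInv]
    | ι v => simp [extensionAction, algebraMapInv]
    | mul a b ha hb => intro p; simp [hb, ha, mul_assoc]
    | add a b ha hb => intro p; simp [ha, hb, add_mul]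
  -- `δ a` is the `M`-component of `a` acting on `(0, 1)`; the Leibniz rule is the associativity of
  -- this action.
  refine ⟨{ toFun := fun a => (R.lift (R.extensionAction e) hlift a (0, 1)).1
            map_add' := fun a b => by simp
            map_smul' := fun c a => by simp }, fun v => ?_, fun a b => ?_⟩
  · simp [lift_gen, extensionAction]
  · change (R.lift (R.extensionAction e) hlift (a * b) (0, 1)).1 = _
    rw [map_mul, Module.End.mul_apply]
    have h : R.lift (R.extensionAction e) hlift b (0, 1) =
        ((R.lift (R.extensionAction e) hlift b (0, 1)).1, 0) + R.augmentation b • (0, 1) := by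
      ext
      · simp
      · simp [key2]
    rw [h, map_add, map_smul, key1]
    simp

end FoxDerivation

end HomogeneousRelations

/-! ### The grading of `A`. -/

namespace HomogeneousRelations

open TensorAlgebra

section Grading

variable {k V : Type u} [Field k] [AddCommGroup V] [Module k V] {N : ℕ}
  (R : HomogeneousRelations k V N)

lemma proj_mem_component {t : TensorAlgebra k V} {m : ℕ} (ht : t ∈ homogeneous k V m) :
    R.proj t ∈ R.component m := by
  have h : R.proj t ∈ (homogeneous k V m).map R.proj.toLinearMap := ⟨t, ht, rfl⟩
  rw [homogeneous, Submodule.map_pow, ← LinearMap.range_comp] at h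
  exact h

lemma exists_proj_eq {a : R.Alg} {m : ℕ} (ha : a ∈ R.component m) :
    ∃ t ∈ homogeneous k V m, R.proj t = a := by
  have h : R.component m = (homogeneous k V m).map R.proj.toLinearMap := by
    rw [homogeneous, Submodule.map_pow, ← LinearMap.range_comp]
    rfl
  rw [h] at ha
  exact ha

lemma mul_mem_component {a b : R.Alg} {i j : ℕ} (ha : a ∈ R.component i) (hb : b ∈ R.component j) :
    a * b ∈ R.component (i + j) := by
  rw [component, pow_add]
  exact Submodule.mul_mem_mul ha hb

lemma gen_mem_component (v : V) : R.gen v ∈ R.component 1 := by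
  rw [component, pow_one]
  exact ⟨v, rfl⟩

/-- A homogeneous relation goes to the monomial whose coefficient is its class `0`; hence
`gradingHom` is well defined on `A`. -/
lemma lift_monomial (t : TensorAlgebra k V) {m : ℕ} (ht : t ∈ homogeneous k V m) :
    TensorAlgebra.lift k ((Polynomial.monomial 1).restrictScalars k ∘ₗ R.gen) t =
      Polynomial.monomial m (R.proj t) := by
  induction m generalizing t with
  | zero =>
    obtain ⟨c, rfl⟩ := mem_homogeneous_zero ht
    simp [Polynomial.algebraMap_apply]
  | succ m ih =>
    refine homogeneous_succ_induction_right (p := fun t => TensorAlgebra.lift k _ t =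
      Polynomial.monomial (m + 1) (R.proj t)) ?_ ?_ ht
    · intro t ht v
      rw [map_mul, ih t ht, lift_ι_apply, map_mul, proj_ι]
      simp [Polynomial.monomial_mul_monomial]
    · intro s t hs ht
      simp only [map_add, hs, ht]

/-- The morphism `A → A[X]` which is `a ↦ a X^m` on `A_m`. -/
def gradingHom : R.Alg →ₐ[k] Polynomial R.Alg :=
  R.lift ((Polynomial.monomial 1).restrictScalars k ∘ₗ R.gen) fun r hr => by
    rw [R.lift_monomial r (R.space_le hr), R.proj_eq_zero hr, map_zero]

/-- The projection `A → A_m`. -/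
def gradedPart (m : ℕ) : R.Alg →ₗ[k] R.Alg where
  toFun a := (R.gradingHom a).coeff m
  map_add' a b := by simp
  map_smul' c a := by simp

lemma gradingHom_of_mem {a : R.Alg} {m : ℕ} (ha : a ∈ R.component m) :
    R.gradingHom a = Polynomial.monomial m a := by
  obtain ⟨t, ht, rfl⟩ := R.exists_proj_eq ha
  rw [gradingHom, lift_proj, R.lift_monomial t ht]

lemma gradedPart_of_mem {a : R.Alg} {m : ℕ} (ha : a ∈ R.component m) (j : ℕ) :
    R.gradedPart j a = if m = j then a else 0 := by
  change (R.gradingHom a).coeff j = _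
  rw [R.gradingHom_of_mem ha, Polynomial.coeff_monomial]

lemma gradedPart_self {a : R.Alg} {m : ℕ} (ha : a ∈ R.component m) : R.gradedPart m a = a := by
  rw [R.gradedPart_of_mem ha, if_pos rfl]

lemma gradedPart_of_ne {a : R.Alg} {m j : ℕ} (ha : a ∈ R.component m) (h : m ≠ j) :
    R.gradedPart j a = 0 := by
  rw [R.gradedPart_of_mem ha, if_neg h]

lemma iSup_component : ⨆ m, R.component m = ⊤ := by
  rw [eq_top_iff]
  rintro a -
  obtain ⟨t, rfl⟩ := R.proj_surjective a
  have ht : t ∈ ⨆ m, homogeneous k V m := by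
    have := (DirectSum.Decomposition.isInternal (homogeneous k V)).submodule_iSup_eq_top
    rw [this]
    trivial
  induction ht using Submodule.iSup_induction' with
  | mem m t ht => exact Submodule.mem_iSup_of_mem m (R.proj_mem_component ht)
  | zero => simp
  | add s t _ _ hs ht => rw [map_add]; exact add_mem hs ht

lemma induction_component {p : R.Alg → Prop} (h1 : ∀ m, ∀ a ∈ R.component m, p a)
    (h2 : ∀ a b, p a → p b → p (a + b)) (a : R.Alg) : p a := by
  have ha : a ∈ ⨆ m, R.component m := by
    rw [iSup_component]
    trivial
  induction ha using Submodule.iSup_induction' with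
  | mem m t ht => exact h1 m t ht
  | zero => exact h1 0 0 (zero_mem _)
  | add s t _ _ hs ht => exact h2 _ _ hs ht

lemma gradedPart_mem (m : ℕ) (a : R.Alg) : R.gradedPart m a ∈ R.component m := by
  induction a using R.induction_component with
  | h1 j a ha =>
    rw [R.gradedPart_of_mem ha]
    split_ifs with h
    · exact h ▸ ha
    · exact zero_mem _
  | h2 a b ha hb => rw [map_add]; exact add_mem ha hb

lemma eval_gradingHom (a : R.Alg) : (R.gradingHom a).eval 1 = a := by
  induction a using R.induction_component with
  | h1 j a ha => simp [R.gradingHom_of_mem ha]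
  | h2 a b ha hb => rw [map_add, Polynomial.eval_add, ha, hb]

lemma eq_zero_of_gradedPart {a : R.Alg} (h : ∀ m, R.gradedPart m a = 0) : a = 0 := by
  rw [← R.eval_gradingHom a, show R.gradingHom a = 0 from Polynomial.ext h, Polynomial.eval_zero]

lemma exists_sum_gradedPart (a : R.Alg) :
    ∃ M : ℕ, ∀ m, M ≤ m → R.gradedPart m a = 0 :=
  ⟨(R.gradingHom a).natDegree + 1, fun _ hm => Polynomial.coeff_eq_zero_of_natDegree_lt hm⟩

lemma sum_gradedPart {a : R.Alg} {M : ℕ} (h : ∀ m, M ≤ m → R.gradedPart m a = 0) :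
    ∑ m ∈ Finset.range M, R.gradedPart m a = a := by
  rw [← sub_eq_zero]
  apply R.eq_zero_of_gradedPart
  intro j
  rw [map_sub, map_sum]
  simp_rw [R.gradedPart_of_mem (R.gradedPart_mem _ a), Finset.sum_ite_eq', Finset.mem_range]
  split_ifs with hj
  · rw [sub_self]
  · rw [h j (not_lt.1 hj), sub_zero]

lemma gradedPart_mul (m : ℕ) (a b : R.Alg) :
    R.gradedPart m (a * b) =
      ∑ p ∈ Finset.HasAntidiagonal.antidiagonal m, R.gradedPart p.1 a * R.gradedPart p.2 b := by
  change (R.gradingHom (a * b)).coeff m = _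
  rw [map_mul, Polynomial.coeff_mul]
  rfl

lemma gradedPart_add_mul (m d : ℕ) (a : R.Alg) {b : R.Alg} (hb : b ∈ R.component d) :
    R.gradedPart (m + d) (a * b) = R.gradedPart m a * b := by
  change (R.gradingHom (a * b)).coeff (m + d) = _
  rw [map_mul, R.gradingHom_of_mem hb, Polynomial.coeff_mul_monomial]
  rfl

lemma gradedPart_mul_add (m d : ℕ) {a : R.Alg} (b : R.Alg) (ha : a ∈ R.component d) :
    R.gradedPart (m + d) (a * b) = a * R.gradedPart m b := by
  change (R.gradingHom (a * b)).coeff (m + d) = _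
  rw [map_mul, R.gradingHom_of_mem ha, Polynomial.coeff_monomial_mul]
  rfl

lemma gradedPart_mul_of_lt {m d : ℕ} (a : R.Alg) {b : R.Alg} (hb : b ∈ R.component d)
    (h : m < d) : R.gradedPart m (a * b) = 0 := by
  rw [gradedPart_mul]
  refine Finset.sum_eq_zero fun p hp => ?_
  rw [Finset.HasAntidiagonal.mem_antidiagonal] at hp
  rw [R.gradedPart_of_ne hb (show d ≠ p.2 by omega), mul_zero]

lemma gradedPart_mul_of_lt' {m d : ℕ} {a : R.Alg} (b : R.Alg) (ha : a ∈ R.component d)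
    (h : m < d) : R.gradedPart m (a * b) = 0 := by
  rw [gradedPart_mul]
  refine Finset.sum_eq_zero fun p hp => ?_
  rw [Finset.HasAntidiagonal.mem_antidiagonal] at hp
  rw [R.gradedPart_of_ne ha (show d ≠ p.1 by omega), zero_mul]

lemma gradedPart_zero (a : R.Alg) : R.gradedPart 0 a = algebraMap k _ (R.augmentation a) := by
  induction a using R.induction_component with
  | h1 j a ha =>
    rw [R.gradedPart_of_mem ha]
    obtain ⟨t, ht, rfl⟩ := R.exists_proj_eq ha
    rw [augmentation_proj]
    split_ifs with h
    · subst h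
      obtain ⟨c, rfl⟩ := mem_homogeneous_zero ht
      simp [algebraMapInv]
    · obtain ⟨m, rfl⟩ := Nat.exists_eq_succ_of_ne_zero h
      rw [algebraMapInv_eq_zero ht, map_zero]
  | h2 a b ha hb => simp only [map_add, ha, hb]

lemma augmentation_of_mem {a : R.Alg} {m : ℕ} (ha : a ∈ R.component (m + 1)) :
    R.augmentation a = 0 := by
  obtain ⟨t, ht, rfl⟩ := R.exists_proj_eq ha
  rw [augmentation_proj, algebraMapInv_eq_zero ht]

lemma algebraMap_injective : Function.Injective (algebraMap k R.Alg) := by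
  intro a b h
  have := congrArg R.augmentation h
  simpa using this

end Grading

/-! ### The start of the minimal resolution of `k`. -/

section Resolution

variable {k V : Type u} [Field k] [AddCommGroup V] [Module k V]
  (R : HomogeneousRelations k V 3) {n r : ℕ} (x : Module.Basis (Fin n) k V)
  (f : Module.Basis (Fin r) k R.space)

/-- The row of the partial derivatives in `A` of an element of the tensor algebra. -/
def foxRow : TensorAlgebra k V →ₗ[k] (Fin n → R.Alg) :=
  LinearMap.pi fun i => R.proj.toLinearMap ∘ₗ rightContract (x.coord i)

@[simp]
lemma foxRow_apply (t : TensorAlgebra k V) (i : Fin n) :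
    R.foxRow x t i = R.proj (rightContract (x.coord i) t) := rfl

/-- The differential `A ⊗ V → A` of the resolution of `k`. -/
def d₁ : (Fin n → R.Alg) →ₗ[R.Alg] R.Alg :=
  Fintype.linearCombination R.Alg fun i => R.gen (x i)

/-- The differential `A ⊗ R → A ⊗ V` of the resolution of `k`. -/
def d₂ : (Fin r → R.Alg) →ₗ[R.Alg] (Fin n → R.Alg) :=
  Fintype.linearCombination R.Alg fun j => R.foxRow x (f j)

lemma d₁_apply (a : Fin n → R.Alg) : R.d₁ x a = ∑ i, a i * R.gen (x i) := rfl

lemma d₂_apply (b : Fin r → R.Alg) (i : Fin n) :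
    R.d₂ x f b i = ∑ j, b j * R.proj (rightContract (x.coord i) (f j)) := by
  simp [d₂, Fintype.linearCombination_apply]

lemma d₁_foxRow {t : TensorAlgebra k V} {m : ℕ} (ht : t ∈ homogeneous k V (m + 1)) :
    R.d₁ x (R.foxRow x t) = R.proj t := by
  conv_rhs => rw [← sum_rightContract_mul x ht]
  simp [d₁_apply, proj_ι]

lemma d₁_d₂ (b : Fin r → R.Alg) : R.d₁ x (R.d₂ x f b) = 0 := by
  rw [d₂, Fintype.linearCombination_apply, map_sum]
  refine Finset.sum_eq_zero fun j _ => ?_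
  rw [map_smul, R.d₁_foxRow x (R.space_le (f j).2), R.proj_eq_zero (f j).2, smul_zero]

lemma sum_smul_foxRow {t : TensorAlgebra k V} (ht : t ∈ R.space) :
    ∃ c : Fin r → k, t = ∑ j, c j • (f j : TensorAlgebra k V) ∧
      R.d₂ x f (fun j => algebraMap k _ (c j)) = R.foxRow x t := by
  have h : t = ∑ j, f.repr ⟨t, ht⟩ j • (f j : TensorAlgebra k V) := by
    have := congrArg R.space.subtype (f.sum_repr ⟨t, ht⟩)
    rw [map_sum] at this
    exact this.symm
  refine ⟨fun j => f.repr ⟨t, ht⟩ j, h, ?_⟩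
  conv_rhs => rw [h]
  rw [map_sum, d₂, Fintype.linearCombination_apply]
  simp

/-- The class of `a` in the cokernel of `d₂` depends only on `d₁ a`. Indeed the cokernel receives a
Fox derivation `δ` with `δ(xᵢ)` the class of the `i`-th basis vector, and the Leibniz rule gives
`δ(∑ aᵢ xᵢ) = [a]`. -/
theorem exists_d₂_eq {a : Fin n → R.Alg} (ha : R.d₁ x a = 0) : ∃ b, R.d₂ x f b = a := by
  let e : V →ₗ[k] ((Fin n → R.Alg) ⧸ LinearMap.range (R.d₂ x f)) :=
    x.constr k fun i => Submodule.Quotient.mk (Pi.single i 1)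
  have he : ∀ i, e (x i) = Submodule.Quotient.mk (Pi.single i 1) := fun i => x.constr_basis _ _ _
  have hsum : ∀ a : Fin n → R.Alg, ∑ i, a i • e (x i) = Submodule.Quotient.mk a := by
    intro a
    simp_rw [he, ← Submodule.Quotient.mk_smul]
    conv_rhs => rw [pi_eq_sum_univ' a]
    exact (map_sum (LinearMap.range (R.d₂ x f)).mkQ _ _).symm
  obtain ⟨δ, h1, h2⟩ := R.exists_foxDerivation x e (fun r hr => by
    rw [show ∑ i, R.proj (rightContract (x.coord i) r) • e (x i) =
      Submodule.Quotient.mk (R.foxRow x r) from hsum (R.foxRow x r),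
      Submodule.Quotient.mk_eq_zero]
    obtain ⟨c, -, hc⟩ := R.sum_smul_foxRow x f hr
    exact ⟨_, hc⟩)
  have h3 : δ (R.d₁ x a) = Submodule.Quotient.mk a := by
    rw [d₁_apply, map_sum, ← hsum]
    simp [h1, h2, augmentation_gen]
  rw [ha, map_zero] at h3
  exact (Submodule.Quotient.mk_eq_zero _).1 h3.symm

-- By exactness the row of derivatives lies in the image of `d₂`, whose entries have no part of
-- degree less than two, whereas these derivatives have degree at most one.
include f x in
lemma eq_zero_of_proj_eq_zero {t : TensorAlgebra k V} {m : ℕ} (hm : m ≤ 2)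
    (ht : t ∈ homogeneous k V m) (h : R.proj t = 0) : t = 0 := by
  induction m generalizing t with
  | zero =>
    obtain ⟨c, rfl⟩ := mem_homogeneous_zero ht
    rw [AlgHom.commutes] at h
    rw [R.algebraMap_injective (h.trans (map_zero _).symm), map_zero]
  | succ m ih =>
    obtain ⟨b, hb⟩ := R.exists_d₂_eq x f (a := R.foxRow x t) (by rw [R.d₁_foxRow x ht, h])
    rw [← sum_rightContract_mul x ht]
    refine Finset.sum_eq_zero fun i _ => ?_
    have hi := rightContract_mem (x.coord i) ht
    rw [ih (by omega) hi, zero_mul]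
    have h2 := congrFun hb i
    rw [d₂_apply, foxRow_apply] at h2
    rw [← R.gradedPart_self (R.proj_mem_component hi), ← h2, map_sum]
    exact Finset.sum_eq_zero fun j _ => R.gradedPart_mul_of_lt _
      (R.proj_mem_component (rightContract_mem (x.coord i) (R.space_le (f j).2))) (by omega)

include f x in
lemma proj_injOn {m : ℕ} (hm : m ≤ 2) {s t : TensorAlgebra k V} (hs : s ∈ homogeneous k V m)
    (ht : t ∈ homogeneous k V m) (h : R.proj s = R.proj t) : s = t := by
  rw [← sub_eq_zero]
  apply R.eq_zero_of_proj_eq_zero x f hm (sub_mem hs ht)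
  rw [map_sub, h, sub_self]

include f in
lemma foxRow_injOn {m : ℕ} (hm : m ≤ 2) {s t : TensorAlgebra k V}
    (hs : s ∈ homogeneous k V (m + 1)) (ht : t ∈ homogeneous k V (m + 1))
    (h : R.foxRow x s = R.foxRow x t) : s = t := by
  rw [← sum_rightContract_mul x hs, ← sum_rightContract_mul x ht]
  refine Finset.sum_congr rfl fun i _ => ?_
  rw [R.proj_injOn x f hm (rightContract_mem _ hs) (rightContract_mem _ ht) (congrFun h i)]

lemma gradedPart_d₂ (b : Fin r → R.Alg) (m : ℕ) (i : Fin n) :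
    R.gradedPart (m + 2) (R.d₂ x f b i) = R.d₂ x f (fun j => R.gradedPart m (b j)) i := by
  rw [d₂_apply, d₂_apply, map_sum]
  exact Finset.sum_congr rfl fun j _ => R.gradedPart_add_mul _ _ _
    (R.proj_mem_component (rightContract_mem (x.coord i) (R.space_le (f j).2)))

lemma d₂_algebraMap (c : Fin r → k) :
    R.d₂ x f (fun j => algebraMap k _ (c j)) =
      R.foxRow x (∑ j, c j • (f j : TensorAlgebra k V)) := by
  rw [map_sum, d₂, Fintype.linearCombination_apply]
  simp

lemma sum_smul_mem (c : Fin r → k) : ∑ j, c j • (f j : TensorAlgebra k V) ∈ R.space :=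
  sum_mem fun j _ => Submodule.smul_mem _ _ (f j).2

-- The ideal of relations meets `V^{⊗3}` only in `R`: the derivatives of `t` have degree two, so
-- only the degree zero part of a preimage under `d₂` matters, and it is a family of scalar
-- coefficients on the `fⱼ`.
include f x in
lemma mem_space_of_proj_eq_zero {t : TensorAlgebra k V} (ht : t ∈ homogeneous k V 3)
    (h : R.proj t = 0) : t ∈ R.space := by
  obtain ⟨b, hb⟩ := R.exists_d₂_eq x f (a := R.foxRow x t) (by rw [R.d₁_foxRow x ht, h])
  have h2 : R.foxRow x t =
      R.foxRow x (∑ j, R.augmentation (b j) • (f j : TensorAlgebra k V)) := by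
    rw [← d₂_algebraMap]
    ext i
    rw [foxRow_apply, ← R.gradedPart_self (R.proj_mem_component (rightContract_mem _ ht)),
      ← foxRow_apply, ← hb, R.gradedPart_d₂ x f b 0]
    simp_rw [gradedPart_zero]
  have h3 := R.sum_smul_mem f fun j => R.augmentation (b j)
  rw [R.foxRow_injOn x f le_rfl ht (R.space_le h3) h2]
  exact h3

/-- The kernel of `A ⊗ R → A ⊗ V`. -/
abbrev K : Submodule R.Alg (Fin r → R.Alg) := LinearMap.ker (R.d₂ x f)

lemma gradedPart_mem_K {b : Fin r → R.Alg} (hb : b ∈ R.K x f) (m : ℕ) :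
    (fun j => R.gradedPart m (b j)) ∈ R.K x f := by
  rw [LinearMap.mem_ker] at hb ⊢
  ext i
  rw [← gradedPart_d₂, hb]
  simp

/-- Minimality of the resolution: the constant terms of an element of `K` form a linear relation
between the rows of the `fⱼ`, hence between the `fⱼ` themselves. -/
lemma augmentation_of_mem_K {b : Fin r → R.Alg} (hb : b ∈ R.K x f) (j : Fin r) :
    R.augmentation (b j) = 0 := by
  have h := R.gradedPart_mem_K x f hb 0
  simp_rw [gradedPart_zero] at h
  rw [LinearMap.mem_ker, d₂_algebraMap] at h
  have h3 := R.sum_smul_mem f fun j => R.augmentation (b j)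
  have h4 := R.foxRow_injOn x f le_rfl (R.space_le h3) (zero_mem _) (h.trans (map_zero _).symm)
  have h5 : ∑ j, R.augmentation (b j) • f j = 0 := by
    apply Subtype.ext
    simpa using h4
  exact Fintype.linearIndependent_iff.1 f.linearIndependent _ h5 j

end Resolution

end HomogeneousRelations

/-! ### Dimension shifting along a short exact sequence with projective middle term. -/

namespace CategoryTheory.ShortComplex.ShortExact

universe v w

variable {C : Type u} [Category.{v} C] [Abelian C] [HasExt.{w} C] {S : ShortComplex C}
  (hS : S.ShortExact)

lemma exists_extClass_comp_eq [Projective S.X₂] {Y : C} {n m : ℕ} (h : 1 + n = m)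
    (e : Ext.{w} S.X₃ Y m) : ∃ e' : Ext.{w} S.X₁ Y n, hS.extClass.comp e' h = e := by
  obtain rfl : n + 1 = m := by omega
  exact Ext.contravariant_sequence_exact₃ hS Y e (Ext.eq_zero_of_projective _) h

/-- The degree is `n + 1` because in degree zero the connecting map has a kernel, the morphisms
which extend to `S.X₂`. -/
lemma eq_zero_of_extClass_comp_eq_zero [Projective S.X₂] {Y : C} {n m : ℕ} (h : 1 + (n + 1) = m)
    {e : Ext.{w} S.X₁ Y (n + 1)} (he : hS.extClass.comp e h = 0) : e = 0 := by
  obtain ⟨x, rfl⟩ := Ext.contravariant_sequence_exact₁ hS Y e h he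
  rw [Ext.eq_zero_of_projective x, Ext.comp_zero]

lemma extClass_comp_mk₀_eq_zero_iff {Y : C} (g : S.X₁ ⟶ Y) :
    hS.extClass.comp (Ext.mk₀ g) (add_zero 1) = 0 ↔ ∃ h : S.X₂ ⟶ Y, S.f ≫ h = g := by
  constructor
  · intro he
    obtain ⟨x, hx⟩ := Ext.contravariant_sequence_exact₁ hS Y (Ext.mk₀ g) (add_zero 1) he
    obtain ⟨h, rfl⟩ := (Ext.mk₀_bijective _ _).2 x
    rw [Ext.mk₀_comp_mk₀] at hx
    exact ⟨h, (Ext.mk₀_bijective _ _).1 hx⟩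
  · rintro ⟨h, rfl⟩
    rw [← Ext.mk₀_comp_mk₀, ← Ext.comp_assoc_of_second_deg_zero, hS.extClass_comp, Ext.zero_comp]

end CategoryTheory.ShortComplex.ShortExact

/-! ### The syzygies of `k` and the groups `Ext²(k, Y)`, `Ext³(k, Y)`. -/

namespace HomogeneousRelations

open TensorAlgebra

variable {k V : Type u} [Field k] [AddCommGroup V] [Module k V]
  (R : HomogeneousRelations k V 3) {n r : ℕ} (x : Module.Basis (Fin n) k V)
  (f : Module.Basis (Fin r) k R.space)

/-- The second syzygy of `k`. -/
abbrev Syzygy : Type u := (Fin r → R.Alg) ⧸ R.K x f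

/-- The inclusion of the second syzygy in `A ⊗ V`. -/
def syzygyIncl : R.Syzygy x f →ₗ[R.Alg] (Fin n → R.Alg) := (R.K x f).liftQ (R.d₂ x f) le_rfl

lemma syzygyIncl_mk (b : Fin r → R.Alg) :
    R.syzygyIncl x f (Submodule.Quotient.mk b) = R.d₂ x f b := rfl

lemma syzygyIncl_injective : Function.Injective (R.syzygyIncl x f) := by
  rw [← LinearMap.ker_eq_bot]
  exact Submodule.ker_liftQ_eq_bot _ _ _ le_rfl

lemma d₁_mem_augIdeal (a : Fin n → R.Alg) : R.d₁ x a ∈ R.augIdeal := by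
  rw [RingHom.mem_ker, d₁_apply]
  simp [augmentation_gen]

/-- The surjection `A ⊗ V → A_{≥1}`. -/
def d₁Aug : (Fin n → R.Alg) →ₗ[R.Alg] R.augIdeal :=
  (R.d₁ x).codRestrict _ (R.d₁_mem_augIdeal x)

lemma exists_d₁_eq {a : R.Alg} (ha : R.augmentation a = 0) : ∃ b, R.d₁ x b = a := by
  obtain ⟨t, rfl⟩ := R.proj_surjective a
  have ht : t ∈ ⨆ m, homogeneous k V m := by
    rw [(DirectSum.Decomposition.isInternal (homogeneous k V)).submodule_iSup_eq_top]
    trivial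
  suffices h : ∃ b, R.d₁ x b = R.proj (t - algebraMap k _ (algebraMapInv t)) by
    rw [augmentation_proj] at ha
    simpa [ha] using h
  clear ha
  induction ht using Submodule.iSup_induction' with
  | mem m t ht =>
    cases m with
    | zero =>
      obtain ⟨c, rfl⟩ := mem_homogeneous_zero ht
      exact ⟨0, by simp [algebraMapInv]⟩
    | succ m => exact ⟨R.foxRow x t, by rw [R.d₁_foxRow x ht, algebraMapInv_eq_zero ht]; simp⟩
  | zero => exact ⟨0, by simp⟩
  | add s t _ _ hs ht =>
    obtain ⟨b, hb⟩ := hs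
    obtain ⟨c, hc⟩ := ht
    exact ⟨b + c, by rw [map_add, hb, hc, ← map_add]; congr 1; simp; abel⟩

/-- The sequence `0 → Ω² → A ⊗ V → A_{≥1} → 0`. -/
def sequence₁ : ShortComplex (ModuleCat.{u} R.Alg) :=
  ShortComplex.mk (ModuleCat.ofHom (R.syzygyIncl x f)) (ModuleCat.ofHom (R.d₁Aug x)) (by
    apply ModuleCat.hom_ext
    apply LinearMap.ext
    intro b
    obtain ⟨b, rfl⟩ := Submodule.Quotient.mk_surjective _ b
    exact Subtype.ext (R.d₁_d₂ x f b))

lemma sequence₁_shortExact : (R.sequence₁ x f).ShortExact where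
  exact := by
    rw [ShortComplex.moduleCat_exact_iff]
    intro a ha
    obtain ⟨b, hb⟩ := R.exists_d₂_eq x f (a := a) (congrArg Subtype.val ha)
    exact ⟨Submodule.Quotient.mk b, hb⟩
  mono_f := by
    rw [ModuleCat.mono_iff_injective]
    exact R.syzygyIncl_injective x f
  epi_g := by
    rw [ModuleCat.epi_iff_surjective]
    rintro ⟨a, ha⟩
    obtain ⟨b, hb⟩ := R.exists_d₁_eq x ha
    exact ⟨b, Subtype.ext hb⟩

/-- The sequence `0 → K → A ⊗ R → Ω² → 0`. -/
def sequence₂ : ShortComplex (ModuleCat.{u} R.Alg) :=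
  ShortComplex.mk (ModuleCat.ofHom (R.K x f).subtype) (ModuleCat.ofHom (R.K x f).mkQ) (by
    apply ModuleCat.hom_ext
    apply LinearMap.ext
    intro b
    exact (Submodule.Quotient.mk_eq_zero _).2 b.2)

lemma sequence₂_shortExact : (R.sequence₂ x f).ShortExact where
  exact := by
    rw [ShortComplex.moduleCat_exact_iff]
    intro a ha
    exact ⟨⟨a, (Submodule.Quotient.mk_eq_zero _).1 ha⟩, rfl⟩
  mono_f := by
    rw [ModuleCat.mono_iff_injective]
    exact Subtype.val_injective
  epi_g := by
    rw [ModuleCat.epi_iff_surjective]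
    exact (R.K x f).mkQ_surjective

instance : Projective R.augSequence.X₂ :=
  inferInstanceAs (Projective (ModuleCat.of R.Alg R.Alg))

instance : Projective (R.sequence₁ x f).X₂ :=
  inferInstanceAs (Projective (ModuleCat.of R.Alg (Fin n → R.Alg)))

instance : Projective (R.sequence₂ x f).X₂ :=
  inferInstanceAs (Projective (ModuleCat.of R.Alg (Fin r → R.Alg)))

/-- The class of `0 → A_{≥1} → A → k → 0`. -/
def class₀ : Ext.{u} R.trivialObj (ModuleCat.of R.Alg R.augIdeal) 1 :=
  R.augSequence_shortExact.extClass

/-- The class of `0 → Ω² → A ⊗ V → A_{≥1} → 0`. -/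
def class₁ : Ext.{u} (ModuleCat.of R.Alg R.augIdeal) (ModuleCat.of R.Alg (R.Syzygy x f)) 1 :=
  (R.sequence₁_shortExact x f).extClass

/-- The class of `0 → K → A ⊗ R → Ω² → 0`. -/
def class₂ : Ext.{u} (ModuleCat.of R.Alg (R.Syzygy x f)) (ModuleCat.of R.Alg (R.K x f)) 1 :=
  (R.sequence₂_shortExact x f).extClass

section

variable {Y : ModuleCat.{u} R.Alg}

lemma exists_class₀_comp_eq {n m : ℕ} (h : 1 + n = m) (e : Ext.{u} R.trivialObj Y m) :
    ∃ e' : Ext.{u} (ModuleCat.of R.Alg R.augIdeal) Y n, R.class₀.comp e' h = e :=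
  R.augSequence_shortExact.exists_extClass_comp_eq h e

lemma exists_class₁_comp_eq {n m : ℕ} (h : 1 + n = m)
    (e : Ext.{u} (ModuleCat.of R.Alg R.augIdeal) Y m) :
    ∃ e' : Ext.{u} (ModuleCat.of R.Alg (R.Syzygy x f)) Y n, (R.class₁ x f).comp e' h = e :=
  (R.sequence₁_shortExact x f).exists_extClass_comp_eq h e

lemma exists_class₂_comp_eq {n m : ℕ} (h : 1 + n = m)
    (e : Ext.{u} (ModuleCat.of R.Alg (R.Syzygy x f)) Y m) :
    ∃ e' : Ext.{u} (ModuleCat.of R.Alg (R.K x f)) Y n, (R.class₂ x f).comp e' h = e :=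
  (R.sequence₂_shortExact x f).exists_extClass_comp_eq h e

lemma eq_zero_of_class₀_comp {n m : ℕ} (h : 1 + (n + 1) = m)
    {e : Ext.{u} (ModuleCat.of R.Alg R.augIdeal) Y (n + 1)} (he : R.class₀.comp e h = 0) : e = 0 :=
  R.augSequence_shortExact.eq_zero_of_extClass_comp_eq_zero h he

lemma eq_zero_of_class₁_comp {n m : ℕ} (h : 1 + (n + 1) = m)
    {e : Ext.{u} (ModuleCat.of R.Alg (R.Syzygy x f)) Y (n + 1)}
    (he : (R.class₁ x f).comp e h = 0) : e = 0 :=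
  (R.sequence₁_shortExact x f).eq_zero_of_extClass_comp_eq_zero h he

lemma class₁_comp_mk₀_eq_zero_iff (g : ModuleCat.of R.Alg (R.Syzygy x f) ⟶ Y) :
    (R.class₁ x f).comp (Ext.mk₀ g) (add_zero 1) = 0 ↔
      ∃ h : ModuleCat.of R.Alg (Fin n → R.Alg) ⟶ Y, ModuleCat.ofHom (R.syzygyIncl x f) ≫ h = g :=
  (R.sequence₁_shortExact x f).extClass_comp_mk₀_eq_zero_iff g

lemma class₂_comp_mk₀_eq_zero_iff (g : ModuleCat.of R.Alg (R.K x f) ⟶ Y) :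
    (R.class₂ x f).comp (Ext.mk₀ g) (add_zero 1) = 0 ↔
      ∃ h : ModuleCat.of R.Alg (Fin r → R.Alg) ⟶ Y, ModuleCat.ofHom (R.K x f).subtype ≫ h = g :=
  (R.sequence₂_shortExact x f).extClass_comp_mk₀_eq_zero_iff g

end

/-- The map `Hom(Ω², Y) → Ext²(k, Y)`. -/
def ext₂Of {Y : ModuleCat.{u} R.Alg} (g : ModuleCat.of R.Alg (R.Syzygy x f) ⟶ Y) :
    Ext.{u} R.trivialObj Y 2 :=
  R.class₀.comp ((R.class₁ x f).comp (Ext.mk₀ g) (add_zero 1)) (show 1 + 1 = 2 by omega)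

/-- The map `Hom(K, Y) → Ext³(k, Y)`. -/
def ext₃Of {Y : ModuleCat.{u} R.Alg} (g : ModuleCat.of R.Alg (R.K x f) ⟶ Y) :
    Ext.{u} R.trivialObj Y 3 :=
  R.class₀.comp ((R.class₁ x f).comp ((R.class₂ x f).comp (Ext.mk₀ g) (add_zero 1))
    (show 1 + 1 = 2 by omega)) (show 1 + 2 = 3 by omega)

variable {Y : ModuleCat.{u} R.Alg}

lemma ext₂Of_surjective (e : Ext.{u} R.trivialObj Y 2) : ∃ g, R.ext₂Of x f g = e := by
  obtain ⟨e₁, rfl⟩ := R.exists_class₀_comp_eq (show 1 + 1 = 2 by omega) e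
  obtain ⟨e₀, rfl⟩ := R.exists_class₁_comp_eq x f (add_zero 1) e₁
  obtain ⟨g, rfl⟩ := (Ext.mk₀_bijective _ _).2 e₀
  exact ⟨g, rfl⟩

lemma ext₃Of_surjective (e : Ext.{u} R.trivialObj Y 3) : ∃ g, R.ext₃Of x f g = e := by
  obtain ⟨e₂, rfl⟩ := R.exists_class₀_comp_eq (show 1 + 2 = 3 by omega) e
  obtain ⟨e₁, rfl⟩ := R.exists_class₁_comp_eq x f (show 1 + 1 = 2 by omega) e₂
  obtain ⟨e₀, rfl⟩ := R.exists_class₂_comp_eq x f (add_zero 1) e₁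
  obtain ⟨g, rfl⟩ := (Ext.mk₀_bijective _ _).2 e₀
  exact ⟨g, rfl⟩

lemma ext₂Of_eq_zero_iff (g : ModuleCat.of R.Alg (R.Syzygy x f) ⟶ Y) :
    R.ext₂Of x f g = 0 ↔
      ∃ h : ModuleCat.of R.Alg (Fin n → R.Alg) ⟶ Y,
        ModuleCat.ofHom (R.syzygyIncl x f) ≫ h = g := by
  rw [← class₁_comp_mk₀_eq_zero_iff]
  refine ⟨fun h => R.eq_zero_of_class₀_comp _ h, fun h => ?_⟩
  rw [ext₂Of, h, Ext.comp_zero]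

lemma ext₃Of_eq_zero_iff (g : ModuleCat.of R.Alg (R.K x f) ⟶ Y) :
    R.ext₃Of x f g = 0 ↔
      ∃ h : ModuleCat.of R.Alg (Fin r → R.Alg) ⟶ Y,
        ModuleCat.ofHom (R.K x f).subtype ≫ h = g := by
  rw [← class₂_comp_mk₀_eq_zero_iff]
  refine ⟨fun h => R.eq_zero_of_class₁_comp x f _ (R.eq_zero_of_class₀_comp _ h), fun h => ?_⟩
  rw [ext₃Of, h, Ext.comp_zero, Ext.comp_zero]

lemma ext₂Of_add (g h : ModuleCat.of R.Alg (R.Syzygy x f) ⟶ Y) :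
    R.ext₂Of x f (g + h) = R.ext₂Of x f g + R.ext₂Of x f h := by
  simp only [ext₂Of, Ext.mk₀_add, Ext.comp_add]

lemma ext₂Of_smul (c : k) (g : ModuleCat.of R.Alg (R.Syzygy x f) ⟶ Y) :
    R.ext₂Of x f (c • g) = c • R.ext₂Of x f g := by
  simp only [ext₂Of, Ext.mk₀_smul, Ext.comp_smul]

lemma ext₃Of_add (g h : ModuleCat.of R.Alg (R.K x f) ⟶ Y) :
    R.ext₃Of x f (g + h) = R.ext₃Of x f g + R.ext₃Of x f h := by
  simp only [ext₃Of, Ext.mk₀_add, Ext.comp_add]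

lemma ext₃Of_smul (c : k) (g : ModuleCat.of R.Alg (R.K x f) ⟶ Y) :
    R.ext₃Of x f (c • g) = c • R.ext₃Of x f g := by
  simp only [ext₃Of, Ext.mk₀_smul, Ext.comp_smul]

lemma ext₃Of_combination_eq_zero {a b p q : k} {e : Ext.{u} R.trivialObj Y 3}
    {g h : ModuleCat.of R.Alg (R.K x f) ⟶ Y} (hg : p • e = R.ext₃Of x f g)
    (hh : q • e = R.ext₃Of x f h) (hab : a * p + b * q = 0) :
    R.ext₃Of x f (a • g + b • h) = 0 := by
  rw [ext₃Of_add, ext₃Of_smul, ext₃Of_smul, ← hg, ← hh, smul_smul, smul_smul, ← add_smul,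
    hab, zero_smul]

section ASRegular

variable {R} (hA : R.IsASRegular 3)
include hA

/-- Each of the three sequences with projective middle term lowers the bound on the projective
dimension by one, from 3 for `k` to 0 for `K`. -/
lemma IsASRegular.projective_K : Module.Projective R.Alg (R.K x f) := by
  have h0 : HasProjectiveDimensionLT R.augSequence.X₃ (2 + 2) := by
    have := (projectiveDimension_le_iff _ 3).1 (hA.globalDimension.1 R.trivialObj)
    exact this
  have h1 := (R.augSequence_shortExact.hasProjectiveDimensionLT_X₃_iff 2 inferInstance).1 h0
  have h2 := ((R.sequence₁_shortExact x f).hasProjectiveDimensionLT_X₃_iff 1 inferInstance).1 h1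
  have h3 := ((R.sequence₂_shortExact x f).hasProjectiveDimensionLT_X₃_iff 0 inferInstance).1 h2
  have h4 := projective_iff_hasProjectiveDimensionLT_one.2 h3
  exact (IsProjective.iff_projective (R := R.Alg) (R.K x f)).2 h4

/-- This is `Ext²(k, A) = 0`: a map on `(A ⊗ R) / K` extends along its inclusion in `A ⊗ V`. -/
lemma IsASRegular.exists_eq_comp_d₂ (h : (Fin r → R.Alg) →ₗ[R.Alg] R.Alg)
    (hh : ∀ b ∈ R.K x f, h b = 0) :
    ∃ g : (Fin n → R.Alg) →ₗ[R.Alg] R.Alg, ∀ b, h b = g (R.d₂ x f b) := by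
  have := hA.ext_eq_zero 2 (by omega)
  obtain ⟨g, hg⟩ := (R.ext₂Of_eq_zero_iff x f
    (ModuleCat.ofHom ((R.K x f).liftQ h hh) : _ ⟶ ModuleCat.of R.Alg R.Alg)).1
    (Subsingleton.elim _ _)
  refine ⟨g.hom, fun b => ?_⟩
  have := LinearMap.congr_fun (congrArg ModuleCat.Hom.hom hg) (Submodule.Quotient.mk b)
  exact this.symm

/-- `Ext³(k, A)` is the quotient of `Hom(K, A)` by the restrictions from `A ⊗ R`. Here it is used
that this space is non-zero, and in the next lemma that its dimension is at most one. -/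
lemma IsASRegular.exists_not_restriction :
    ∃ φ : R.K x f →ₗ[R.Alg] R.Alg,
      ¬ ∃ h : (Fin r → R.Alg) →ₗ[R.Alg] R.Alg, ∀ b : R.K x f, φ b = h b := by
  obtain ⟨e, he, -⟩ := finrank_eq_one_iff'.1 hA.finrank_ext
  obtain ⟨g, rfl⟩ := R.ext₃Of_surjective x f e
  refine ⟨g.hom, fun ⟨h, hh⟩ => he ((R.ext₃Of_eq_zero_iff x f g).2 ⟨ModuleCat.ofHom h, ?_⟩)⟩
  ext b
  exact (hh b).symm

lemma IsASRegular.exists_combination_restriction (φ ψ : R.K x f →ₗ[R.Alg] R.Alg) :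
    ∃ a b : k, (a ≠ 0 ∨ b ≠ 0) ∧
      ∃ h : (Fin r → R.Alg) →ₗ[R.Alg] R.Alg, ∀ z : R.K x f, a • φ z + b • ψ z = h z := by
  obtain ⟨e, -, he⟩ := finrank_eq_one_iff'.1 hA.finrank_ext
  obtain ⟨p, hp⟩ := he (R.ext₃Of x f (Y := ModuleCat.of R.Alg R.Alg) (ModuleCat.ofHom φ))
  obtain ⟨q, hq⟩ := he (R.ext₃Of x f (Y := ModuleCat.of R.Alg R.Alg) (ModuleCat.ofHom ψ))
  have key : ∀ a b : k, a * p + b * q = 0 →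
      ∃ h : (Fin r → R.Alg) →ₗ[R.Alg] R.Alg, ∀ z : R.K x f, a • φ z + b • ψ z = h z := by
    intro a b hab
    obtain ⟨h, hh⟩ := (R.ext₃Of_eq_zero_iff x f _).1
      (R.ext₃Of_combination_eq_zero x f hp hq hab)
    refine ⟨h.hom, fun z => ?_⟩
    have := LinearMap.congr_fun (congrArg ModuleCat.Hom.hom hh) z
    change h.hom z = algebraMap k R.Alg a * φ z + algebraMap k R.Alg b * ψ z at this
    rw [this, Algebra.smul_def, Algebra.smul_def]
  -- `p` and `q` are the coordinates of the two classes on the generator `e`; the cases provide a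
  -- non-zero pair orthogonal to `(p, q)`.
  by_cases hp0 : p = 0
  · exact ⟨1, 0, Or.inl one_ne_zero, key 1 0 (by rw [hp0]; ring)⟩
  · exact ⟨-q, p, Or.inr hp0, key (-q) p (by ring)⟩

end ASRegular

end HomogeneousRelations

/-! ### The third syzygy `K` is free on one homogeneous generator. -/

namespace HomogeneousRelations

open TensorAlgebra

variable {k V : Type u} [Field k] [AddCommGroup V] [Module k V]
  (R : HomogeneousRelations k V 3) {n r : ℕ} (x : Module.Basis (Fin n) k V)
  (f : Module.Basis (Fin r) k R.space)

section GradedNakayama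

variable {w : Fin r → R.Alg} {s : ℕ}

/-- The space `A_{≥1} K`. -/
def decomposables : Submodule k (Fin r → R.Alg) :=
  Submodule.span k {y | ∃ p : R.Alg, R.augmentation p = 0 ∧ ∃ z ∈ R.K x f, y = p • z}

/-- For `p` in `A_{≥1}`, the degree `m` part of `p z` involves only the parts of `z` of degree less
than `m`. The submodule `S` will be `A w` for Nakayama and `⊥` for the generator of lowest degree.
-/
lemma gradedPart_decomposables {y : Fin r → R.Alg} (hy : y ∈ R.decomposables x f) {m : ℕ}
    {S : Submodule R.Alg (Fin r → R.Alg)}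
    (hS : ∀ i < m, ∀ z ∈ R.K x f, (fun j => R.gradedPart i (z j)) ∈ S) :
    (fun j => R.gradedPart m (y j)) ∈ S := by
  induction hy using Submodule.span_induction with
  | mem y hy =>
    obtain ⟨p, hp, z, hz, rfl⟩ := hy
    have h : (fun j => R.gradedPart m ((p • z) j)) =
        ∑ q ∈ Finset.HasAntidiagonal.antidiagonal m,
          R.gradedPart q.1 p • fun j => R.gradedPart q.2 (z j) := by
      ext j
      simp [gradedPart_mul]
    rw [h]
    refine Submodule.sum_mem _ fun q hq => ?_
    rw [Finset.HasAntidiagonal.mem_antidiagonal] at hq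
    by_cases h : q.1 = 0
    · rw [h, gradedPart_zero, hp, map_zero, zero_smul]
      exact zero_mem _
    · exact Submodule.smul_mem _ _ (hS q.2 (by omega) z hz)
  | zero => convert S.zero_mem using 1; ext j; simp
  | add y z _ _ hy hz => convert S.add_mem hy hz using 1; ext j; simp
  | smul c y _ hy =>
    convert S.smul_mem (algebraMap k _ c) hy using 1
    ext j
    rw [Pi.smul_apply, Pi.smul_apply, map_smul, smul_eq_mul, Algebra.smul_def]

/-- Graded Nakayama lemma for the kernel `K`. -/
lemma mem_span_of_K_le (hws : ∀ j, w j ∈ R.component s)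
    (h : ∀ z ∈ R.K x f, ∃ c : k, z - c • w ∈ R.decomposables x f)
    {z : Fin r → R.Alg} (hz : z ∈ R.K x f) : z ∈ Submodule.span R.Alg {w} := by
  have key : ∀ m, ∀ z ∈ R.K x f, (fun j => R.gradedPart m (z j)) ∈ Submodule.span R.Alg {w} := by
    intro m
    induction m using Nat.strong_induction_on with
    | _ m ih =>
      intro z hz
      obtain ⟨c, hc⟩ := h z hz
      have h1 := R.gradedPart_decomposables x f hc ih
      have h2 : (fun j => R.gradedPart m ((c • w) j)) ∈ Submodule.span R.Alg {w} := by
        by_cases hsm : s = m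
        · subst hsm
          have : (fun j => R.gradedPart s ((c • w) j)) = algebraMap k R.Alg c • w := by
            ext j
            rw [Pi.smul_apply, Pi.smul_apply, map_smul, R.gradedPart_self (hws j), smul_eq_mul,
              Algebra.smul_def]
          rw [this]
          exact Submodule.smul_mem _ _ (Submodule.mem_span_singleton_self w)
        · convert Submodule.zero_mem _ using 1
          ext j
          simp [R.gradedPart_of_ne (hws j) hsm]
      convert Submodule.add_mem _ h1 h2 using 1
      ext j
      simp
  have hbound : ∃ M, ∀ j m, M ≤ m → R.gradedPart m (z j) = 0 := by
    choose M hM using fun j => R.exists_sum_gradedPart (z j)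
    exact ⟨Finset.univ.sup M, fun j m hm => hM j m ((Finset.le_sup (Finset.mem_univ j)).trans hm)⟩
  obtain ⟨M, hM⟩ := hbound
  have : z = ∑ m ∈ Finset.range M, fun j => R.gradedPart m (z j) := by
    ext j
    rw [Finset.sum_apply, R.sum_gradedPart (hM j)]
  rw [this]
  exact Submodule.sum_mem _ fun m _ => key m z hz

end GradedNakayama

variable {R} (hA : R.IsASRegular 3)
include hA

/-- On `K`, a form killing `A_{≥1} K` is an `A`-linear map to the trivial module; projectivity of
`K` lifts it through the augmentation. -/
lemma IsASRegular.exists_lift_form (l : (Fin r → R.Alg) →ₗ[k] k)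
    (hl : ∀ y ∈ R.decomposables x f, l y = 0) :
    ∃ φ : R.K x f →ₗ[R.Alg] R.Alg, ∀ z : R.K x f, R.augmentation (φ z) = l z := by
  have := hA.projective_K x f
  let l' : R.K x f →ₗ[R.Alg] R.TrivialModule :=
    { toFun := fun z => l z
      map_add' := fun a b => map_add l a.1 b.1
      map_smul' := fun a z => by
        have h1 : a • z.1 = R.augmentation a • z.1 +
            (a - algebraMap k _ (R.augmentation a)) • z.1 := by
          rw [sub_smul, algebraMap_smul]
          abel
        have h2 : l ((a - algebraMap k _ (R.augmentation a)) • z.1) = 0 :=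
          hl _ (Submodule.subset_span ⟨_, by simp, z.1, z.2, rfl⟩)
        change l (a • z.1) = R.augmentation a * l z.1
        rw [h1, map_add, h2, add_zero, map_smul, smul_eq_mul] }
  have hsurj : Function.Surjective R.augmentationLin := fun c =>
    ⟨algebraMap k R.Alg c, R.augmentation.commutes c⟩
  obtain ⟨φ, hφ⟩ := Module.projective_lifting_property R.augmentationLin l' hsurj
  exact ⟨φ, fun z => LinearMap.congr_fun hφ z⟩

-- By minimality `K ⊆ A_{≥1} ⊗ R`, so restrictions from `A ⊗ R` become zero after augmentation. This
-- turns information on `Ext³(k, A)` into information on `K / A_{≥1} K`.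
omit hA in
lemma augmentation_restriction (h : (Fin r → R.Alg) →ₗ[R.Alg] R.Alg) {z : Fin r → R.Alg}
    (hz : z ∈ R.K x f) : R.augmentation (h z) = 0 := by
  rw [pi_eq_sum_univ' z, map_sum, map_sum]
  refine Finset.sum_eq_zero fun j _ => ?_
  rw [map_smul, smul_eq_mul, map_mul, R.augmentation_of_mem_K x f hz j, zero_mul]

/-- `Ext³(k, A) ≠ 0` gives `K ≠ 0`, and `dim Ext³(k, A) = 1` bounds the dimension of `K / A_{≥1} K`
by one. A non-zero homogeneous element of lowest degree is indecomposable, so it generates `K` by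
Nakayama. -/
lemma IsASRegular.exists_generator :
    ∃ (w : Fin r → R.Alg) (s : ℕ), w ∈ R.K x f ∧ w ≠ 0 ∧ (∀ j, w j ∈ R.component s) ∧
      ∀ z ∈ R.K x f, z ∈ Submodule.span R.Alg {w} := by
  classical
  have hex : ∃ s : ℕ, ∃ w ∈ R.K x f, w ≠ 0 ∧ ∀ j, w j ∈ R.component s := by
    by_contra! hcon
    obtain ⟨φ, hφ⟩ := hA.exists_not_restriction x f
    refine hφ ⟨0, fun b => ?_⟩
    have hb : b = 0 := by
      ext j
      refine R.eq_zero_of_gradedPart fun m => ?_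
      by_contra hne
      obtain ⟨i, hi⟩ := hcon m _ (R.gradedPart_mem_K x f b.2 m) (fun h => hne (congrFun h j))
      exact hi (R.gradedPart_mem _ _)
    simp [hb]
  obtain ⟨w, hw, hw0, hws⟩ := Nat.find_spec hex
  set s := Nat.find hex with hs
  have hmin : ∀ i < s, ∀ z ∈ R.K x f, (fun j => R.gradedPart i (z j)) ∈
      (⊥ : Submodule R.Alg (Fin r → R.Alg)) := by
    intro i hi z hz
    by_contra hne
    exact Nat.find_min hex hi ⟨_, R.gradedPart_mem_K x f hz i, hne, fun j => R.gradedPart_mem _ _⟩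
  have hwD : w ∉ R.decomposables x f := by
    intro h
    apply hw0
    have := R.gradedPart_decomposables x f h hmin
    rw [Submodule.mem_bot] at this
    rw [← this]
    ext j
    rw [R.gradedPart_self (hws j)]
  refine ⟨w, s, hw, hw0, hws, fun z hz => R.mem_span_of_K_le x f hws (fun z hz => ?_) hz⟩
  by_contra! hcon
  have hzD : z ∉ R.decomposables x f ⊔ Submodule.span k {w} := by
    intro h
    obtain ⟨y, hy, v, hv, rfl⟩ := Submodule.mem_sup.1 h
    obtain ⟨c, rfl⟩ := Submodule.mem_span_singleton.1 hv
    exact hcon c (by simpa using hy)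
  -- `l` separates `z` from `w`, and `l'` detects `w`. Their lifts are dependent modulo
  -- restrictions, so `a l + b l' = 0` on `K`; evaluation at `w` gives `b = 0`, and then evaluation
  -- at `z` gives `a = 0`.
  obtain ⟨l, hl1, hl2⟩ := Submodule.exists_le_ker_of_notMem hzD
  obtain ⟨l', hl1', hl2'⟩ := Submodule.exists_le_ker_of_notMem hwD
  obtain ⟨φ, hφ⟩ := hA.exists_lift_form x f l fun y hy => hl2 (Submodule.mem_sup_left hy)
  obtain ⟨ψ, hψ⟩ := hA.exists_lift_form x f l' fun y hy => hl2' hy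
  obtain ⟨a, b, hab, h, hh⟩ := hA.exists_combination_restriction x f φ ψ
  have key : ∀ z : R.K x f, a * l z + b * l' z = 0 := by
    intro z
    have h0 := congrArg R.augmentation (hh z)
    rw [map_add, map_smul, map_smul, hφ, hψ, augmentation_restriction x f h z.2] at h0
    exact h0
  have hlw : l w = 0 := hl2 (Submodule.mem_sup_right (Submodule.mem_span_singleton_self w))
  have h1 := key ⟨w, hw⟩
  have h2 := key ⟨z, hz⟩
  simp only [hlw, mul_zero, zero_add, mul_eq_zero, hl1', or_false] at h1
  simp only [h1, zero_mul, add_zero, mul_eq_zero, hl1, or_false] at h2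
  tauto

/-- Projectivity of `K` provides a section `σ` of `a ↦ a w`. The element `p = σ(w)` satisfies `p w =
w`, so its constant term is `1`; and `a w = 0` gives `a p = 0`, which kills the parts of `a` degree
by degree. -/
lemma IsASRegular.eq_zero_of_smul_generator {w : Fin r → R.Alg} {s : ℕ} (hw : w ∈ R.K x f)
    (hw0 : w ≠ 0) (hws : ∀ j, w j ∈ R.component s)
    (hspan : ∀ z ∈ R.K x f, z ∈ Submodule.span R.Alg {w}) {a : R.Alg} (ha : a • w = 0) :
    a = 0 := by
  have := hA.projective_K x f
  let π : R.Alg →ₗ[R.Alg] R.K x f := LinearMap.toSpanSingleton R.Alg _ ⟨w, hw⟩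
  have hπ : Function.Surjective π := by
    rintro ⟨z, hz⟩
    obtain ⟨a, ha⟩ := Submodule.mem_span_singleton.1 (hspan z hz)
    exact ⟨a, Subtype.ext ha⟩
  obtain ⟨σ, hσ⟩ := Module.projective_lifting_property π LinearMap.id hπ
  set p := σ ⟨w, hw⟩ with hp
  have h1 : p • w = w := congrArg Subtype.val (LinearMap.congr_fun hσ ⟨w, hw⟩)
  have h2 : a * p = 0 := by
    rw [hp, ← smul_eq_mul, ← map_smul]
    convert map_zero σ
    exact Subtype.ext ha
  have h3 : R.gradedPart 0 p = 1 := by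
    obtain ⟨j, hj⟩ := Function.ne_iff.1 hw0
    have h4 := congrArg (R.gradedPart (0 + s)) (congrFun h1 j)
    rw [Pi.smul_apply, smul_eq_mul, R.gradedPart_add_mul 0 s p (hws j), zero_add,
      R.gradedPart_self (hws j), gradedPart_zero, ← Algebra.smul_def] at h4
    have h5 : (R.augmentation p - 1) • w j = 0 := by rw [sub_smul, h4, one_smul, sub_self]
    have h6 := (smul_eq_zero.1 h5).resolve_right hj
    rw [gradedPart_zero, sub_eq_zero.1 h6, map_one]
  apply R.eq_zero_of_gradedPart
  intro m
  induction m using Nat.strong_induction_on with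
  | _ m ih =>
    have h4 := congrArg (R.gradedPart m) h2
    rw [gradedPart_mul, Finset.sum_eq_single (m, 0)] at h4
    · simpa [h3] using h4
    · rintro ⟨i, j⟩ hij hne
      rw [Finset.HasAntidiagonal.mem_antidiagonal] at hij
      have hij : i + j = m := hij
      rw [ih i (by by_contra hlt; apply hne; ext <;> simp <;> omega), zero_mul]
    · intro h
      simp at h

end HomogeneousRelations

/-! ### The generator of `K` as a basis of `V`, and the potential. -/

namespace HomogeneousRelations

open TensorAlgebra

variable {k V : Type u} [Field k] [AddCommGroup V] [Module k V]
  {R : HomogeneousRelations k V 3} {n r : ℕ} (x : Module.Basis (Fin n) k V)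
  (f : Module.Basis (Fin r) k R.space)

include x f in
lemma gen_injective : Function.Injective R.gen := fun v w h =>
  TensorAlgebra.ι_leftInverse.injective
    (R.proj_injOn x f one_le_two (ι_mem_homogeneous v) (ι_mem_homogeneous w) h)

/-- The vector of the classes of the `yⱼ` generates freely the kernel `K`. -/
structure IsKernelBasis (y : Module.Basis (Fin r) k V) : Prop where
  mem : (fun j => R.gen (y j)) ∈ R.K x f
  span : ∀ z ∈ R.K x f, ∃ a : R.Alg, z = a • fun j => R.gen (y j)
  free : ∀ a : R.Alg, (a • fun j => R.gen (y j)) = 0 → a = 0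

/-- Since `K = A w` is free, `Hom(K, A)` is `A` and the restrictions from `A ⊗ R` form the right
ideal `∑ wⱼ A`, so `Ext³(k, A) = A / ∑ wⱼ A`. In this line the classes of `1` and `c` are dependent,
and augmentation shows that the coefficient of `1` is zero. -/
lemma IsASRegular.exists_sum_mul (hA : R.IsASRegular 3) {w : Fin r → R.Alg} {s : ℕ}
    (hw : w ∈ R.K x f) (hw0 : w ≠ 0) (hws : ∀ j, w j ∈ R.component s)
    (hspan : ∀ z ∈ R.K x f, z ∈ Submodule.span R.Alg {w}) {c : R.Alg}
    (hc : R.augmentation c = 0) : ∃ b : Fin r → R.Alg, c = ∑ j, w j * b j := by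
  let π : R.Alg →ₗ[R.Alg] R.K x f := LinearMap.toSpanSingleton R.Alg _ ⟨w, hw⟩
  have hπ : Function.Bijective π := by
    constructor
    · rw [← LinearMap.ker_eq_bot, LinearMap.ker_eq_bot']
      intro a ha
      exact hA.eq_zero_of_smul_generator x f hw hw0 hws hspan (congrArg Subtype.val ha)
    · rintro ⟨z, hz⟩
      obtain ⟨a, ha⟩ := Submodule.mem_span_singleton.1 (hspan z hz)
      exact ⟨a, Subtype.ext ha⟩
  let e := LinearEquiv.ofBijective π hπ
  have hone : e.symm ⟨w, hw⟩ = 1 := by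
    rw [LinearEquiv.symm_apply_eq]
    change _ = (1 : R.Alg) • (⟨w, hw⟩ : R.K x f)
    rw [one_smul]
  obtain ⟨a, b, hab, h, hh⟩ := hA.exists_combination_restriction x f e.symm.toLinearMap
    ((LinearMap.toSpanSingleton R.Alg R.Alg c) ∘ₗ e.symm.toLinearMap)
  have h1 := hh ⟨w, hw⟩
  simp only [LinearEquiv.coe_coe, LinearMap.comp_apply, hone, LinearMap.toSpanSingleton_apply,
    one_smul] at h1
  have h2 := congrArg R.augmentation h1
  rw [augmentation_restriction x f h hw, map_add, map_smul, map_smul, hc, map_one, smul_zero,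
    add_zero, smul_eq_mul, mul_one] at h2
  have hb : b ≠ 0 := hab.resolve_left (not_not.2 h2)
  rw [h2, zero_smul, zero_add] at h1
  refine ⟨fun j => b⁻¹ • h (Pi.single j 1), ?_⟩
  simp_rw [mul_smul_comm, ← Finset.smul_sum]
  rw [eq_inv_smul_iff₀ hb, h1]
  conv_lhs => rw [pi_eq_sum_univ' w, map_sum]
  simp

theorem IsASRegular.exists_isKernelBasis (hA : R.IsASRegular 3) :
    ∃ y : Module.Basis (Fin r) k V, IsKernelBasis x f y := by
  obtain ⟨w, s, hw, hw0, hws, hspan⟩ := hA.exists_generator x f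
  have hsum : ∀ {c : R.Alg}, R.augmentation c = 0 → ∃ b : Fin r → R.Alg, c = ∑ j, w j * b j :=
    fun hc => hA.exists_sum_mul x f hw hw0 hws hspan hc
  have hinj := gen_injective x f
  obtain ⟨j₀, hj₀⟩ := Function.ne_iff.1 hw0
  have hn : 0 < n := by
    by_contra hn
    obtain rfl : n = 0 := by omega
    apply f.ne_zero j₀
    apply Subtype.ext
    rw [← sum_rightContract_mul x (R.space_le (f j₀).2)]
    simp
  -- The right ideal `∑ wⱼ A` contains `V`, which excludes `s ≥ 2`; minimality of the resolution
  -- excludes `s = 0`.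
  obtain rfl : s = 1 := by
    obtain ⟨b, hb⟩ := hsum (R.augmentation_gen (x ⟨0, hn⟩))
    by_contra hs
    rcases Nat.lt_or_ge s 1 with h | h
    · obtain rfl : s = 0 := by omega
      apply hj₀
      rw [← R.gradedPart_self (hws j₀), gradedPart_zero, R.augmentation_of_mem_K x f hw]
      simp
    · apply x.ne_zero ⟨0, hn⟩
      apply hinj
      rw [map_zero, ← R.gradedPart_self (R.gen_mem_component (x ⟨0, hn⟩)), hb, map_sum]
      exact Finset.sum_eq_zero fun j _ => R.gradedPart_mul_of_lt' _ (hws j) (by omega)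
  have hy : ∀ j, ∃ v, R.gen v = w j := by
    intro j
    have := hws j
    rw [component, pow_one] at this
    exact this
  choose y hy using hy
  have hw' : w = fun j => R.gen (y j) := funext fun j => (hy j).symm
  -- A linear relation among the `yⱼ` is a form on `A ⊗ R` with scalar coefficients which vanishes
  -- on `K`. As `Ext²(k, A) = 0`, it factors through `d₂`, whose rows have degree two, so its
  -- coefficients are zero.
  have hli : LinearIndependent k y := by
    rw [Fintype.linearIndependent_iff]
    intro c hc
    let h : (Fin r → R.Alg) →ₗ[R.Alg] R.Alg :=
      Fintype.linearCombination R.Alg fun j => algebraMap k R.Alg (c j)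
    have hh : ∀ b, h b = ∑ j, c j • b j := fun b => by
      simp [h, Fintype.linearCombination_apply, Algebra.smul_def, Algebra.commutes]
    have hw0 : h w = 0 := by
      rw [hh, hw']
      simp_rw [← map_smul, ← map_sum]
      rw [hc, map_zero]
    obtain ⟨g, hg⟩ := hA.exists_eq_comp_d₂ x f h (by
      intro z hz
      obtain ⟨a, rfl⟩ := Submodule.mem_span_singleton.1 (hspan z hz)
      rw [map_smul, hw0, smul_zero])
    intro j
    have h1 := hg (Pi.single j 1)
    have h2 : R.d₂ x f (Pi.single j 1) = R.foxRow x (f j) := by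
      simp [d₂]
    have h3 : h (Pi.single j 1) = algebraMap k _ (c j) := by simp [h]
    rw [h2, h3] at h1
    have h4 := congrArg R.augmentation h1
    rw [AlgHom.commutes, pi_eq_sum_univ' (R.foxRow x (f j)), map_sum, map_sum] at h4
    change c j = _ at h4
    rw [h4]
    refine Finset.sum_eq_zero fun i _ => ?_
    rw [map_smul, smul_eq_mul, map_mul, foxRow_apply, R.augmentation_of_mem
      (R.proj_mem_component (rightContract_mem _ (R.space_le (f j).2))), zero_mul]
  have hsp : ⊤ ≤ Submodule.span k (Set.range y) := by
    rintro v -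
    obtain ⟨b, hb⟩ := hsum (R.augmentation_gen v)
    have h1 : R.gen v = R.gen (∑ j, R.augmentation (b j) • y j) := by
      rw [← R.gradedPart_self (R.gen_mem_component v), hb, map_sum, map_sum]
      refine Finset.sum_congr rfl fun j _ => ?_
      rw [← zero_add 1, R.gradedPart_mul_add 0 1 _ (hws j), gradedPart_zero, ← hy,
        ← Algebra.commutes, ← Algebra.smul_def, map_smul]
    rw [hinj h1]
    exact Submodule.sum_mem _ fun j _ => Submodule.smul_mem _ _ (Submodule.subset_span ⟨j, rfl⟩)
  have hB : (fun j => R.gen (Module.Basis.mk hli hsp j)) = w := by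
    rw [hw']
    simp
  refine ⟨Module.Basis.mk hli hsp, ?_, ?_, ?_⟩
  · rw [hB]; exact hw
  · intro z hz
    obtain ⟨a, ha⟩ := Submodule.mem_span_singleton.1 (hspan z hz)
    exact ⟨a, by rw [hB, ha]⟩
  · intro a ha
    rw [hB] at ha
    exact hA.eq_zero_of_smul_generator x f hw hw0 hws hspan ha

variable (R) in
/-- `w` is a twisted potential of `A`: it generates the line `V ⊗ R ∩ R ⊗ V`, and the left and
right contractions with linear forms identify `V^*` with `R`. -/
structure IsPotential (w : TensorAlgebra k V) : Prop where
  mem : w ∈ homogeneous k V 4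
  left_mem : ∀ ξ, leftContract ξ w ∈ R.space
  right_mem : ∀ ξ, rightContract ξ w ∈ R.space
  left_injective : ∀ ξ, leftContract ξ w = 0 → ξ = 0
  right_injective : ∀ ξ, rightContract ξ w = 0 → ξ = 0
  left_surjective : ∀ t ∈ R.space, ∃ ξ, leftContract ξ w = t
  right_surjective : ∀ t ∈ R.space, ∃ ξ, rightContract ξ w = t
  exists_smul : ∀ w' ∈ homogeneous k V 4, (∀ ξ, leftContract ξ w' ∈ R.space) →
    (∀ ξ, rightContract ξ w' ∈ R.space) → ∃ c : k, w' = c • w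

/-- The element `∑ yⱼ fⱼ`. -/
def potential (y : Module.Basis (Fin r) k V) : TensorAlgebra k V :=
  ∑ j, ι k (y j) * (f j : TensorAlgebra k V)

lemma potential_mem (y : Module.Basis (Fin r) k V) : potential f y ∈ homogeneous k V 4 :=
  Submodule.sum_mem _ fun j _ => by
    have := mul_mem_homogeneous (ι_mem_homogeneous (y j)) (R.space_le (f j).2)
    exact this

lemma leftContract_potential (y : Module.Basis (Fin r) k V) (ξ : Module.Dual k V) :
    leftContract ξ (potential f y) = ∑ j, ξ (y j) • (f j : TensorAlgebra k V) :=
  leftContract_sum_mul y ξ _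

lemma rightContract_potential (y : Module.Basis (Fin r) k V) (ξ : Module.Dual k V) :
    rightContract ξ (potential f y) =
      ∑ j, ι k (y j) * rightContract ξ (f j : TensorAlgebra k V) := by
  rw [potential, map_sum]
  exact Finset.sum_congr rfl fun j _ => rightContract_mul_of_mem ξ _ (R.space_le (f j).2)

theorem IsKernelBasis.isPotential (hA : R.IsASRegular 3) {y : Module.Basis (Fin r) k V}
    (hy : IsKernelBasis x f y) : R.IsPotential (potential f y) := by
  have hinj := gen_injective x f
  have hfin : Module.Finite k V := Module.Finite.of_basis x
  have hfR : Module.Finite k R.space := Module.Finite.of_basis f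
  -- In `A` this contraction is the `i`-th entry of `d₂ y = 0`, and the kernel of `V^{⊗3} → A` is
  -- `R`.
  have hmem : ∀ i, rightContract (x.coord i) (potential f y) ∈ R.space := by
    intro i
    apply R.mem_space_of_proj_eq_zero x f (rightContract_mem _ (potential_mem f y))
    rw [rightContract_potential, map_sum]
    simp_rw [map_mul, proj_ι]
    rw [← R.d₂_apply x f (fun j => R.gen (y j)) i, LinearMap.mem_ker.1 hy.mem]
    rfl
  have hright : ∀ ξ, rightContract ξ (potential f y) ∈ R.space := by
    intro ξ
    rw [rightContract_eq_sum x ξ (potential_mem f y)]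
    exact Submodule.sum_mem _ fun i _ => Submodule.smul_mem _ _ (hmem i)
  -- Write `t = ∑ yⱼ tⱼ`. The form with coefficients `tⱼ` vanishes on `K`, so `Ext²(k, A) = 0` gives
  -- `tⱼ = ∑ᵢ ∂ᵢfⱼ gᵢ` in `A`. In degree two only the constant terms of the `gᵢ` count; they are the
  -- coordinates of the required `ξ`.
  have hsurj : ∀ t ∈ R.space, ∃ ξ, rightContract ξ (potential f y) = t := by
    intro t ht
    let h : (Fin r → R.Alg) →ₗ[R.Alg] R.Alg :=
      Fintype.linearCombination R.Alg fun j => R.proj (leftContract (y.coord j) t)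
    obtain ⟨g, hg⟩ := hA.exists_eq_comp_d₂ x f h (by
      intro z hz
      obtain ⟨a, rfl⟩ := hy.span z hz
      have : h (fun j => R.gen (y j)) = 0 := by
        rw [← R.proj_eq_zero ht, ← sum_mul_leftContract y (R.space_le ht)]
        simp only [h, Fintype.linearCombination_apply, map_sum, map_mul, proj_ι, smul_eq_mul]
      rw [map_smul, this, smul_zero])
    refine ⟨∑ i, R.augmentation (g (Pi.single i 1)) • x.coord i, ?_⟩
    have key : ∀ j, leftContract (y.coord j) t =
        ∑ i, R.augmentation (g (Pi.single i 1)) •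
          rightContract (x.coord i) (f j : TensorAlgebra k V) := by
      intro j
      have hj1 := leftContract_mem (y.coord j) (R.space_le ht)
      have hj2 : ∀ i, rightContract (x.coord i) (f j : TensorAlgebra k V) ∈ homogeneous k V 2 :=
        fun i => rightContract_mem (x.coord i) (R.space_le (f j).2)
      refine R.proj_injOn x f le_rfl hj1
        (Submodule.sum_mem _ fun i _ => Submodule.smul_mem _ _ (hj2 i)) ?_
      have h1 := hg (Pi.single j 1)
      have h2 : R.d₂ x f (Pi.single j 1) = R.foxRow x (f j) := by simp [d₂]
      have h3 : h (Pi.single j 1) = R.proj (leftContract (y.coord j) t) := by simp [h]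
      rw [h2, h3, pi_eq_sum_univ' (R.foxRow x (f j)), map_sum] at h1
      rw [← R.gradedPart_self (R.proj_mem_component hj1), h1, map_sum, map_sum]
      refine Finset.sum_congr rfl fun i _ => ?_
      rw [map_smul, smul_eq_mul, foxRow_apply, ← zero_add 2,
        R.gradedPart_mul_add 0 2 _ (R.proj_mem_component (hj2 i)), gradedPart_zero,
        ← Algebra.commutes, ← Algebra.smul_def, map_smul]
    rw [rightContract_eq_sum x _ (potential_mem f y), ← sum_mul_leftContract y (R.space_le ht)]
    simp_rw [key, rightContract_potential, Finset.mul_sum, Finset.smul_sum]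
    rw [Finset.sum_comm]
    refine Finset.sum_congr rfl fun j _ => Finset.sum_congr rfl fun i _ => ?_
    rw [mul_smul_comm]
    congr 1
    simp [Finsupp.single_apply]
  have hleft : ∀ ξ, leftContract ξ (potential f y) ∈ R.space := by
    intro ξ
    rw [leftContract_potential]
    exact R.sum_smul_mem f _
  refine ⟨potential_mem f y, hleft, hright, ?_, ?_, ?_, hsurj, ?_⟩
  · intro ξ hξ
    rw [leftContract_potential] at hξ
    refine y.ext fun j => ?_
    have h5 : ∑ j, ξ (y j) • f j = 0 := by
      apply Subtype.ext
      simpa using hξ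
    exact Fintype.linearIndependent_iff.1 f.linearIndependent _ h5 j
  · let D : Module.Dual k V →ₗ[k] R.space :=
      { toFun := fun ξ => ⟨rightContract ξ (potential f y), hright ξ⟩
        map_add' := fun ξ η => Subtype.ext (rightContract_add ξ η _)
        map_smul' := fun c ξ => Subtype.ext (rightContract_smul c ξ _) }
    have hD : Function.Surjective D := fun t => by
      obtain ⟨ξ, hξ⟩ := hsurj t t.2
      exact ⟨ξ, Subtype.ext hξ⟩
    -- `V^*` and `R` both have dimension `r`, so surjectivity of the right contraction implies
    -- injectivity.
    have hdim : Module.finrank k (Module.Dual k V) = Module.finrank k R.space := by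
      rw [Subspace.dual_finrank_eq, Module.finrank_eq_card_basis y, Module.finrank_eq_card_basis f]
    have hDi := (LinearMap.injective_iff_surjective_of_finrank_eq_finrank hdim).2 hD
    intro ξ hξ
    exact hDi ((Subtype.ext hξ : D ξ = 0).trans (map_zero D).symm)
  · intro t ht
    refine ⟨y.constr k fun j => f.repr ⟨t, ht⟩ j, ?_⟩
    rw [leftContract_potential]
    have := congrArg R.space.subtype (f.sum_repr ⟨t, ht⟩)
    rw [map_sum] at this
    simpa [y.constr_basis] using this
  · intro w' hw' hl hr
    -- The left contractions put `w'` in the form `∑ zₘ fₘ` with `zₘ` in `V`. The right contractions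
    -- say that `z` lies in `K`, so `z = a y`, and only the constant term of `a` matters by degree.
    have hC : ∀ j, ∃ c : Fin r → k, leftContract (y.coord j) w' =
        ∑ m, c m • (f m : TensorAlgebra k V) := by
      intro j
      obtain ⟨c, hc, -⟩ := R.sum_smul_foxRow x f (hl (y.coord j))
      exact ⟨c, hc⟩
    choose C hC using hC
    have hw1 : w' = ∑ m, ι k (∑ j, C j m • y j) * (f m : TensorAlgebra k V) := by
      rw [← sum_mul_leftContract y hw']
      simp_rw [hC, map_sum, map_smul, Finset.mul_sum, Finset.sum_mul]
      rw [Finset.sum_comm]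
      simp
    have hb : (fun m => R.gen (∑ j, C j m • y j)) ∈ R.K x f := by
      rw [LinearMap.mem_ker]
      ext i
      rw [d₂_apply]
      simp_rw [← proj_ι, ← map_mul, ← map_sum]
      rw [Pi.zero_apply, ← R.proj_eq_zero (hr (x.coord i))]
      congr 1
      rw [hw1, map_sum]
      exact Finset.sum_congr rfl fun j _ =>
        (rightContract_mul_of_mem _ _ (R.space_le (f j).2)).symm
    obtain ⟨a, ha⟩ := hy.span _ hb
    refine ⟨R.augmentation a, ?_⟩
    rw [hw1, potential, Finset.smul_sum]
    refine Finset.sum_congr rfl fun m _ => ?_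
    rw [← smul_mul_assoc, ← map_smul]
    congr 2
    apply hinj
    have h1 := congrFun ha m
    rw [Pi.smul_apply, smul_eq_mul] at h1
    rw [← R.gradedPart_self (R.gen_mem_component (∑ j, C j m • y j)), h1, ← zero_add 1,
      R.gradedPart_add_mul 0 1 _ (R.gen_mem_component _), gradedPart_zero, ← Algebra.smul_def,
      map_smul]

end HomogeneousRelations

/-! ### The Hilbert series and `dim V = 2`. -/

/-- A sequence of natural numbers with generating series `1 / (1 - n t + n t³ - t⁴)` which is
bounded by a polynomial exists only for `n = 2`. -/
lemma eq_two_of_cubic_recurrence {a : ℕ → ℕ} {n : ℕ} (h0 : a 0 = 1) (h1 : a 1 = n * a 0)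
    (h2 : a 2 = n * a 1) (h3 : a 3 + n = n * a 2)
    (hrec : ∀ m, a (m + 4) + n * a (m + 1) = n * a (m + 3) + a m)
    (hle : ∀ m, a (m + 1) ≤ n * a m)
    (hpoly : ∃ c d : ℕ, ∀ m, 1 ≤ m → a m ≤ c * m ^ d) : n = 2 := by
  rcases Nat.lt_or_ge n 3 with hn | hn
  · interval_cases n
    · have := hrec 0
      have := hle 3
      simp at *
      omega
    · have := hrec 0
      have := hrec 1
      have := hrec 2
      have := hle 3
      have := hle 4
      have := hle 5
      simp at *
      omega
    · rfl
  · exfalso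
    -- The denominator is `(1 - t²)(1 - n t + t²)`, so the differences `b m = a (m + 2) - a m`
    -- satisfy `b (m + 2) = n b (m + 1) - b m`. For `n ≥ 3` they at least double at each step.
    have key : ∀ m, 2 ^ m ≤ (a (m + 2) : ℤ) - a m ∧
        2 * ((a (m + 2) : ℤ) - a m) ≤ (a (m + 3) : ℤ) - a (m + 1) := by
      intro m
      induction m with
      | zero =>
        have h3' : (a 3 : ℤ) = n * a 2 - n := by
          rw [eq_sub_iff_add_eq]
          exact_mod_cast h3
        have hn' : (3 : ℤ) ≤ n := by exact_mod_cast hn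
        simp only [zero_add, h3']
        simp only [h2, h1, h0]
        push_cast
        constructor
        · nlinarith
        · nlinarith [mul_nonneg (sub_nonneg.2 hn') (mul_self_nonneg (n : ℤ))]
      | succ m ih =>
        have hr := congrArg (Nat.cast (R := ℤ)) (hrec m)
        push_cast at hr
        have hn' : (3 : ℤ) ≤ n := by exact_mod_cast hn
        have hpos : (0 : ℤ) < 2 ^ m := by positivity
        have e1 : m + 1 + 2 = m + 3 := by ring
        have e2 : m + 1 + 3 = m + 4 := by ring
        have e3 : m + 1 + 1 = m + 2 := by ring
        rw [e1, e2, e3, pow_succ]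
        constructor
        · linarith [ih.1, ih.2]
        · have hb : (a (m + 4) : ℤ) - a (m + 2) =
              n * ((a (m + 3) : ℤ) - a (m + 1)) - ((a (m + 2) : ℤ) - a m) := by
            linarith
          rw [hb]
          nlinarith [ih.1, ih.2]
    obtain ⟨c, d, hcd⟩ := hpoly
    have hlim := tendsto_pow_const_mul_const_pow_of_abs_lt_one d (r := (1 / 2 : ℝ))
      (by rw [abs_of_pos] <;> norm_num)
    -- With `m = j + 2`, the factor `4` absorbs the shift by two in the exponent, and `c + 1` avoids
    -- division by zero when `c = 0`.
    have hev := hlim.eventually (gt_mem_nhds (show (0 : ℝ) < 1 / (4 * (c + 1)) by positivity))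
    obtain ⟨m, hm⟩ := ((hev.and (Filter.eventually_ge_atTop 2)).exists)
    obtain ⟨j, rfl⟩ := Nat.exists_eq_add_of_le' hm.2
    have hb := (key j).1
    have h4 : (2 : ℝ) ^ j ≤ c * ((j + 2 : ℕ) : ℝ) ^ d := by
      have h5 : (2 : ℤ) ^ j ≤ a (j + 2) := by
        have : (0 : ℤ) ≤ a j := by positivity
        linarith
      have h6 : 2 ^ j ≤ c * (j + 2) ^ d := le_trans (by exact_mod_cast h5) (hcd (j + 2) (by omega))
      exact_mod_cast h6
    have h7 := hm.1
    rw [one_div, inv_pow, ← div_eq_mul_inv, div_lt_div_iff₀ (by positivity) (by positivity),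
      one_mul, pow_add] at h7
    have h8 : (0 : ℝ) ≤ ((j + 2 : ℕ) : ℝ) ^ d := by positivity
    nlinarith

namespace HomogeneousRelations

open TensorAlgebra

variable {k V : Type u} [Field k] [AddCommGroup V] [Module k V]
  (R : HomogeneousRelations k V 3) {n r : ℕ} (x : Module.Basis (Fin n) k V)
  (f : Module.Basis (Fin r) k R.space)

/-- Right multiplication by an element of `A_i` as a map `A_m → A_{m+i}`. -/
def mulRightComponent (m : ℕ) {i : ℕ} {b : R.Alg} (hb : b ∈ R.component i) :
    R.component m →ₗ[k] R.component (m + i) :=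
  (LinearMap.mulRight k b).restrict fun _ ha => R.mul_mem_component ha hb

lemma rightContract_relation_mem (i : Fin n) (j : Fin r) :
    R.proj (rightContract (x.coord i) (f j : TensorAlgebra k V)) ∈ R.component 2 :=
  R.proj_mem_component (rightContract_mem (x.coord i) (R.space_le (f j).2))

/-- The map `A_m ⊗ V → A_{m+1}`. -/
def d₁Component (m : ℕ) : (Fin n → R.component m) →ₗ[k] R.component (m + 1) :=
  ∑ i, R.mulRightComponent m (R.gen_mem_component (x i)) ∘ₗ LinearMap.proj i

/-- The map `A_m ⊗ R → A_{m+2} ⊗ V`. -/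
def d₂Component (m : ℕ) : (Fin r → R.component m) →ₗ[k] (Fin n → R.component (m + 2)) :=
  LinearMap.pi fun i => ∑ j,
    R.mulRightComponent m (R.rightContract_relation_mem x f i j) ∘ₗ LinearMap.proj j

/-- The map `A_m → A_{m+1} ⊗ R` of multiplication by the generator of `K`. -/
def d₃Component (y : Fin r → V) (m : ℕ) : R.component m →ₗ[k] (Fin r → R.component (m + 1)) :=
  LinearMap.pi fun j => R.mulRightComponent m (R.gen_mem_component (y j))

lemma coe_d₁Component (m : ℕ) (a : Fin n → R.component m) :
    (R.d₁Component x m a : R.Alg) = R.d₁ x fun i => (a i : R.Alg) := by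
  simp [d₁Component, d₁_apply, mulRightComponent]
  rfl

lemma coe_d₂Component (m : ℕ) (b : Fin r → R.component m) (i : Fin n) :
    (R.d₂Component x f m b i : R.Alg) = R.d₂ x f (fun i => (b i : R.Alg)) i := by
  simp [d₂Component, d₂_apply, mulRightComponent]
  rfl

lemma coe_d₃Component (y : Fin r → V) (m : ℕ) (a : R.component m) (j : Fin r) :
    (R.d₃Component y m a j : R.Alg) = a * R.gen (y j) := rfl

lemma d₁Component_surjective (m : ℕ) : Function.Surjective (R.d₁Component x m) := by
  rintro ⟨c, hc⟩
  obtain ⟨t, ht, rfl⟩ := R.exists_proj_eq hc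
  refine ⟨fun i => ⟨R.foxRow x t i, R.proj_mem_component (rightContract_mem _ ht)⟩, ?_⟩
  apply Subtype.ext
  rw [coe_d₁Component]
  exact R.d₁_foxRow x ht

include f in
lemma d₁Component_injective {m : ℕ} (hm : m ≤ 1) : Function.Injective (R.d₁Component x m) := by
  rw [← LinearMap.ker_eq_bot, LinearMap.ker_eq_bot']
  intro a ha
  have h : R.d₁ x (fun i => (a i : R.Alg)) = 0 := by rw [← coe_d₁Component, ha]; rfl
  obtain ⟨b, hb⟩ := R.exists_d₂_eq x f h
  ext i
  rw [← R.gradedPart_self (a i).2, ← congrFun hb i, d₂_apply, map_sum]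
  exact Finset.sum_eq_zero fun j _ =>
    R.gradedPart_mul_of_lt _ (R.rightContract_relation_mem x f i j) (by omega)

lemma ker_d₁Component (m : ℕ) :
    LinearMap.ker (R.d₁Component x (m + 2)) = LinearMap.range (R.d₂Component x f m) := by
  ext a
  rw [LinearMap.mem_ker, LinearMap.mem_range]
  constructor
  · intro ha
    have h : R.d₁ x (fun i => (a i : R.Alg)) = 0 := by rw [← coe_d₁Component, ha]; rfl
    obtain ⟨b, hb⟩ := R.exists_d₂_eq x f h
    refine ⟨fun j => ⟨R.gradedPart m (b j), R.gradedPart_mem _ _⟩, ?_⟩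
    ext i
    rw [coe_d₂Component, ← R.gradedPart_d₂, hb, R.gradedPart_self (a i).2]
  · rintro ⟨b, rfl⟩
    apply Subtype.ext
    rw [coe_d₁Component]
    simp_rw [coe_d₂Component]
    exact R.d₁_d₂ x f _

lemma d₂Component_zero_injective : Function.Injective (R.d₂Component x f 0) := by
  rw [← LinearMap.ker_eq_bot, LinearMap.ker_eq_bot']
  intro b hb
  have h : (fun j => (b j : R.Alg)) ∈ R.K x f := by
    rw [LinearMap.mem_ker]
    ext i
    rw [← coe_d₂Component, hb]
    rfl
  ext j
  rw [← R.gradedPart_self (b j).2, gradedPart_zero, R.augmentation_of_mem_K x f h j, map_zero]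
  rfl

variable {R x f}

lemma IsKernelBasis.ker_d₂Component {y : Module.Basis (Fin r) k V} (hy : IsKernelBasis x f y)
    (m : ℕ) :
    LinearMap.ker (R.d₂Component x f (m + 1)) = LinearMap.range (R.d₃Component y m) := by
  ext b
  rw [LinearMap.mem_ker, LinearMap.mem_range]
  constructor
  · intro hb
    have h : (fun j => (b j : R.Alg)) ∈ R.K x f := by
      rw [LinearMap.mem_ker]
      ext i
      rw [← coe_d₂Component, hb]
      rfl
    obtain ⟨a, ha⟩ := hy.span _ h
    refine ⟨⟨R.gradedPart m a, R.gradedPart_mem _ _⟩, ?_⟩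
    ext j
    rw [coe_d₃Component, ← R.gradedPart_add_mul m 1 a (R.gen_mem_component _),
      ← R.gradedPart_self (b j).2]
    exact congrArg _ (congrFun ha j).symm
  · rintro ⟨a, rfl⟩
    ext i
    rw [coe_d₂Component]
    have h := (R.K x f).smul_mem (a : R.Alg) hy.mem
    exact congrFun (LinearMap.mem_ker.1 h) i

lemma IsKernelBasis.d₃Component_injective {y : Module.Basis (Fin r) k V}
    (hy : IsKernelBasis x f y) (m : ℕ) : Function.Injective (R.d₃Component y m) := by
  rw [← LinearMap.ker_eq_bot, LinearMap.ker_eq_bot']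
  intro a ha
  apply Subtype.ext
  apply hy.free
  ext j
  exact congrArg Subtype.val (congrFun ha j)

lemma finite_component [Module.Finite k V] (R : HomogeneousRelations k V 3) (m : ℕ) :
    Module.Finite k (R.component m) := by
  rw [Module.Finite.iff_fg]
  have : (LinearMap.range R.gen).FG := by
    rw [← Module.Finite.iff_fg]
    infer_instance
  exact this.pow m

/-- Dimension count, degree by degree, in `0 → A(-4) → A(-3)^n → A(-1)^n → A → k → 0`. The bases of
`V` and `R` share the index `n`, which is legitimate since `K` is generated by a basis of `V`
indexed like that of `R`. -/
lemma IsKernelBasis.card_eq_two {n : ℕ} {x : Module.Basis (Fin n) k V}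
    {f : Module.Basis (Fin n) k R.space} (hA : R.IsASRegular 3)
    {y : Module.Basis (Fin n) k V} (hy : IsKernelBasis x f y) : n = 2 := by
  have hV : Module.Finite k V := Module.Finite.of_basis x
  have hfin := R.finite_component
  have hpi : ∀ m, Module.finrank k (Fin n → R.component m) =
      n * Module.finrank k (R.component m) := by
    intro m
    rw [Module.finrank_pi_fintype]
    simp
  have h1 : ∀ m, Module.finrank k (R.component (m + 1)) +
      Module.finrank k (LinearMap.ker (R.d₁Component x m)) =
        n * Module.finrank k (R.component m) := by
    intro m
    rw [← hpi, ← LinearMap.finrank_range_add_finrank_ker (R.d₁Component x m),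
      LinearMap.range_eq_top.2 (R.d₁Component_surjective x m), finrank_top]
  have h2 : ∀ m, Module.finrank k (LinearMap.ker (R.d₁Component x (m + 2))) +
      Module.finrank k (LinearMap.ker (R.d₂Component x f m)) =
        n * Module.finrank k (R.component m) := by
    intro m
    rw [← hpi, ← LinearMap.finrank_range_add_finrank_ker (R.d₂Component x f m), R.ker_d₁Component]
  have h3 : ∀ m, Module.finrank k (LinearMap.ker (R.d₂Component x f (m + 1))) =
      Module.finrank k (R.component m) := by
    intro m
    rw [hy.ker_d₂Component, LinearMap.finrank_range_of_inj (hy.d₃Component_injective m)]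
  have h4 : Module.finrank k (LinearMap.ker (R.d₂Component x f 0)) = 0 := by
    rw [LinearMap.ker_eq_bot.2 (R.d₂Component_zero_injective x f), finrank_bot]
  have h5 : ∀ m ≤ 1, Module.finrank k (LinearMap.ker (R.d₁Component x m)) = 0 := by
    intro m hm
    rw [LinearMap.ker_eq_bot.2 (R.d₁Component_injective x f hm), finrank_bot]
  have h0 : Module.finrank k (R.component 0) = 1 := by
    rw [component, pow_zero, Submodule.one_eq_range,
      LinearMap.finrank_range_of_inj R.algebraMap_injective, Module.finrank_self]
  refine eq_two_of_cubic_recurrence (a := fun m => Module.finrank k (R.component m)) h0 ?_ ?_ ?_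
    ?_ ?_ hA.polynomial_growth
  · have := h1 0
    rw [h5 0 zero_le_one] at this
    exact this
  · have := h1 1
    rw [h5 1 le_rfl] at this
    exact this
  · have e1 := h1 2
    have e2 := h2 0
    rw [h4, h0] at e2
    rw [add_zero, mul_one] at e2
    rw [e2] at e1
    exact e1
  · intro m
    have e1 : Module.finrank k (R.component (m + 4)) + _ = _ := h1 (m + 3)
    have e2 := h2 (m + 1)
    rw [h3] at e2
    change Module.finrank k (LinearMap.ker (R.d₁Component x (m + 3))) + _ = _ at e2
    omega
  · intro m
    have := h1 m
    omega

end HomogeneousRelations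

/-! ### Yoneda products in `E(A)` by lifting chain maps. -/

namespace CategoryTheory.Abelian.Ext

universe v w

variable {C : Type u} [Category.{v} C] [Abelian C] [HasExt.{w} C]

/-- The map `h` lifts `y` past one extension, so that the product becomes a single long splice
followed by `h ≫ x`. The primed version lifts twice. -/
lemma comp_comp_of_naturality {X Y Z K X' Y' W : C} (α : Ext.{w} X Y 1) (β : Ext.{w} Y Z 1)
    (γ : Ext.{w} Z K 1) (α' : Ext.{w} X' Y' 1) (y : Z ⟶ X') (x : Y' ⟶ W) (h : K ⟶ Y')
    (hh : γ.comp (mk₀ h) (add_zero 1) = (mk₀ y).comp α' (zero_add 1)) :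
    (α.comp (β.comp (mk₀ y) (add_zero 1)) (show 1 + 1 = 2 by omega)).comp
      (α'.comp (mk₀ x) (add_zero 1)) (show 2 + 1 = 3 by omega) =
    α.comp (β.comp (γ.comp (mk₀ (h ≫ x)) (add_zero 1)) (show 1 + 1 = 2 by omega))
      (show 1 + 2 = 3 by omega) := by
  rw [comp_assoc α _ _ (show 1 + 1 = 2 by omega) (show 1 + 1 = 2 by omega) (by omega),
    comp_assoc β _ _ (add_zero 1) (zero_add 1) (by omega),
    ← comp_assoc (mk₀ y) α' (mk₀ x) (zero_add 1) (add_zero 1) (by omega), ← hh,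
    comp_assoc γ _ _ (add_zero 1) (add_zero 0) (by omega), mk₀_comp_mk₀]

lemma comp_comp_of_naturality' {X Y Z K X' Y' Z' W : C} (α : Ext.{w} X Y 1) (β : Ext.{w} Y Z 1)
    (γ : Ext.{w} Z K 1) (α' : Ext.{w} X' Y' 1) (β' : Ext.{w} Y' Z' 1) (x : Y ⟶ X') (y : Z' ⟶ W)
    (h₁ : Z ⟶ Y') (h₂ : K ⟶ Z')
    (hh₁ : β.comp (mk₀ h₁) (add_zero 1) = (mk₀ x).comp α' (zero_add 1))
    (hh₂ : γ.comp (mk₀ h₂) (add_zero 1) = (mk₀ h₁).comp β' (zero_add 1)) :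
    (α.comp (mk₀ x) (add_zero 1)).comp
      (α'.comp (β'.comp (mk₀ y) (add_zero 1)) (show 1 + 1 = 2 by omega))
      (show 1 + 2 = 3 by omega) =
    α.comp (β.comp (γ.comp (mk₀ (h₂ ≫ y)) (add_zero 1)) (show 1 + 1 = 2 by omega))
      (show 1 + 2 = 3 by omega) := by
  rw [comp_assoc α _ _ (add_zero 1) (show 0 + 2 = 2 by omega) (by omega),
    ← comp_assoc (mk₀ x) α' _ (zero_add 1) (show 1 + 1 = 2 by omega) (by omega), ← hh₁,
    comp_assoc β _ _ (add_zero 1) (zero_add 1) (by omega),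
    ← comp_assoc (mk₀ h₁) β' (mk₀ y) (zero_add 1) (add_zero 1) (by omega), ← hh₂,
    comp_assoc γ _ _ (add_zero 1) (add_zero 0) (by omega), mk₀_comp_mk₀]

end CategoryTheory.Abelian.Ext

namespace HomogeneousRelations

open TensorAlgebra

variable {k V : Type u} [Field k] [AddCommGroup V] [Module k V]
  (R : HomogeneousRelations k V 3) {n r : ℕ} (x : Module.Basis (Fin n) k V)
  (f : Module.Basis (Fin r) k R.space)

/-- The identification of the trivial module with `k`. -/
def scalar : R.TrivialModule ≃+ k := AddEquiv.refl k

lemma scalar_smul (a : R.Alg) (c : R.TrivialModule) :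
    R.scalar (a • c) = R.augmentation a * R.scalar c := rfl

lemma scalar_augmentationLin (a : R.Alg) : R.scalar (R.augmentationLin a) = R.augmentation a := rfl

lemma scalar_smul_hom {X : ModuleCat.{u} R.Alg} (c : k) (g : X ⟶ R.trivialObj) (z : X) :
    R.scalar ((c • g).hom z) = c * R.scalar (g.hom z) := by
  change R.augmentation (algebraMap k R.Alg c) * R.scalar (g.hom z) = _
  rw [AlgHom.commutes]
  rfl

/-- The map `V → A_{≥1}`. -/
def genAug (v : V) : R.augIdeal :=
  ⟨R.gen v, by rw [RingHom.mem_ker]; exact R.augmentation_gen v⟩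

lemma genAug_add (v w : V) : R.genAug (v + w) = R.genAug v + R.genAug w :=
  Subtype.ext (map_add R.gen v w)

lemma genAug_smul (c : k) (v : V) : R.genAug (c • v) = algebraMap k R.Alg c • R.genAug v := by
  apply Subtype.ext
  rw [Submodule.coe_smul, smul_eq_mul, ← Algebra.smul_def]
  exact map_smul R.gen c v

lemma scalar_extendForm (ξ : Module.Dual k V) (v : V) :
    R.scalar (R.extendForm ξ (R.genAug v)) = ξ v := R.extendForm_gen ξ v _

lemma d₁Aug_eq_sum (a : Fin n → R.Alg) : R.d₁Aug x a = ∑ i, a i • R.genAug (x i) := by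
  apply Subtype.ext
  rw [AddSubmonoidClass.coe_finsetSum]
  rfl

lemma d₁Aug_surjective : Function.Surjective (R.d₁Aug x) := by
  rintro ⟨a, ha⟩
  obtain ⟨b, hb⟩ := R.exists_d₁_eq x ha
  exact ⟨b, Subtype.ext hb⟩

section Naturality

/-- These naturality squares feed the product formulas: `h'` is the chain lift on the projective
middle terms, and `h` the map it induces on the kernels. -/
lemma class₂_comp_mk₀ (h : R.K x f →ₗ[R.Alg] R.augIdeal) (h' : (Fin r → R.Alg) →ₗ[R.Alg] R.Alg)
    (y : R.Syzygy x f →ₗ[R.Alg] R.TrivialModule) (h1 : ∀ z : R.K x f, (h z : R.Alg) = h' z)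
    (h2 : ∀ b, y (Submodule.Quotient.mk b) = R.augmentationLin (h' b)) :
    (R.class₂ x f).comp (Ext.mk₀ (ModuleCat.ofHom h)) (add_zero 1) =
      (Ext.mk₀ (ModuleCat.ofHom y)).comp R.class₀ (zero_add 1) := by
  let F : R.sequence₂ x f ⟶ R.augSequence :=
    { τ₁ := ModuleCat.ofHom h
      τ₂ := ModuleCat.ofHom h'
      τ₃ := ModuleCat.ofHom y
      comm₁₂ := by
        apply ModuleCat.hom_ext
        apply LinearMap.ext
        intro z
        exact h1 z
      comm₂₃ := by
        apply ModuleCat.hom_ext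
        apply LinearMap.ext
        intro b
        exact (h2 b).symm }
  exact ShortComplex.ShortExact.extClass_naturality (R.sequence₂_shortExact x f)
    R.augSequence_shortExact F

lemma class₁_comp_mk₀ (h : R.Syzygy x f →ₗ[R.Alg] R.augIdeal)
    (h' : (Fin n → R.Alg) →ₗ[R.Alg] R.Alg)
    (y : R.augIdeal →ₗ[R.Alg] R.TrivialModule)
    (h1 : ∀ b, (h (Submodule.Quotient.mk b) : R.Alg) = h' (R.d₂ x f b))
    (h2 : ∀ a, y (R.d₁Aug x a) = R.augmentationLin (h' a)) :
    (R.class₁ x f).comp (Ext.mk₀ (ModuleCat.ofHom h)) (add_zero 1) =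
      (Ext.mk₀ (ModuleCat.ofHom y)).comp R.class₀ (zero_add 1) := by
  let F : R.sequence₁ x f ⟶ R.augSequence :=
    { τ₁ := ModuleCat.ofHom h
      τ₂ := ModuleCat.ofHom h'
      τ₃ := ModuleCat.ofHom y
      comm₁₂ := by
        apply ModuleCat.hom_ext
        apply LinearMap.ext
        intro z
        obtain ⟨b, rfl⟩ := Submodule.Quotient.mk_surjective _ z
        exact h1 b
      comm₂₃ := by
        apply ModuleCat.hom_ext
        apply LinearMap.ext
        intro b
        exact (h2 b).symm }
  exact ShortComplex.ShortExact.extClass_naturality (R.sequence₁_shortExact x f)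
    R.augSequence_shortExact F

lemma class₂_comp_mk₀' (h : R.K x f →ₗ[R.Alg] R.Syzygy x f)
    (h' : (Fin r → R.Alg) →ₗ[R.Alg] (Fin n → R.Alg))
    (y : R.Syzygy x f →ₗ[R.Alg] R.augIdeal)
    (h1 : ∀ z : R.K x f, R.syzygyIncl x f (h z) = h' z)
    (h2 : ∀ b, (y (Submodule.Quotient.mk b) : R.Alg) = R.d₁ x (h' b)) :
    (R.class₂ x f).comp (Ext.mk₀ (ModuleCat.ofHom h)) (add_zero 1) =
      (Ext.mk₀ (ModuleCat.ofHom y)).comp (R.class₁ x f) (zero_add 1) := by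
  let F : R.sequence₂ x f ⟶ R.sequence₁ x f :=
    { τ₁ := ModuleCat.ofHom h
      τ₂ := ModuleCat.ofHom h'
      τ₃ := ModuleCat.ofHom y
      comm₁₂ := by
        apply ModuleCat.hom_ext
        apply LinearMap.ext
        intro z
        exact h1 z
      comm₂₃ := by
        apply ModuleCat.hom_ext
        apply LinearMap.ext
        intro b
        exact Subtype.ext (h2 b).symm }
  exact ShortComplex.ShortExact.extClass_naturality (R.sequence₂_shortExact x f)
    (R.sequence₁_shortExact x f) F

end Naturality

section Forms

include x in
lemma augIdeal_hom_ext {g h : R.augIdeal →ₗ[R.Alg] R.TrivialModule}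
    (hgh : ∀ v, R.scalar (g (R.genAug v)) = R.scalar (h (R.genAug v))) : g = h := by
  apply LinearMap.ext
  intro z
  obtain ⟨b, rfl⟩ := R.d₁Aug_surjective x z
  rw [d₁Aug_eq_sum, map_sum, map_sum]
  exact Finset.sum_congr rfl fun i _ => by rw [map_smul, map_smul, R.scalar.injective (hgh (x i))]

lemma syzygy_hom_ext {g h : R.Syzygy x f →ₗ[R.Alg] R.TrivialModule}
    (hgh : ∀ b, R.scalar (g (Submodule.Quotient.mk b)) = R.scalar (h (Submodule.Quotient.mk b))) :
    g = h := by
  apply LinearMap.ext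
  intro b
  obtain ⟨b, rfl⟩ := Submodule.Quotient.mk_surjective _ b
  exact R.scalar.injective (hgh b)

/-- The linear map `Ω² → k` defined by a linear form on `R`. -/
def relationForm (η : Module.Dual k R.space) : R.Syzygy x f →ₗ[R.Alg] R.TrivialModule :=
  (R.K x f).liftQ
    (R.augmentationLin ∘ₗ
      Fintype.linearCombination R.Alg fun j => algebraMap k R.Alg (η (f j)))
    (fun b hb => by
      change R.augmentation (Fintype.linearCombination R.Alg _ b) = 0
      rw [Fintype.linearCombination_apply, map_sum]
      refine Finset.sum_eq_zero fun j _ => ?_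
      rw [smul_eq_mul, map_mul, R.augmentation_of_mem_K x f hb, zero_mul])

lemma relationForm_mk (η : Module.Dual k R.space) (b : Fin r → R.Alg) :
    R.scalar (R.relationForm x f η (Submodule.Quotient.mk b)) =
      ∑ j, R.augmentation (b j) * η (f j) := by
  change R.augmentation (Fintype.linearCombination R.Alg _ b) = _
  rw [Fintype.linearCombination_apply, map_sum]
  simp

/-- The element of `Ext²(k, k)` defined by a linear form on `R`. -/
def degreeTwo (η : Module.Dual k R.space) : R.ExtK 2 :=
  R.ext₂Of x f (ModuleCat.ofHom (R.relationForm x f η))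

lemma degreeOne_eq (ξ : Module.Dual k V) :
    R.degreeOne ξ = R.class₀.comp (Ext.mk₀ (ModuleCat.ofHom (R.extendForm ξ))) (add_zero 1) := rfl

include x in
lemma degreeOne_surjective (e : R.ExtK 1) : ∃ ξ, R.degreeOne ξ = e := by
  obtain ⟨e₀, rfl⟩ := R.exists_class₀_comp_eq (add_zero 1) e
  obtain ⟨g, rfl⟩ := (Ext.mk₀_bijective _ _).2 e₀
  refine ⟨{ toFun := fun v => R.scalar (g.hom (R.genAug v))
            map_add' := fun v w => by rw [genAug_add, map_add, map_add]
            map_smul' := fun c v => by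
              rw [genAug_smul, map_smul, scalar_smul, AlgHom.commutes]
              rfl }, ?_⟩
  rw [degreeOne_eq]
  congr 2
  apply ModuleCat.hom_ext
  apply R.augIdeal_hom_ext x
  intro v
  exact R.scalar_extendForm _ v

lemma degreeTwo_surjective (e : R.ExtK 2) : ∃ η, R.degreeTwo x f η = e := by
  obtain ⟨g, rfl⟩ := R.ext₂Of_surjective x f e
  refine ⟨f.constr k fun j => R.scalar (g.hom (Submodule.Quotient.mk (Pi.single j 1))), ?_⟩
  rw [degreeTwo]
  congr 1
  apply ModuleCat.hom_ext
  apply R.syzygy_hom_ext x f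
  intro b
  have hb : (Submodule.Quotient.mk b : R.Syzygy x f) =
      ∑ j, b j • Submodule.Quotient.mk (Pi.single j 1) := by
    conv_lhs => rw [pi_eq_sum_univ' b]
    exact map_sum (R.K x f).mkQ _ _
  change R.scalar (R.relationForm x f _ (Submodule.Quotient.mk b)) = _
  rw [relationForm_mk, hb, map_sum, map_sum]
  simp_rw [map_smul, f.constr_basis, scalar_smul]

lemma degreeZero_surjective (e : R.ExtK 0) : ∃ c : k, c • Ext.mk₀ (𝟙 R.trivialObj) = e := by
  obtain ⟨g, rfl⟩ := (Ext.mk₀_bijective _ _).2 e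
  refine ⟨R.scalar (g.hom (R.scalar.symm 1)), ?_⟩
  rw [← Ext.mk₀_smul]
  congr 1
  apply ModuleCat.hom_ext
  apply LinearMap.ext
  intro c
  apply R.scalar.injective
  have h1 : c = algebraMap k R.Alg (R.scalar c) • R.scalar.symm 1 := by
    apply R.scalar.injective
    rw [scalar_smul, AlgHom.commutes, AddEquiv.apply_symm_apply]
    exact (mul_one _).symm
  rw [scalar_smul_hom]
  conv_rhs => rw [h1, map_smul, scalar_smul, AlgHom.commutes]
  exact mul_comm _ _

lemma IsASRegular.extK_eq_zero {R : HomogeneousRelations k V 3} (hA : R.IsASRegular 3) {m : ℕ}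
    (hm : 4 ≤ m) (e : R.ExtK m) : e = 0 := by
  have : HasProjectiveDimensionLT R.trivialObj 4 :=
    (projectiveDimension_le_iff _ 3).1 (hA.globalDimension.1 R.trivialObj)
  exact Ext.eq_zero_of_hasProjectiveDimensionLT e 4 hm

/-- The map `V^* → Ext¹(k, k)` as a linear map. -/
def degreeOneLin : Module.Dual k V →ₗ[k] R.ExtK 1 where
  toFun := R.degreeOne
  map_add' ξ η := by
    rw [degreeOne_eq, degreeOne_eq, degreeOne_eq, ← Ext.comp_add, ← Ext.mk₀_add]
    congr 2
    apply ModuleCat.hom_ext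
    apply R.augIdeal_hom_ext x
    intro v
    change R.scalar (R.extendForm (ξ + η) _) =
      R.scalar (R.extendForm ξ _) + R.scalar (R.extendForm η _)
    rw [scalar_extendForm, scalar_extendForm, scalar_extendForm]
    rfl
  map_smul' c ξ := by
    rw [degreeOne_eq, degreeOne_eq, RingHom.id_apply, ← Ext.comp_smul, ← Ext.mk₀_smul]
    congr 2
    apply ModuleCat.hom_ext
    apply R.augIdeal_hom_ext x
    intro v
    rw [scalar_smul_hom]
    change R.scalar (R.extendForm (c • ξ) _) = c * R.scalar (R.extendForm ξ _)
    rw [scalar_extendForm, scalar_extendForm]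
    rfl

/-- The map `R^* → Ext²(k, k)` as a linear map. -/
def degreeTwoLin : Module.Dual k R.space →ₗ[k] R.ExtK 2 where
  toFun := R.degreeTwo x f
  map_add' ξ η := by
    rw [degreeTwo, degreeTwo, degreeTwo, ← ext₂Of_add]
    congr 1
    apply ModuleCat.hom_ext
    apply R.syzygy_hom_ext x f
    intro b
    change R.scalar (R.relationForm x f (ξ + η) (Submodule.Quotient.mk b)) =
      R.scalar (R.relationForm x f ξ (Submodule.Quotient.mk b) +
        R.relationForm x f η (Submodule.Quotient.mk b))
    rw [map_add]
    rw [relationForm_mk, relationForm_mk, relationForm_mk]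
    simp_rw [LinearMap.add_apply, mul_add, Finset.sum_add_distrib]
  map_smul' c ξ := by
    rw [degreeTwo, degreeTwo, RingHom.id_apply, ← ext₂Of_smul]
    congr 1
    apply ModuleCat.hom_ext
    apply R.syzygy_hom_ext x f
    intro b
    rw [scalar_smul_hom]
    change R.scalar (R.relationForm x f (c • ξ) _) = c * R.scalar (R.relationForm x f ξ _)
    rw [relationForm_mk, relationForm_mk, Finset.mul_sum]
    exact Finset.sum_congr rfl fun j _ => by
      rw [LinearMap.smul_apply, smul_eq_mul, mul_left_comm]

end Forms

section Products

variable {R x f} {y : Module.Basis (Fin r) k V} (hy : IsKernelBasis x f y)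
include hy

/-- The generator of `K`. -/
def IsKernelBasis.generator : R.K x f := ⟨fun j => R.gen (y j), hy.mem⟩

/-- The kernel `K` is free of rank one. -/
def IsKernelBasis.equiv : R.Alg ≃ₗ[R.Alg] R.K x f :=
  LinearEquiv.ofBijective (LinearMap.toSpanSingleton R.Alg _ hy.generator) (by
    constructor
    · rw [← LinearMap.ker_eq_bot, LinearMap.ker_eq_bot']
      intro a ha
      exact hy.free a (congrArg Subtype.val ha)
    · rintro ⟨z, hz⟩
      obtain ⟨a, ha⟩ := hy.span z hz
      exact ⟨a, Subtype.ext ha.symm⟩)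

lemma IsKernelBasis.equiv_one : hy.equiv 1 = hy.generator := one_smul R.Alg hy.generator

lemma IsKernelBasis.hom_ext {M : Type u} [AddCommGroup M] [Module R.Alg M]
    {g h : R.K x f →ₗ[R.Alg] M} (hgh : g hy.generator = h hy.generator) : g = h := by
  apply LinearMap.ext
  rintro ⟨z, hz⟩
  obtain ⟨a, rfl⟩ := hy.span z hz
  have : (⟨_, hz⟩ : R.K x f) = a • hy.generator := rfl
  rw [this, map_smul, map_smul, hgh]

/-- The linear map `K → k` which is `1` on the generator. -/
def IsKernelBasis.topForm : R.K x f →ₗ[R.Alg] R.TrivialModule :=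
  R.augmentationLin ∘ₗ hy.equiv.symm.toLinearMap

lemma IsKernelBasis.topForm_generator : R.scalar (hy.topForm hy.generator) = 1 := by
  change R.augmentation (hy.equiv.symm hy.generator) = 1
  rw [← hy.equiv_one, LinearEquiv.symm_apply_apply, map_one]

/-- The generator of `Ext³(k, k)`. -/
def IsKernelBasis.top : R.ExtK 3 := R.ext₃Of x f (ModuleCat.ofHom hy.topForm)

lemma IsKernelBasis.ext₃Of_eq (g : R.K x f →ₗ[R.Alg] R.TrivialModule) :
    R.ext₃Of x f (ModuleCat.ofHom g) = R.scalar (g hy.generator) • hy.top := by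
  rw [IsKernelBasis.top, ← ext₃Of_smul]
  congr 1
  apply ModuleCat.hom_ext
  apply hy.hom_ext
  apply R.scalar.injective
  rw [scalar_smul_hom]
  change R.scalar (g hy.generator) = _ * R.scalar (hy.topForm hy.generator)
  rw [hy.topForm_generator, mul_one]

lemma IsKernelBasis.top_surjective (e : R.ExtK 3) : ∃ c : k, c • hy.top = e := by
  obtain ⟨g, rfl⟩ := R.ext₃Of_surjective x f e
  exact ⟨_, (hy.ext₃Of_eq g.hom).symm⟩

/-- An `A`-linear map `A ⊗ R → k` kills the generator of `K`, whose entries lie in `A_{≥1}`; so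
`topForm` is not a restriction. -/
lemma IsKernelBasis.top_ne_zero : hy.top ≠ 0 := by
  intro h
  obtain ⟨g, hg⟩ := (R.ext₃Of_eq_zero_iff x f _).1 h
  have h1 : R.scalar (hy.topForm hy.generator) = R.scalar (g.hom fun j => R.gen (y j)) :=
    congrArg R.scalar (LinearMap.congr_fun (congrArg ModuleCat.Hom.hom hg) hy.generator).symm
  rw [hy.topForm_generator, pi_eq_sum_univ' (fun j => R.gen (y j)), map_sum, map_sum,
    Finset.sum_eq_zero] at h1
  · exact one_ne_zero h1
  · intro j _
    rw [map_smul, scalar_smul, augmentation_gen, zero_mul]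

/-- In `E(A)` this is the product `ξ • η`. The chain lift of `η` is the form with coefficients
`η(fⱼ)`; it sends the generator of `K` to `∑ η(fⱼ) yⱼ`, on which `ξ` takes the value of `η` at the
left contraction. There is no sign, as the result is a splice of the same three classes as `top`. -/
theorem IsKernelBasis.degreeTwo_comp_degreeOne (ξ : Module.Dual k V) (η : Module.Dual k R.space)
    (hξ : leftContract ξ (potential f y) ∈ R.space) :
    (R.degreeTwo x f η).comp (R.degreeOne ξ) (show 2 + 1 = 3 by omega) =
      η ⟨leftContract ξ (potential f y), hξ⟩ • hy.top := by
  let h' : (Fin r → R.Alg) →ₗ[R.Alg] R.Alg :=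
    Fintype.linearCombination R.Alg fun j => algebraMap k R.Alg (η (f j))
  let h : R.K x f →ₗ[R.Alg] R.augIdeal := (h'.domRestrict (R.K x f)).codRestrict R.augIdeal
    fun z => augmentation_restriction x f h' z.2
  have hnat := R.class₂_comp_mk₀ x f h h' (R.relationForm x f η) (fun _ => rfl) (fun _ => rfl)
  rw [degreeTwo, ext₂Of, degreeOne_eq, Ext.comp_comp_of_naturality _ _ _ _ _ _ _ hnat]
  refine (hy.ext₃Of_eq (R.extendForm ξ ∘ₗ h)).trans ?_
  congr 1
  have h1 : h hy.generator = R.genAug (∑ j, η (f j) • y j) := by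
    apply Subtype.ext
    change h' (fun j => R.gen (y j)) = R.gen _
    simp [h', Fintype.linearCombination_apply, Algebra.smul_def, Algebra.commutes]
  rw [LinearMap.comp_apply, h1, scalar_extendForm]
  have h2 : (⟨leftContract ξ (potential f y), hξ⟩ : R.space) = ∑ j, ξ (y j) • f j := by
    apply Subtype.ext
    rw [AddSubmonoidClass.coe_finsetSum]
    exact leftContract_potential f y ξ
  rw [h2]
  simp [mul_comm]

/-- This is `η • ξ`, and `ξ` must be lifted twice: to `p` on `A ⊗ V`, then to `h₂'` on `A ⊗ R`. On
the generator of `K` the second lift is the row of the right contraction of the potential. That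
contraction lies in `R`, and its coordinates `c` define the induced map `K → Ω²`. -/
theorem IsKernelBasis.degreeOne_comp_degreeTwo (ξ : Module.Dual k V) (η : Module.Dual k R.space)
    (hξ : rightContract ξ (potential f y) ∈ R.space) :
    (R.degreeOne ξ).comp (R.degreeTwo x f η) (show 1 + 2 = 3 by omega) =
      η ⟨rightContract ξ (potential f y), hξ⟩ • hy.top := by
  let p : (Fin n → R.Alg) →ₗ[R.Alg] R.Alg :=
    Fintype.linearCombination R.Alg fun i => algebraMap k R.Alg (ξ (x i))
  have hp : ∀ a, p a = ∑ i, ξ (x i) • a i := fun a => by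
    simp [p, Fintype.linearCombination_apply, Algebra.smul_def, Algebra.commutes]
  have hpf : ∀ t ∈ R.space, p (R.foxRow x t) = R.proj (rightContract ξ t) := fun t ht => by
    rw [hp, rightContract_eq_sum x ξ (R.space_le ht), map_sum]
    simp
  let h₁' : R.Syzygy x f →ₗ[R.Alg] R.Alg := p ∘ₗ R.syzygyIncl x f
  let h₂' : (Fin r → R.Alg) →ₗ[R.Alg] (Fin n → R.Alg) :=
    Fintype.linearCombination R.Alg fun j => R.foxRow x (rightContract ξ (f j))
  have h12 : ∀ b, h₁' (Submodule.Quotient.mk b) = R.d₁ x (h₂' b) := by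
    intro b
    change p (R.d₂ x f b) = _
    simp only [d₂, h₂', Fintype.linearCombination_apply, map_sum, map_smul]
    refine Finset.sum_congr rfl fun j _ => ?_
    rw [hpf _ (f j).2, R.d₁_foxRow x (rightContract_mem ξ (R.space_le (f j).2))]
  let h₁ : R.Syzygy x f →ₗ[R.Alg] R.augIdeal := h₁'.codRestrict R.augIdeal fun z => by
    obtain ⟨b, rfl⟩ := Submodule.Quotient.mk_surjective _ z
    rw [h12]
    exact R.d₁_mem_augIdeal x _
  obtain ⟨c, hc, hc2⟩ := R.sum_smul_foxRow x f hξ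
  let h₂ : R.K x f →ₗ[R.Alg] R.Syzygy x f :=
    LinearMap.toSpanSingleton R.Alg _ (Submodule.Quotient.mk fun j => algebraMap k R.Alg (c j)) ∘ₗ
      hy.equiv.symm.toLinearMap
  have hgen : h₂ hy.generator = Submodule.Quotient.mk fun j => algebraMap k R.Alg (c j) := by
    rw [LinearMap.comp_apply, LinearMap.toSpanSingleton_apply]
    change hy.equiv.symm hy.generator • (Submodule.Quotient.mk _ : R.Syzygy x f) = _
    rw [← hy.equiv_one, LinearEquiv.symm_apply_apply, one_smul]
  have hnat₁ := R.class₁_comp_mk₀ x f h₁ p (R.extendForm ξ) (fun _ => rfl) (fun a => by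
    apply R.scalar.injective
    rw [d₁Aug_eq_sum, map_sum, map_sum, scalar_augmentationLin, hp, map_sum]
    refine Finset.sum_congr rfl fun i _ => ?_
    rw [map_smul, scalar_smul, map_smul, smul_eq_mul, mul_comm, scalar_extendForm])
  have hnat₂ := R.class₂_comp_mk₀' x f h₂ h₂' h₁ (by
    have : R.syzygyIncl x f ∘ₗ h₂ = h₂'.domRestrict (R.K x f) := by
      apply hy.hom_ext
      rw [LinearMap.comp_apply, hgen, syzygyIncl_mk, hc2]
      change _ = h₂' fun j => R.gen (y j)
      ext i
      rw [foxRow_apply, rightContract_potential, map_sum, map_sum]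
      simp only [h₂', Fintype.linearCombination_apply, Finset.sum_apply, Pi.smul_apply,
        foxRow_apply, smul_eq_mul]
      refine Finset.sum_congr rfl fun j _ => ?_
      rw [rightContract_mul_of_mem _ _ (rightContract_mem ξ (R.space_le (f j).2)), map_mul, proj_ι]
    exact fun z => LinearMap.congr_fun this z) h12
  rw [degreeTwo, ext₂Of, degreeOne_eq,
    Ext.comp_comp_of_naturality' _ _ _ _ _ _ _ _ _ hnat₁ hnat₂]
  refine (hy.ext₃Of_eq (R.relationForm x f η ∘ₗ h₂)).trans ?_
  congr 1
  rw [LinearMap.comp_apply, hgen, relationForm_mk]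
  have h2 : (⟨rightContract ξ (potential f y), hξ⟩ : R.space) = ∑ j, c j • f j := by
    apply Subtype.ext
    rw [AddSubmonoidClass.coe_finsetSum]
    exact hc
  rw [h2]
  simp

end Products

end HomogeneousRelations

/-! ### The Frobenius pairing and its automorphism. -/

/-- A linear automorphism `ν` of an algebra with a nondegenerate pairing `(x, y) = l (x y)` for
which `(x, y) = (y, ν x)` is an automorphism of algebras. -/
lemma exists_algEquiv_of_frobenius {k E : Type*} [Field k] [Ring E] [Algebra k E] (l : E →ₗ[k] k)
    (hl : ∀ x, (∀ y, l (y * x) = 0) → x = 0) (ν : E ≃ₗ[k] E)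
    (hν : ∀ x y, l (x * y) = l (y * ν x)) : ∃ ν' : E ≃ₐ[k] E, ∀ x, ν' x = ν x := by
  have ext : ∀ x x', (∀ y, l (y * x) = l (y * x')) → x = x' := by
    intro x x' h
    rw [← sub_eq_zero]
    refine hl _ fun y => ?_
    rw [mul_sub, map_sub, h, sub_self]
  refine ⟨AlgEquiv.ofLinearEquiv ν (ext _ _ fun y => ?_) (fun x y => ext _ _ fun z => ?_),
    fun _ => rfl⟩
  · rw [← hν, one_mul, mul_one]
  · rw [← hν, mul_assoc, hν, mul_assoc, hν, mul_assoc]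

namespace HomogeneousRelations

open TensorAlgebra

section Yoneda

variable {k V : Type u} [Field k] [AddCommGroup V] [Module k V] {N : ℕ}
  (R : HomogeneousRelations k V N)

/-- The free index `m` avoids transport along equalities of degrees. -/
lemma of_mul_of_eq {i j m : ℕ} (h : i + j = m) (a : R.ExtK i) (b : R.ExtK j) :
    DirectSum.of R.ExtK i a * DirectSum.of R.ExtK j b =
      DirectSum.of R.ExtK m (b.comp a (by omega)) := by
  subst h
  exact DirectSum.of_mul_of a b

lemma of_mul_of_apply_of_ne {i j m : ℕ} (h : i + j ≠ m) (a : R.ExtK i) (b : R.ExtK j) :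
    (DirectSum.of R.ExtK i a * DirectSum.of R.ExtK j b) m = 0 := by
  rw [R.of_mul_of_eq rfl]
  exact DirectSum.of_eq_of_ne _ _ _ (Ne.symm h)

lemma of_mul_of_apply {i j m : ℕ} (h : i + j = m) (a : R.ExtK i) (b : R.ExtK j) :
    (DirectSum.of R.ExtK i a * DirectSum.of R.ExtK j b) m = b.comp a (by omega) := by
  rw [R.of_mul_of_eq h]
  exact DirectSum.of_eq_same _ _

/-- The Frobenius pairing as a linear form in the product. -/
def frobeniusForm {D : ℕ} (uStar : Module.Dual k (R.ExtK D)) : R.Yoneda →ₗ[k] k :=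
  uStar ∘ₗ DirectSum.component k ℕ R.ExtK D

lemma frobeniusForm_mul {D : ℕ} (uStar : Module.Dual k (R.ExtK D)) (x y : R.Yoneda) :
    R.frobeniusForm uStar (x * y) = R.frobeniusPairing uStar x y := rfl

end Yoneda

variable {k V : Type u} [Field k] [AddCommGroup V] [Module k V]
  {R : HomogeneousRelations k V 3} {n r : ℕ} {x : Module.Basis (Fin n) k V}
  {f : Module.Basis (Fin r) k R.space}

/-- The isomorphism `V^* ≃ R` of contraction of the first letter of the potential. -/
def IsPotential.leftEquiv {w : TensorAlgebra k V} (hw : R.IsPotential w) :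
    Module.Dual k V ≃ₗ[k] R.space :=
  LinearEquiv.ofBijective
    { toFun := fun ξ => ⟨leftContract ξ w, hw.left_mem ξ⟩
      map_add' := fun ξ η => Subtype.ext (leftContract_add ξ η w)
      map_smul' := fun c ξ => Subtype.ext (leftContract_smul c ξ w) }
    ⟨(injective_iff_map_eq_zero _).2 fun ξ h => hw.left_injective ξ (congrArg Subtype.val h),
      fun t => (hw.left_surjective t t.2).imp fun _ h => Subtype.ext h⟩

/-- The isomorphism `V^* ≃ R` of contraction of the last letter of the potential. -/
def IsPotential.rightEquiv {w : TensorAlgebra k V} (hw : R.IsPotential w) :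
    Module.Dual k V ≃ₗ[k] R.space :=
  LinearEquiv.ofBijective
    { toFun := fun ξ => ⟨rightContract ξ w, hw.right_mem ξ⟩
      map_add' := fun ξ η => Subtype.ext (rightContract_add ξ η w)
      map_smul' := fun c ξ => Subtype.ext (rightContract_smul c ξ w) }
    ⟨(injective_iff_map_eq_zero _).2 fun ξ h => hw.right_injective ξ (congrArg Subtype.val h),
      fun t => (hw.right_surjective t t.2).imp fun _ h => Subtype.ext h⟩

section

variable {y : Module.Basis (Fin r) k V} (hy : IsKernelBasis x f y)

/-- The map `k × V^* × R^* × k → E(A)`. -/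
def IsKernelBasis.yonedaMap :
    (k × Module.Dual k V × Module.Dual k R.space × k) →ₗ[k] R.Yoneda :=
  DirectSum.lof k ℕ R.ExtK 0 ∘ₗ LinearMap.toSpanSingleton k (R.ExtK 0) (Ext.mk₀ (𝟙 R.trivialObj)) ∘ₗ
      LinearMap.fst k _ _ +
    DirectSum.lof k ℕ R.ExtK 1 ∘ₗ R.degreeOneLin x ∘ₗ LinearMap.fst k _ _ ∘ₗ LinearMap.snd k _ _ +
    DirectSum.lof k ℕ R.ExtK 2 ∘ₗ R.degreeTwoLin x f ∘ₗ LinearMap.fst k _ _ ∘ₗ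
      LinearMap.snd k _ _ ∘ₗ LinearMap.snd k _ _ +
    DirectSum.lof k ℕ R.ExtK 3 ∘ₗ LinearMap.toSpanSingleton k (R.ExtK 3) hy.top ∘ₗ
      LinearMap.snd k _ _ ∘ₗ LinearMap.snd k _ _ ∘ₗ LinearMap.snd k _ _

lemma IsKernelBasis.yonedaMap_apply (p : k × Module.Dual k V × Module.Dual k R.space × k) :
    hy.yonedaMap p = DirectSum.of R.ExtK 0 (p.1 • Ext.mk₀ (𝟙 R.trivialObj)) +
      DirectSum.of R.ExtK 1 (R.degreeOne p.2.1) +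
      DirectSum.of R.ExtK 2 (R.degreeTwo x f p.2.2.1) +
      DirectSum.of R.ExtK 3 (p.2.2.2 • hy.top) := rfl

lemma IsKernelBasis.yonedaMap_surjective (hA : R.IsASRegular 3) :
    Function.Surjective hy.yonedaMap := by
  rw [← LinearMap.range_eq_top, eq_top_iff]
  rintro z -
  induction z using DirectSum.induction_on with
  | zero => exact zero_mem _
  | add a b ha hb => exact add_mem ha hb
  | of i e =>
    match i, e with
    | 0, e =>
      obtain ⟨c, rfl⟩ := R.degreeZero_surjective e
      exact ⟨(c, 0, 0, 0), by
        simp only [yonedaMap, LinearMap.add_apply, LinearMap.comp_apply, LinearMap.fst_apply,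
          LinearMap.snd_apply, LinearMap.toSpanSingleton_apply, map_zero, add_zero]
        rfl⟩
    | 1, e =>
      obtain ⟨c, rfl⟩ := R.degreeOne_surjective x e
      exact ⟨(0, c, 0, 0), by simp [yonedaMap]; rfl⟩
    | 2, e =>
      obtain ⟨c, rfl⟩ := R.degreeTwo_surjective x f e
      exact ⟨(0, 0, c, 0), by simp [yonedaMap]; rfl⟩
    | 3, e =>
      obtain ⟨c, rfl⟩ := hy.top_surjective e
      exact ⟨(0, 0, 0, c), by
        simp only [yonedaMap, LinearMap.add_apply, LinearMap.comp_apply, LinearMap.fst_apply,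
          LinearMap.snd_apply, LinearMap.toSpanSingleton_apply, map_zero, add_zero,
          zero_add]
        rfl⟩
    | m + 4, e =>
      rw [hA.extK_eq_zero (by omega) e, map_zero]
      exact zero_mem _

variable (hw : R.IsPotential (potential f y)) (uStar : Module.Dual k (R.ExtK 3))

/-- Only complementary degrees contribute. The asymmetry of the two middle terms, left contraction
in one and right contraction in the other, is the whole source of `ν`. -/
lemma IsKernelBasis.frobeniusForm_yonedaMap
    (p q : k × Module.Dual k V × Module.Dual k R.space × k) :
    R.frobeniusForm uStar (hy.yonedaMap p * hy.yonedaMap q) =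
      (p.1 * q.2.2.2 + q.2.2.1 (hw.leftEquiv p.2.1) + p.2.2.1 (hw.rightEquiv q.2.1) +
        p.2.2.2 * q.1) * uStar hy.top := by
  change uStar ((hy.yonedaMap p * hy.yonedaMap q) 3) = _
  rw [yonedaMap_apply, yonedaMap_apply]
  have e12 : (R.degreeTwo x f q.2.2.1).comp (R.degreeOne p.2.1) (show 2 + 1 = 3 by omega) =
      q.2.2.1 (hw.leftEquiv p.2.1) • hy.top := hy.degreeTwo_comp_degreeOne _ _ (hw.left_mem _)
  have e21 : (R.degreeOne q.2.1).comp (R.degreeTwo x f p.2.2.1) (show 1 + 2 = 3 by omega) =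
      p.2.2.1 (hw.rightEquiv q.2.1) • hy.top := hy.degreeOne_comp_degreeTwo _ _ (hw.right_mem _)
  simp only [add_mul, mul_add, DirectSum.add_apply]
  rw [R.of_mul_of_apply (show 0 + 3 = 3 by omega), R.of_mul_of_apply (show 1 + 2 = 3 by omega),
    R.of_mul_of_apply (show 2 + 1 = 3 by omega), R.of_mul_of_apply (show 3 + 0 = 3 by omega),
    R.of_mul_of_apply_of_ne (show 0 + 0 ≠ 3 by omega),
    R.of_mul_of_apply_of_ne (show 0 + 1 ≠ 3 by omega),
    R.of_mul_of_apply_of_ne (show 0 + 2 ≠ 3 by omega),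
    R.of_mul_of_apply_of_ne (show 1 + 0 ≠ 3 by omega),
    R.of_mul_of_apply_of_ne (show 1 + 1 ≠ 3 by omega),
    R.of_mul_of_apply_of_ne (show 1 + 3 ≠ 3 by omega),
    R.of_mul_of_apply_of_ne (show 2 + 0 ≠ 3 by omega),
    R.of_mul_of_apply_of_ne (show 2 + 2 ≠ 3 by omega),
    R.of_mul_of_apply_of_ne (show 2 + 3 ≠ 3 by omega),
    R.of_mul_of_apply_of_ne (show 3 + 1 ≠ 3 by omega),
    R.of_mul_of_apply_of_ne (show 3 + 2 ≠ 3 by omega),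
    R.of_mul_of_apply_of_ne (show 3 + 3 ≠ 3 by omega), e12, e21]
  simp only [Ext.comp_smul, Ext.smul_comp, Ext.comp_mk₀_id, Ext.mk₀_id_comp, map_add, map_smul,
    map_zero, smul_eq_mul]
  ring

variable {uStar} (hu : uStar hy.top ≠ 0)
include hw hu

lemma IsKernelBasis.eq_zero_of_frobeniusForm {q : k × Module.Dual k V × Module.Dual k R.space × k}
    (h : ∀ p, R.frobeniusForm uStar (hy.yonedaMap p * hy.yonedaMap q) = 0) : q = 0 := by
  simp_rw [hy.frobeniusForm_yonedaMap hw, mul_eq_zero, or_iff_left hu] at h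
  obtain ⟨a, ξ, η, c⟩ := q
  have hc : c = 0 := by simpa using h (1, 0, 0, 0)
  have hη : η = 0 := by
    ext t
    obtain ⟨ξ', rfl⟩ := hw.leftEquiv.surjective t
    simpa using h (0, ξ', 0, 0)
  have hξ : ξ = 0 := by
    apply hw.rightEquiv.injective
    rw [map_zero, ← Module.forall_dual_apply_eq_zero_iff k]
    intro η'
    simpa using h (0, 0, η', 0)
  have ha : a = 0 := by simpa using h (0, 0, 0, 1)
  rw [hc, hη, hξ, ha]
  rfl

theorem IsKernelBasis.exists_frobeniusAutomorphism (hA : R.IsASRegular 3) :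
    ∃ ν : R.Yoneda ≃ₐ[k] R.Yoneda,
      R.IsFrobeniusAutomorphism uStar ν ∧
      (∀ ν' : R.Yoneda ≃ₐ[k] R.Yoneda, R.IsFrobeniusAutomorphism uStar ν' → ν' = ν) ∧
      ∀ ξ, ν (DirectSum.of R.ExtK 1 (R.degreeOne ξ)) =
        DirectSum.of R.ExtK 1 (R.degreeOne (hw.rightEquiv.symm (hw.leftEquiv ξ))) := by
  have hinj : Function.Injective hy.yonedaMap := by
    rw [← LinearMap.ker_eq_bot, LinearMap.ker_eq_bot']
    intro q hq
    refine hy.eq_zero_of_frobeniusForm hw hu fun p => ?_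
    rw [hq, mul_zero, map_zero]
  have hsurj := hy.yonedaMap_surjective hA
  let Φ := LinearEquiv.ofBijective hy.yonedaMap ⟨hinj, hsurj⟩
  have hΦ : ∀ p, Φ p = hy.yonedaMap p := fun _ => rfl
  have hnd : ∀ z, (∀ z', R.frobeniusForm uStar (z' * z) = 0) → z = 0 := by
    intro z hz
    obtain ⟨q, rfl⟩ := hsurj z
    rw [hy.eq_zero_of_frobeniusForm hw hu fun p => hz _, map_zero]
  -- Solution of `(x, y) = (y, ν x)` degree by degree: the identity at both ends, `D⁻¹ L` on `V^*`
  -- and the transpose of `D L⁻¹` on `R^*`.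
  let δ : (k × Module.Dual k V × Module.Dual k R.space × k) ≃ₗ[k]
      (k × Module.Dual k V × Module.Dual k R.space × k) :=
    (LinearEquiv.refl k k).prodCongr ((hw.leftEquiv.trans hw.rightEquiv.symm).prodCongr
      ((hw.leftEquiv.symm.trans hw.rightEquiv).dualMap.prodCongr (LinearEquiv.refl k k)))
  have hδ : ∀ a ξ η c, δ (a, ξ, η, c) = (a, hw.rightEquiv.symm (hw.leftEquiv ξ),
    η ∘ₗ (hw.leftEquiv.symm.trans hw.rightEquiv).toLinearMap, c) := fun _ _ _ _ => rfl
  let ν₀ := (Φ.symm.trans δ).trans Φ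
  have hν₀ : ∀ p, ν₀ (hy.yonedaMap p) = hy.yonedaMap (δ p) := by
    intro p
    rw [← hΦ, ← hΦ]
    simp [ν₀]
  have hfrob : ∀ a b, R.frobeniusForm uStar (a * b) = R.frobeniusForm uStar (b * ν₀ a) := by
    intro a b
    obtain ⟨⟨a, ξ, η, c⟩, rfl⟩ := hsurj a
    obtain ⟨⟨a', ξ', η', c'⟩, rfl⟩ := hsurj b
    rw [hν₀, hδ, hy.frobeniusForm_yonedaMap hw, hy.frobeniusForm_yonedaMap hw]
    simp
    left
    ring
  obtain ⟨ν, hν⟩ := exists_algEquiv_of_frobenius _ hnd ν₀ hfrob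
  refine ⟨ν, fun a b => ?_, fun ν' hν' => ?_, fun ξ => ?_⟩
  · rw [hν, ← frobeniusForm_mul, ← frobeniusForm_mul]
    exact hfrob a b
  · refine AlgEquiv.ext fun a => ?_
    rw [hν, ← sub_eq_zero]
    refine hnd _ fun b => ?_
    rw [mul_sub, map_sub, ← hfrob, frobeniusForm_mul, frobeniusForm_mul, ← hν', sub_self]
  · have h1 : ∀ ξ, DirectSum.of R.ExtK 1 (R.degreeOne ξ) = hy.yonedaMap (0, ξ, 0, 0) := by
      intro ξ
      simp [yonedaMap]
      rfl
    rw [h1, h1, hν, hν₀, hδ, LinearMap.zero_comp]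

lemma IsKernelBasis.degreeOne_injective {ξ ξ' : Module.Dual k V}
    (h : R.degreeOne ξ = R.degreeOne ξ') : ξ = ξ' := by
  have h1 : ((0, ξ, 0, 0) : k × Module.Dual k V × Module.Dual k R.space × k) - (0, ξ', 0, 0) = 0 := by
    apply hy.eq_zero_of_frobeniusForm hw hu
    intro p
    have h2 : hy.yonedaMap (0, ξ, 0, 0) = hy.yonedaMap (0, ξ', 0, 0) := by
      rw [yonedaMap_apply, yonedaMap_apply, h]
    rw [map_sub, h2, sub_self, mul_zero, map_zero]
  exact congrArg (fun p => p.2.1) (sub_eq_zero.1 h1)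

end

end HomogeneousRelations

/-! ### Invariance of the potential under its twist. -/

namespace TensorAlgebra

variable {k V : Type u} [Field k] [AddCommGroup V] [Module k V]

lemma leftContract_rightContract (ξ η : Module.Dual k V) {t : TensorAlgebra k V} {m : ℕ}
    (ht : t ∈ homogeneous k V (m + 2)) :
    leftContract ξ (rightContract η t) = rightContract η (leftContract ξ t) := by
  refine homogeneous_succ_induction_right (m := m + 1) (p := fun t =>
    leftContract ξ (rightContract η t) = rightContract η (leftContract ξ t)) ?_ ?_ ht
  · intro s hs v
    rw [rightContract_mul_ι, map_smul, leftContract_mul_of_mem ξ _ hs, rightContract_mul_ι]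
  · intro s t hs ht
    simp only [map_add, hs, ht]

lemma leftContract_eq_rightContract (ξ : Module.Dual k V) {t : TensorAlgebra k V}
    (ht : t ∈ homogeneous k V 1) : leftContract ξ t = rightContract ξ t := by
  rw [homogeneous, pow_one] at ht
  obtain ⟨v, rfl⟩ := ht
  rw [leftContract_ι, rightContract_ι]

/-- Contracting the four letters of `t ∈ V^{⊗4}` from the left or from the right. -/
lemma leftContract_four (ξ₁ ξ₂ ξ₃ ξ₄ : Module.Dual k V) {t : TensorAlgebra k V}
    (ht : t ∈ homogeneous k V 4) :
    leftContract ξ₄ (leftContract ξ₃ (leftContract ξ₂ (leftContract ξ₁ t))) =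
      rightContract ξ₁ (rightContract ξ₂ (rightContract ξ₃ (rightContract ξ₄ t))) := by
  have hl : ∀ {m : ℕ} {s : TensorAlgebra k V} (ξ : Module.Dual k V),
    s ∈ homogeneous k V (m + 1) → leftContract ξ s ∈ homogeneous k V m :=
    fun ξ hs => leftContract_mem ξ hs
  have hr : ∀ {m : ℕ} {s : TensorAlgebra k V} (ξ : Module.Dual k V),
    s ∈ homogeneous k V (m + 1) → rightContract ξ s ∈ homogeneous k V m :=
    fun ξ hs => rightContract_mem ξ hs
  have h4 := hr ξ₄ ht
  have h34 := hr ξ₃ h4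
  have h234 := hr ξ₂ h34
  rw [leftContract_eq_rightContract ξ₄ (hl ξ₃ (hl ξ₂ (hl ξ₁ ht))),
    ← leftContract_rightContract ξ₃ ξ₄ (hl ξ₂ (hl ξ₁ ht)),
    ← leftContract_rightContract ξ₂ ξ₄ (hl ξ₁ ht), ← leftContract_rightContract ξ₁ ξ₄ ht,
    leftContract_eq_rightContract ξ₃ (hl ξ₂ (hl ξ₁ h4)),
    ← leftContract_rightContract ξ₂ ξ₃ (hl ξ₁ h4), ← leftContract_rightContract ξ₁ ξ₃ h4,
    leftContract_eq_rightContract ξ₂ (hl ξ₁ h34), ← leftContract_rightContract ξ₁ ξ₂ h34,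
    leftContract_eq_rightContract ξ₁ h234]

lemma eq_of_leftContract_eq [FiniteDimensional k V] {s t : TensorAlgebra k V} {m : ℕ}
    (hs : s ∈ homogeneous k V (m + 1)) (ht : t ∈ homogeneous k V (m + 1))
    (h : ∀ ξ, leftContract ξ s = leftContract ξ t) : s = t := by
  rw [← sum_mul_leftContract (Module.finBasis k V) hs,
    ← sum_mul_leftContract (Module.finBasis k V) ht]
  exact Finset.sum_congr rfl fun i _ => by rw [h]

/-- The endomorphism of the tensor algebra induced by an endomorphism of `V`. -/
def mapEnd (θ : V →ₗ[k] V) : TensorAlgebra k V →ₐ[k] TensorAlgebra k V := lift k (ι k ∘ₗ θ)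

lemma mapEnd_ι (θ : V →ₗ[k] V) (v : V) : mapEnd θ (ι k v) = ι k (θ v) := by
  simp [mapEnd]

lemma mapEnd_mem (θ : V →ₗ[k] V) {t : TensorAlgebra k V} {m : ℕ} (ht : t ∈ homogeneous k V m) :
    mapEnd θ t ∈ homogeneous k V m := by
  induction m generalizing t with
  | zero =>
    obtain ⟨c, rfl⟩ := mem_homogeneous_zero ht
    rw [AlgHom.commutes]
    exact ht
  | succ m ih =>
    refine homogeneous_succ_induction_right (p := fun t => mapEnd θ t ∈ _) ?_ ?_ ht
    · intro s hs v
      rw [map_mul, mapEnd_ι]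
      exact mul_mem_homogeneous (ih hs) (ι_mem_homogeneous _)
    · intro s t hs ht
      rw [map_add]
      exact add_mem hs ht

lemma mapEnd_comp (θ θ' : V →ₗ[k] V) (t : TensorAlgebra k V) :
    mapEnd θ (mapEnd θ' t) = mapEnd (θ ∘ₗ θ') t := by
  have : (mapEnd θ).comp (mapEnd θ') = mapEnd (θ ∘ₗ θ') := by
    ext v
    simp [mapEnd_ι]
  exact DFunLike.congr_fun this t

lemma mapEnd_id (t : TensorAlgebra k V) : mapEnd LinearMap.id t = t := by
  have : mapEnd (LinearMap.id : V →ₗ[k] V) = AlgHom.id k _ := by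
    ext v
    simp [mapEnd_ι]
  exact DFunLike.congr_fun this t

lemma leftContract_mapEnd (θ : V →ₗ[k] V) (ξ : Module.Dual k V) {t : TensorAlgebra k V} {m : ℕ}
    (ht : t ∈ homogeneous k V (m + 1)) :
    leftContract ξ (mapEnd θ t) = mapEnd θ (leftContract (ξ ∘ₗ θ) t) := by
  refine homogeneous_succ_induction_left (p := fun t =>
    leftContract ξ (mapEnd θ t) = mapEnd θ (leftContract (ξ ∘ₗ θ) t)) ?_ ?_ ht
  · intro s _ v
    rw [map_mul, mapEnd_ι, leftContract_ι_mul, leftContract_ι_mul, map_smul]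
    rfl
  · intro s t hs ht
    simp only [map_add, hs, ht]

/-- A twisted potential of degree four is invariant under its twist. -/
lemma mapEnd_eq_self [FiniteDimensional k V] {w : TensorAlgebra k V} (hw : w ∈ homogeneous k V 4)
    (θ : V →ₗ[k] V) (h : ∀ ξ, rightContract ξ w = leftContract (ξ ∘ₗ θ) w) : mapEnd θ w = w := by
  have hl : ∀ {m : ℕ} {s : TensorAlgebra k V} (ξ : Module.Dual k V),
    s ∈ homogeneous k V (m + 1) → leftContract ξ s ∈ homogeneous k V m :=
    fun ξ hs => leftContract_mem ξ hs
  have hr : ∀ {m : ℕ} {s : TensorAlgebra k V} (ξ : Module.Dual k V),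
    s ∈ homogeneous k V (m + 1) → rightContract ξ s ∈ homogeneous k V m :=
    fun ξ hs => rightContract_mem ξ hs
  have hw' := mapEnd_mem θ hw
  refine eq_of_leftContract_eq hw' hw fun ξ₁ => ?_
  refine eq_of_leftContract_eq (hl _ hw') (hl _ hw) fun ξ₂ => ?_
  refine eq_of_leftContract_eq (hl _ (hl _ hw')) (hl _ (hl _ hw)) fun ξ₃ => ?_
  refine eq_of_leftContract_eq (hl _ (hl _ (hl _ hw'))) (hl _ (hl _ (hl _ hw))) fun ξ₄ => ?_
  -- Contracting `θ w` with the `ξᵢ` amounts to contracting `w` with the `ξᵢ ∘ θ`. By `h` each left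
  -- contraction of `w` with `ξᵢ ∘ θ` is a right contraction with `ξᵢ`; as the two kinds commute,
  -- the letters change sides one at a time. What remains is a scalar, which `mapEnd θ` fixes.
  rw [leftContract_mapEnd θ ξ₁ hw, leftContract_mapEnd θ ξ₂ (hl _ hw),
    leftContract_mapEnd θ ξ₃ (hl _ (hl _ hw)), leftContract_mapEnd θ ξ₄ (hl _ (hl _ (hl _ hw))),
    leftContract_four ξ₁ ξ₂ ξ₃ ξ₄ hw, ← h, leftContract_rightContract _ _ hw, ← h,
    leftContract_rightContract _ _ (hr _ hw), leftContract_rightContract _ _ hw, ← h,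
    leftContract_rightContract _ _ (hr _ (hr _ hw)), leftContract_rightContract _ _ (hr _ hw),
    leftContract_rightContract _ _ hw, ← h]
  obtain ⟨c, hc⟩ := mem_homogeneous_zero (hr ξ₁ (hr ξ₂ (hr ξ₃ (hr ξ₄ hw))))
  rw [← hc, AlgHom.commutes]

end TensorAlgebra

/-! ### The automorphism of `A` induced by the twist. -/

namespace HomogeneousRelations

open TensorAlgebra

variable {k V : Type u} [Field k] [AddCommGroup V] [Module k V]

section Automorphism

variable {N : ℕ} (R : HomogeneousRelations k V N)

lemma lift_gen_comp (θ : V →ₗ[k] V) (t : TensorAlgebra k V) :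
    TensorAlgebra.lift k (R.gen ∘ₗ θ) t = R.proj (mapEnd θ t) := by
  have : TensorAlgebra.lift k (R.gen ∘ₗ θ) = R.proj.comp (mapEnd θ) := by
    ext v
    simp [mapEnd_ι, proj_ι]
  exact DFunLike.congr_fun this t

/-- The automorphism of `A` induced by an automorphism of `V` which preserves the relations. -/
def mapEquiv (θ : V ≃ₗ[k] V) (h : ∀ r ∈ R.space, mapEnd θ.toLinearMap r ∈ R.space)
    (h' : ∀ r ∈ R.space, mapEnd θ.symm.toLinearMap r ∈ R.space) : R.Alg ≃ₐ[k] R.Alg :=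
  AlgEquiv.ofAlgHom
    (R.lift (R.gen ∘ₗ θ.toLinearMap) fun r hr => by
      rw [lift_gen_comp, R.proj_eq_zero (h r hr)])
    (R.lift (R.gen ∘ₗ θ.symm.toLinearMap) fun r hr => by
      rw [lift_gen_comp, R.proj_eq_zero (h' r hr)])
    (R.algHom_ext fun v => by simp [lift_gen])
    (R.algHom_ext fun v => by simp [lift_gen])

lemma mapEquiv_gen (θ : V ≃ₗ[k] V) (h : ∀ r ∈ R.space, mapEnd θ.toLinearMap r ∈ R.space)
    (h' : ∀ r ∈ R.space, mapEnd θ.symm.toLinearMap r ∈ R.space) (v : V) :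
    R.mapEquiv θ h h' (R.gen v) = R.gen (θ v) := R.lift_gen _ _ v

lemma algEquiv_ext {φ ψ : R.Alg ≃ₐ[k] R.Alg} (h : ∀ v, φ (R.gen v) = ψ (R.gen v)) : φ = ψ := by
  have := R.algHom_ext (f := φ.toAlgHom) (g := ψ.toAlgHom) h
  exact AlgEquiv.ext fun a => DFunLike.congr_fun this a

lemma parity_pow_four : R.parity ^ (3 + 1) = 1 := by
  refine R.algEquiv_ext fun v => ?_
  simp [pow_succ, parity_gen]

lemma finite_space [Module.Finite k V] : Module.Finite k R.space := by
  have hfg : (homogeneous k V N).FG := by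
    have : (LinearMap.range (ι k (M := V))).FG := by
      rw [← Module.Finite.iff_fg]
      infer_instance
    exact this.pow N
  have := Module.Finite.iff_fg.2 hfg
  exact Submodule.finiteDimensional_of_le R.space_le

end Automorphism

variable {R : HomogeneousRelations k V 3}

section Potential

variable {w : TensorAlgebra k V} (hw : R.IsPotential w)
include hw

/-- The automorphism of `V` whose transpose is `ξ ↦ ξ'`, `D_{ξ'} w = L_ξ w`. -/
lemma IsPotential.exists_twist [FiniteDimensional k V] :
    ∃ θ : V ≃ₗ[k] V, ∀ ξ : Module.Dual k V,
      ξ ∘ₗ θ.toLinearMap = hw.rightEquiv.symm (hw.leftEquiv ξ) := by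
  refine ⟨((Module.evalEquiv k V).trans
    (hw.leftEquiv.trans hw.rightEquiv.symm).dualMap).trans (Module.evalEquiv k V).symm,
    fun ξ => ?_⟩
  refine LinearMap.ext fun v => ?_
  change ξ ((Module.evalEquiv k V).symm _) = _
  rw [Module.apply_evalEquiv_symm_apply]
  rfl

variable {θ : V ≃ₗ[k] V}
  (hθ : ∀ ξ : Module.Dual k V, ξ ∘ₗ θ.toLinearMap = hw.rightEquiv.symm (hw.leftEquiv ξ))
include hθ

lemma IsPotential.rightContract_comp_twist (ξ : Module.Dual k V) :
    rightContract (ξ ∘ₗ θ.toLinearMap) w = leftContract ξ w := by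
  rw [hθ]
  exact congrArg Subtype.val (hw.rightEquiv.apply_symm_apply (hw.leftEquiv ξ))

lemma IsPotential.leftContract_comp_symm (ξ : Module.Dual k V) :
    rightContract ξ w = leftContract (ξ ∘ₗ θ.symm.toLinearMap) w := by
  have h : (ξ ∘ₗ θ.symm.toLinearMap) ∘ₗ θ.toLinearMap = ξ := by ext v; simp
  rw [← hw.rightContract_comp_twist hθ, h]

/-- `θ⁻¹` fixes `w`, and `R` is the space of left contractions of `w`; contraction intertwines `θ⁻¹`
on tensors with composition on forms. -/
lemma IsPotential.mapEnd_symm_mem [FiniteDimensional k V] {r : TensorAlgebra k V}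
    (hr : r ∈ R.space) :
    mapEnd θ.symm.toLinearMap r ∈ R.space := by
  obtain ⟨ξ, rfl⟩ := hw.left_surjective r hr
  have h1 := mapEnd_eq_self hw.mem θ.symm.toLinearMap (hw.leftContract_comp_symm hθ)
  have h2 := leftContract_mapEnd (m := 3) θ.symm.toLinearMap (ξ ∘ₗ θ.toLinearMap) hw.mem
  have h3 : (ξ ∘ₗ θ.toLinearMap) ∘ₗ θ.symm.toLinearMap = ξ := by ext v; simp
  rw [h1, h3] at h2
  rw [← h2]
  exact hw.left_mem _

lemma IsPotential.mapEnd_mem [FiniteDimensional k V] {r : TensorAlgebra k V} (hr : r ∈ R.space) :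
    mapEnd θ.toLinearMap r ∈ R.space := by
  obtain ⟨ξ, rfl⟩ := hw.left_surjective r hr
  have h1 := mapEnd_eq_self hw.mem θ.symm.toLinearMap (hw.leftContract_comp_symm hθ)
  have h2 := leftContract_mapEnd (m := 3) θ.symm.toLinearMap ξ hw.mem
  rw [h1] at h2
  rw [h2, mapEnd_comp]
  have h3 : θ.toLinearMap ∘ₗ θ.symm.toLinearMap = LinearMap.id := by ext v; simp
  rw [h3, mapEnd_id]
  exact hw.left_mem _

end Potential

/-! ### The Artin–Schelter matrix. -/

section ArtinSchelter

variable {w : TensorAlgebra k V} (hw : R.IsPotential w) (x : Module.Basis (Fin 2) k V)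
include hw

/-- The two bases of `R` are the left and right contractions of `w` with the dual basis of `x`. -/
lemma IsPotential.exists_isArtinSchelterMatrix :
    ∃ Q : Matrix (Fin 2) (Fin 2) k, R.IsArtinSchelterMatrix x Q := by
  let f : Module.Basis (Fin 2) k R.space := x.dualBasis.map hw.leftEquiv
  let g : Module.Basis (Fin 2) k R.space := x.dualBasis.map hw.rightEquiv
  have hf : ∀ i, (f i : TensorAlgebra k V) = leftContract (x.coord i) w := fun i => by
    simp only [f, Module.Basis.map_apply, Module.Basis.coe_dualBasis]
    rfl
  have hg : ∀ i, (g i : TensorAlgebra k V) = rightContract (x.coord i) w := fun i => by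
    simp only [g, Module.Basis.map_apply, Module.Basis.coe_dualBasis]
    rfl
  refine ⟨Matrix.of fun i j => f.repr (g i) j, f, g, ?_, fun i => ?_⟩
  · simp_rw [hf, hg]
    rw [sum_mul_leftContract (m := 3) x hw.mem, sum_rightContract_mul (m := 3) x hw.mem]
  · exact (f.sum_repr (g i)).symm

/-- The element `∑ xᵢ fᵢ = ∑ gᵢ xᵢ` lies in `V ⊗ R ∩ R ⊗ V`, so it is a non-zero multiple of `w`.
Its contractions are the `fᵢ` and the `gᵢ`, and the factor cancels; so `Q` depends only on `w` and
`x`. -/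
lemma IsPotential.rightContract_eq_of_isArtinSchelterMatrix {Q : Matrix (Fin 2) (Fin 2) k}
    (hQ : R.IsArtinSchelterMatrix x Q) (i : Fin 2) :
    rightContract (x.coord i) w = ∑ j, Q i j • leftContract (x.coord j) w := by
  obtain ⟨f, g, hfg, hgf⟩ := hQ
  set w' := ∑ i, ι k (x i) * (f i : TensorAlgebra k V) with hw'
  have hmem : w' ∈ homogeneous k V 4 := Submodule.sum_mem _ fun i _ => by
    have := mul_mem_homogeneous (ι_mem_homogeneous (x i)) (R.space_le (f i).2)
    exact this
  have hl : ∀ ξ, leftContract ξ w' = ∑ i, ξ (x i) • (f i : TensorAlgebra k V) :=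
    fun ξ => leftContract_sum_mul x ξ _
  have hr : ∀ ξ, rightContract ξ w' = ∑ i, ξ (x i) • (g i : TensorAlgebra k V) :=
    fun ξ => by rw [hfg]; exact rightContract_sum_mul x ξ _
  obtain ⟨c, hc⟩ := hw.exists_smul w' hmem
    (fun ξ => by rw [hl]; exact R.sum_smul_mem f _) (fun ξ => by rw [hr]; exact R.sum_smul_mem g _)
  have hl' : ∀ i, leftContract (x.coord i) w' = f i := fun i =>
    leftContract_coord_sum_mul x _ i
  have hr' : ∀ i, rightContract (x.coord i) w' = g i := fun i => by
    rw [hfg]; exact rightContract_coord_sum_mul x _ i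
  have hc0 : c ≠ 0 := by
    rintro rfl
    apply f.ne_zero 0
    apply Subtype.ext
    rw [← hl', hc, zero_smul, map_zero]
    rfl
  have h1 : c • rightContract (x.coord i) w = c • ∑ j, Q i j • leftContract (x.coord j) w := by
    rw [← map_smul, ← hc, hr', hgf, Finset.smul_sum, AddSubmonoidClass.coe_finsetSum]
    refine Finset.sum_congr rfl fun j _ => ?_
    have h2 : c • leftContract (x.coord j) w = f j := by rw [← map_smul, ← hc, hl']
    rw [smul_comm, h2]
    rfl
  exact smul_right_injective _ hc0 h1

lemma IsPotential.isArtinSchelterMatrix_unique {Q Q' : Matrix (Fin 2) (Fin 2) k}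
    (hQ : R.IsArtinSchelterMatrix x Q) (hQ' : R.IsArtinSchelterMatrix x Q') : Q = Q' := by
  ext i j
  have h1 := hw.rightContract_eq_of_isArtinSchelterMatrix x hQ i
  rw [hw.rightContract_eq_of_isArtinSchelterMatrix x hQ' i, ← sub_eq_zero,
    ← Finset.sum_sub_distrib] at h1
  simp_rw [← sub_smul, ← leftContract_smul] at h1
  have hsum : ∀ c : Fin 2 → k, ∑ j, leftContract (c j • x.coord j) w =
      leftContract (∑ j, c j • x.coord j) w := fun c => by
    simp [Fin.sum_univ_two, leftContract_add]
  rw [hsum] at h1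
  have h2 := LinearMap.congr_fun (hw.left_injective _ h1) (x j)
  simp only [LinearMap.sum_apply, LinearMap.smul_apply, Module.Basis.coord_apply,
    Module.Basis.repr_self, Finsupp.single_apply, smul_eq_mul, mul_ite, mul_one, mul_zero,
    Finset.sum_ite_eq, Finset.mem_univ, if_true, LinearMap.zero_apply] at h2
  exact (sub_eq_zero.1 h2).symm

omit hw in
lemma isUnit_det_of_isArtinSchelterMatrix {Q : Matrix (Fin 2) (Fin 2) k}
    (hQ : R.IsArtinSchelterMatrix x Q) : IsUnit Q.det := by
  obtain ⟨f, g, -, hgf⟩ := hQ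
  have h : f.toMatrix g = Q.transpose := by
    ext i j
    rw [Module.Basis.toMatrix_apply, hgf]
    fin_cases i <;> simp
  rw [← Matrix.det_transpose, ← h]
  exact Matrix.isUnit_det_of_right_inverse (Module.Basis.toMatrix_mul_toMatrix_flip f g)

/-- The map `θ'` with the asserted matrix satisfies the equation that characterises the twist, `D_{ξ
∘ θ'} w = L_ξ w`, and `D` is injective. -/
lemma IsPotential.twist_apply {θ : V ≃ₗ[k] V}
    (hθ : ∀ ξ : Module.Dual k V, ξ ∘ₗ θ.toLinearMap = hw.rightEquiv.symm (hw.leftEquiv ξ))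
    {Q : Matrix (Fin 2) (Fin 2) k} (hQ : R.IsArtinSchelterMatrix x Q) (i : Fin 2) :
    θ (x i) = ∑ j, (Q⁻¹).transpose i j • x j := by
  have hdet := isUnit_det_of_isArtinSchelterMatrix x hQ
  let θ' : V →ₗ[k] V := x.constr k fun i => ∑ j, (Q⁻¹).transpose i j • x j
  have hθ' : ∀ i, θ' (x i) = ∑ j, Q⁻¹ j i • x j := fun i => x.constr_basis _ _ i
  have key : ∀ ξ : Module.Dual k V, rightContract (ξ ∘ₗ θ') w = leftContract ξ w := by
    intro ξ
    rw [rightContract_eq_sum (m := 3) x _ hw.mem, leftContract_eq_sum (m := 3) x _ hw.mem]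
    simp_rw [hw.rightContract_eq_of_isArtinSchelterMatrix x hQ, LinearMap.comp_apply, hθ', map_sum,
      map_smul, Finset.smul_sum, Finset.sum_smul, smul_eq_mul, smul_smul]
    have hinv : ∀ j m, ∑ i, Q⁻¹ j i * Q i m = if j = m then 1 else 0 := by
      intro j m
      rw [← Matrix.mul_apply, Matrix.nonsing_inv_mul Q hdet, Matrix.one_apply]
    calc _ = ∑ j, ∑ m, (∑ i, Q⁻¹ j i * Q i m) • ξ (x j) • leftContract (x.coord m) w := by
          simp only [Fin.sum_univ_two, smul_smul]
          module
      _ = _ := by simp [hinv]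
  have h : θ' = θ.toLinearMap := by
    refine LinearMap.ext fun v => ?_
    rw [← sub_eq_zero, ← Module.forall_dual_apply_eq_zero_iff k]
    intro ξ
    have h2 : ξ ∘ₗ θ' = ξ ∘ₗ θ.toLinearMap := by
      apply hw.rightEquiv.injective
      apply Subtype.ext
      exact (key ξ).trans (hw.rightContract_comp_twist hθ ξ).symm
    rw [map_sub]
    exact sub_eq_zero.2 (LinearMap.congr_fun h2 v)
  have := LinearMap.congr_fun h (x i)
  rw [hθ'] at this
  exact this.symm

end ArtinSchelter

end HomogeneousRelations

theorem proposition6p5 {k V : Type u} [Field k] [AddCommGroup V] [Module k V]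
    [FiniteDimensional k V] (R : HomogeneousRelations k V 3) (hA : R.IsASRegular 3) :
    Module.finrank k V = 2 ∧
    (∀ x : Module.Basis (Fin 2) k V,
      ∃! Q : Matrix (Fin 2) (Fin 2) k, R.IsArtinSchelterMatrix x Q) ∧
    Module.finrank k (R.ExtK 3) = 1 ∧
    ∀ uStar : Module.Dual k (R.ExtK 3), uStar ≠ 0 →
      ∃ (ν : R.Yoneda ≃ₐ[k] R.Yoneda) (φ : R.Alg ≃ₐ[k] R.Alg),
        (R.IsFrobeniusAutomorphism uStar ν ∧
          ∀ ν' : R.Yoneda ≃ₐ[k] R.Yoneda, R.IsFrobeniusAutomorphism uStar ν' → ν' = ν) ∧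
        (R.IsTransposedAutomorphism ν φ ∧
          ∀ φ' : R.Alg ≃ₐ[k] R.Alg, R.IsTransposedAutomorphism ν φ' → φ' = φ) ∧
        (∀ (x : Module.Basis (Fin 2) k V) (Q : Matrix (Fin 2) (Fin 2) k),
          R.IsArtinSchelterMatrix x Q → IsUnit Q.det ∧
            ∀ i, φ (R.gen (x i)) = ∑ j, (Q⁻¹).transpose i j • R.gen (x j)) ∧
        (R.parity ^ (3 + 1) * φ = 1 ↔ R.IsTypeA) := by
  have := R.finite_space
  let f := Module.finBasis k R.space
  -- The first use only provides a basis of `V` with the same index as `f`, which gives `dim V = dim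
  -- R`; the second is made with that basis, as the dimension count requires.
  obtain ⟨x₀, -⟩ := hA.exists_isKernelBasis (Module.finBasis k V) f
  obtain ⟨y, hy⟩ := hA.exists_isKernelBasis x₀ f
  have hw := hy.isPotential x₀ f hA
  have hdim : Module.finrank k V = 2 := by
    rw [Module.finrank_eq_card_basis x₀, Fintype.card_fin, hy.card_eq_two hA]
  have hgen := HomogeneousRelations.gen_injective x₀ f
  refine ⟨hdim, fun x => ?_, ?_, fun uStar hu => ?_⟩
  · obtain ⟨Q, hQ⟩ := hw.exists_isArtinSchelterMatrix x
    exact ⟨Q, hQ, fun Q' hQ' => hw.isArtinSchelterMatrix_unique x hQ' hQ⟩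
  · exact finrank_eq_one_iff'.2 ⟨hy.top, hy.top_ne_zero, hy.top_surjective⟩
  · have hu' : uStar hy.top ≠ 0 := by
      intro h
      apply hu
      ext e
      obtain ⟨c, rfl⟩ := hy.top_surjective e
      rw [map_smul, h, smul_zero, LinearMap.zero_apply]
    obtain ⟨ν, hν, hνu, hν1⟩ := hy.exists_frobeniusAutomorphism hw hu' hA
    obtain ⟨θ, hθ⟩ := hw.exists_twist
    let φ := R.mapEquiv θ (fun _ => hw.mapEnd_mem hθ) (fun _ => hw.mapEnd_symm_mem hθ)
    have hφ : ∀ v, φ (R.gen v) = R.gen (θ v) := R.mapEquiv_gen θ _ _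
    have hφx : ∀ (x : Module.Basis (Fin 2) k V) (Q : Matrix (Fin 2) (Fin 2) k),
        R.IsArtinSchelterMatrix x Q →
          ∀ i, φ (R.gen (x i)) = ∑ j, (Q⁻¹).transpose i j • R.gen (x j) := by
      intro x Q hQ i
      rw [hφ, hw.twist_apply x hθ hQ, map_sum]
      simp_rw [map_smul]
    refine ⟨ν, φ, ⟨hν, hνu⟩, ⟨⟨θ.toLinearMap, hφ, fun ξ => ?_⟩, fun φ' ⟨φ₁, h1, h2⟩ => ?_⟩,
      fun x Q hQ => ⟨HomogeneousRelations.isUnit_det_of_isArtinSchelterMatrix x hQ, hφx x Q hQ⟩, ?_⟩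
    · rw [hν1, hθ]
    · refine R.algEquiv_ext fun v => ?_
      rw [h1, hφ]
      congr 1
      -- `φ₁` and `θ` have the same transpose, because `degreeOne` is injective, and linear forms
      -- separate the points of `V`.
      rw [← sub_eq_zero, ← Module.forall_dual_apply_eq_zero_iff k]
      intro ξ
      have h3 : ξ ∘ₗ φ₁ = ξ ∘ₗ θ.toLinearMap := by
        apply hy.degreeOne_injective hw hu'
        apply DirectSum.of_injective (β := R.ExtK) 1
        rw [← h2, hν1, hθ]
      rw [map_sub]
      exact sub_eq_zero.2 (LinearMap.congr_fun h3 v)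
    -- Since `ε⁴ = 1`, the condition is `φ = 1`. It forces `Q⁻¹ = 1` in any basis, so an arbitrary
    -- one serves as witness.
    · rw [R.parity_pow_four, one_mul]
      constructor
      · intro h
        let x := Module.finBasisOfFinrankEq k V hdim
        obtain ⟨Q, hQ⟩ := hw.exists_isArtinSchelterMatrix x
        have hdet := HomogeneousRelations.isUnit_det_of_isArtinSchelterMatrix x hQ
        have hQ1 : Q⁻¹ = 1 := by
          ext j i
          have h1 := hφx x Q hQ i
          rw [h] at h1
          simp_rw [← map_smul, ← map_sum] at h1
          have h2 := congrArg (fun v => x.repr v j) (hgen h1)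
          simp only [map_sum, map_smul, Module.Basis.repr_self, Finsupp.coe_finsetSum,
            Finset.sum_apply, Finsupp.smul_apply, Finsupp.single_apply, smul_eq_mul, mul_ite,
            mul_one, mul_zero, Finset.sum_ite_eq', Finset.mem_univ, if_true,
            Matrix.transpose_apply] at h2
          rw [← h2, Matrix.one_apply]
          simp [eq_comm]
        refine ⟨x, ?_⟩
        have hQ2 : Q = 1 := by
          rw [← Matrix.nonsing_inv_nonsing_inv Q hdet, hQ1, inv_one]
        rw [← hQ2]
        exact hQ
      · rintro ⟨x, hx⟩
        refine R.algEquiv_ext fun v => ?_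
        have hθ1 : θ.toLinearMap = LinearMap.id := by
          refine x.ext fun i => ?_
          have := hw.twist_apply x hθ hx i
          simpa [Matrix.one_apply] using this
        rw [hφ]
        exact congrArg R.gen (LinearMap.congr_fun hθ1 v)
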